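/- **Setting.** Let $k,V_0,l_0,\phi_0,c_1\in\mathbb R$ with $k\ne0$, $V_0\neq0$, and put $\lambda=\tfrac{k^2}{2}-1$. Consider real functions $R,l,\phi,\gamma$ of $\tau\in[0,T)$, $0<T\le\infty$, of class $C^2$, with $R>0$ on $(0,T)$, which satisfy on $(0,T)$ (dots are $\tau$-derivatives) $$2\gamma+2\phi=\frac{k^2l}{2}+\frac{\tau}{2}+c_1,\qquad \ddot R=\Big(\frac14-V_0e^{\lambda l}\Big)R,\qquad \dot R+\Big(2\dot\phi-\frac12\Big)R=1,$$ $$R\ddot l+\dot R\dot l=\Big(\frac14-\frac{2}{k^2}V_0e^{\lambda l}\Big)R,\qquad \frac{\dot R^2-1}{R^2}+\frac{k^2\dot R\dot l}{R}+2V_0e^{\lambda l}-\frac{2+k^2}{8}-\frac{k^2\dot l^2}{2}=0,$$ with the regular-axis data $R(0)=0$, $\dot R(0)=1$, $l(0)=l_0$, $\dot l(0)=0$, $\phi(0)=\phi_0$. To a solution belongs, with $S=e^{-\tau/2}R$ and $\tau=-\log(v/u)$, the spacetime metric on $u<v<0$ (coordinates $u,v,\theta,z$) $$ds^2=-2|u|^{-1}e^{2\gamma+2\phi}\,du\,dv+|u|e^{2\phi}S^2\,d\theta^2+|u|e^{-2\phi}\,dz^2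 .$$ The radius of the cylinders is $r=|u|S$ and their specific length is $L=|u|^{1/2}e^{-\phi}$. The past null cone $\mathcal N_-$ of the origin is $v=0$, $u<0$, i.e. $\tau=\infty$. Outgoing radial null rays are the curves of constant $u<0$, $\theta$, $z$. A hypersurface $\tau=\tau_M$ is *reached in finite affine time* if affine parameters along every outgoing radial null ray have a finite limit there, and is *radial null infinity* if increasing affine parameters along every such ray tend to $+\infty$ there. Limits of $r$, $L$ and of the Ricci scalar at $\tau=\tau_M$ are taken as $\tau\to\tau_M^-$ along each such ray. **Theorem 2.3 (Global structure of solutions in the causal past of the scaling origin).** There is a unique maximal solution; let $[0,\tau_M)$ be its interval of existence. Then: * **Case 1.** If $k^2>2$ and $V_0<0$, then $\tau_M<\infty$, the hypersurface $\tau=\tau_M$ is radial null infinity, and the Ricci scalar decays to zero there. * **Case 2.** If $k^2=2$ and $V_0<0$, then $\tau_M=\infty$, $\mathcal N_-$ is radial null infinity, and the Ricci scalar decays to zero there. * **Case 3.** If (i) $k^2<2$ and $V_0<0$, or (ii) $k^2<2$, $V_0>0$ and $V_0e^{\lambda l_0}<k^2/8$, then $\tau_M=\infty$, the radius of the cylinders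 has a finite nonzero limit on $\mathcal N_-$, and $\mathcal N_-$ is reached in finite affine time. Moreover $\mathcal N_-$ exists as part of the spacetime: for a suitable new null coordinate $w$ in place of $v$ (where $v=h(w)$, with $h$ continuous for $w\le0$, $h(0)=0$, and $h$ of class $C^1$ with $h'>0$ for $w<0$) the metric extends continuously and nondegenerately to $w=0$. * **Case 4.** If (i) $k^2<2$, $V_0>0$ and $V_0e^{\lambda l_0}>k^2/8$, or (ii) $k^2>2$ and $V_0>0$, or (iii) $k^2=2$ and $V_0>1/4$, then $\tau_M<\infty$ and $\tau=\tau_M$ is a singularity of zero radius, reached in finite affine time: the radius $r$ tends to zero there; so does the specific length $L$, so that this is not a regular axis; and the Ricci scalar tends to $+\infty$ there unless $V_0e^{\lambda l_0}=k^2/8$. * **Case 5.** If (i) $k^2=2$ and $0<V_0\le1/4$, or (ii) $k^2<2$ and $V_0e^{\lambda l_0}=k^2/8$, then $\tau_M=\infty$, the radius tends to zero on $\mathcal N_-$, there is a curvature singularity on $\mathcal N_-$ (the Ricci scalar tends to $+\infty$), and it is reached in finite affine time. -/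

import Mathlib

open Filter Topology

namespace SelfSimilarCylinder

/-! ### Curvature and affine parameters of a metric in a four-dimensional coordinate chart -/

/-- A point of the chart, given by its four coordinates. -/
abbrev Event := Fin 4 → ℝ

/-- The components `g i j` of a metric as functions of the coordinates. -/
abbrev MetricField := Event → Matrix (Fin 4) (Fin 4) ℝ

/-- The partial derivative of `f` in the `i`-th coordinate. -/
noncomputable def pd (i : Fin 4) (f : Event → ℝ) (x : Event) : ℝ :=
  deriv (fun s => f (Function.update x i s)) (x i)

/-- The Christoffel symbol `Γ^i_{jk}`. -/
noncomputable def christoffel (g : MetricField) (i j k : Fin 4) (x : Event) : ℝ :=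
  (1 / 2) * ∑ m, (g x)⁻¹ i m *
    (pd j (fun y => g y m k) x + pd k (fun y => g y m j) x - pd m (fun y => g y j k) x)

/-- The Ricci tensor
`R_{jk} = ∂_i Γ^i_{jk} - ∂_k Γ^i_{ij} + Γ^i_{im} Γ^m_{jk} - Γ^i_{km} Γ^m_{ij}`. -/
noncomputable def ricciTensor (g : MetricField) (j k : Fin 4) (x : Event) : ℝ :=
  ∑ i, (pd i (christoffel g i j k) x - pd k (christoffel g i i j) x +
    ∑ m, (christoffel g i i m x * christoffel g m j k x -
      christoffel g i k m x * christoffel g m i j x))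

/-- The Ricci scalar `g^{jk} R_{jk}`. -/
noncomputable def ricciScalar (g : MetricField) (x : Event) : ℝ :=
  ∑ j, ∑ k, (g x)⁻¹ j k * ricciTensor g j k x

/-- `μ` is an (increasing) affine parameter along the curve `c` over the open set `I` of values of
the parameter `t` of `c`: in terms of `μ` the curve satisfies the geodesic equation
`d²xⁱ/dμ² + Γ^i_{jk} (dxʲ/dμ) (dxᵏ/dμ) = 0`, which in terms of `t` is
`d²xⁱ/dt² + Γ^i_{jk} (dxʲ/dt) (dxᵏ/dt) = (μ'' / μ') dxⁱ/dt`. -/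
def IsAffineParameter (g : MetricField) (c : ℝ → Event) (I : Set ℝ) (μ : ℝ → ℝ) : Prop :=
  ContDiffOn ℝ 2 μ I ∧ ∀ t ∈ I, 0 < deriv μ t ∧ ∀ i,
    deriv (deriv fun s => c s i) t +
        ∑ j, ∑ k, christoffel g i j k (c t) * deriv (fun s => c s j) t * deriv (fun s => c s k) t =
      deriv (deriv μ) t / deriv μ t * deriv (fun s => c s i) t

/-! ### The initial value problem -/

/-- The exponent `λ = k² / 2 - 1`. -/
noncomputable def lam (k : ℝ) : ℝ := k ^ 2 / 2 - 1

/-- The interval `[0, T)`, for `T ≤ ∞`. -/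
def dom (T : EReal) : Set ℝ := {τ | 0 ≤ τ ∧ (τ : EReal) < T}

/-- The interval `(0, T)`, for `T ≤ ∞`. -/
def openDom (T : EReal) : Set ℝ := {τ | 0 < τ ∧ (τ : EReal) < T}

/-- The filter of the limit `τ → T` from below: `𝓝[<] T` for real `T`, and `atTop` for `T = ∞`. -/
noncomputable def endFilter (T : EReal) : Filter ℝ := comap (fun τ : ℝ => (τ : EReal)) (𝓝[<] T)

/-- The unknown functions of `τ`. -/
structure Fields where
  R : ℝ → ℝ
  l : ℝ → ℝ
  φ : ℝ → ℝ
  γ : ℝ → ℝ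

/-- A twice continuously differentiable solution on `[0, T)` of the autonomous field equations with
the data of a regular axis at `τ = 0`. The equations are singular at the axis, where `R = 0`, and
are imposed on `(0, T)`, where `R` must not vanish. -/
structure IsSolution (k V₀ l₀ φ₀ c₁ : ℝ) (T : EReal) (s : Fields) : Prop where
  pos : 0 < T
  smooth_R : ContDiffOn ℝ 2 s.R (dom T)
  smooth_l : ContDiffOn ℝ 2 s.l (dom T)
  smooth_φ : ContDiffOn ℝ 2 s.φ (dom T)
  smooth_γ : ContDiffOn ℝ 2 s.γ (dom T)
  R_pos : ∀ τ ∈ openDom T, 0 < s.R τ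
  eq_a : ∀ τ ∈ openDom T, 2 * s.γ τ + 2 * s.φ τ = k ^ 2 * s.l τ / 2 + τ / 2 + c₁
  eq_b : ∀ τ ∈ openDom T,
    deriv (deriv s.R) τ = (1 / 4 - V₀ * Real.exp (lam k * s.l τ)) * s.R τ
  eq_c : ∀ τ ∈ openDom T, deriv s.R τ + (2 * deriv s.φ τ - 1 / 2) * s.R τ = 1
  eq_d : ∀ τ ∈ openDom T,
    s.R τ * deriv (deriv s.l) τ + deriv s.R τ * deriv s.l τ =
      (1 / 4 - 2 / k ^ 2 * V₀ * Real.exp (lam k * s.l τ)) * s.R τ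
  eq_e : ∀ τ ∈ openDom T,
    (deriv s.R τ ^ 2 - 1) / s.R τ ^ 2 + k ^ 2 * deriv s.R τ * deriv s.l τ / s.R τ +
      2 * V₀ * Real.exp (lam k * s.l τ) - (2 + k ^ 2) / 8 - k ^ 2 * deriv s.l τ ^ 2 / 2 = 0
  R_zero : s.R 0 = 0
  deriv_R_zero : HasDerivWithinAt s.R 1 (Set.Ici 0) 0
  l_zero : s.l 0 = l₀
  deriv_l_zero : HasDerivWithinAt s.l 0 (Set.Ici 0) 0
  φ_zero : s.φ 0 = φ₀

/-- `s` on `[0, T)` is the unique maximal solution: every solution with the same data lives on a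
subinterval of `[0, T)` and agrees with `s` there. -/
def IsMaximalSolution (k V₀ l₀ φ₀ c₁ : ℝ) (T : EReal) (s : Fields) : Prop :=
  IsSolution k V₀ l₀ φ₀ c₁ T s ∧
    ∀ (T' : EReal) (s' : Fields), IsSolution k V₀ l₀ φ₀ c₁ T' s' →
      T' ≤ T ∧ ∀ τ ∈ dom T',
        s'.R τ = s.R τ ∧ s'.l τ = s.l τ ∧ s'.φ τ = s.φ τ ∧ s'.γ τ = s.γ τ

/-! ### The spacetime -/

/-- The metric function `S = e^{-τ/2} R`. -/
noncomputable def Fields.S (s : Fields) (τ : ℝ) : ℝ := Real.exp (-τ / 2) * s.R τ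

/-- The line element
`-2 |u|⁻¹ e^{2γ+2φ} du dv + |u| e^{2φ} S² dθ² + |u| e^{-2φ} dz²`, with `γ, φ, S` evaluated at
`τ = -log (v / u)`, in the coordinates `(u, v, θ, z)`. The region between the axis and the past null
cone of the origin is `u < v < 0`. -/
noncomputable def Fields.metric (s : Fields) : MetricField := fun x =>
  let u := x 0
  let v := x 1
  let τ := -Real.log (v / u)
  !![0, -(|u|⁻¹ * Real.exp (2 * s.γ τ + 2 * s.φ τ)), 0, 0;
     -(|u|⁻¹ * Real.exp (2 * s.γ τ + 2 * s.φ τ)), 0, 0, 0;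
     0, 0, |u| * Real.exp (2 * s.φ τ) * s.S τ ^ 2, 0;
     0, 0, 0, |u| * Real.exp (-2 * s.φ τ)]

/-- The radius `r = |u| S` of the cylinders. -/
noncomputable def Fields.radius (s : Fields) (u τ : ℝ) : ℝ := |u| * s.S τ

/-- The specific length `|u|^{1/2} e^{-φ}` of the cylinders, the norm of the translational Killing
vector `∂/∂z`. -/
noncomputable def Fields.specificLength (s : Fields) (u τ : ℝ) : ℝ :=
  Real.sqrt |u| * Real.exp (-s.φ τ)

/-- The outgoing radial null ray at constant `u, θ, z`, parametrized by `τ`: here `v = u e^{-τ}`. -/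
noncomputable def outgoingRay (u θ z : ℝ) (τ : ℝ) : Event := ![u, u * Real.exp (-τ), θ, z]

/-- Along every outgoing radial null ray affine parameters exist, and each of them has a finite
limit at the hypersurface `τ = T`. -/
def ReachedInFiniteAffineTime (s : Fields) (T : EReal) : Prop :=
  ∀ u θ z : ℝ, u < 0 →
    (∃ μ, IsAffineParameter s.metric (outgoingRay u θ z) (openDom T) μ) ∧
    ∀ μ, IsAffineParameter s.metric (outgoingRay u θ z) (openDom T) μ →
      ∃ a : ℝ, Tendsto μ (endFilter T) (𝓝 a)

/-- The hypersurface `τ = T` is radial null infinity: along every outgoing radial null ray affine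
parameters exist, and each of them tends to infinity at `τ = T`. -/
def IsRadialNullInfinity (s : Fields) (T : EReal) : Prop :=
  ∀ u θ z : ℝ, u < 0 →
    (∃ μ, IsAffineParameter s.metric (outgoingRay u θ z) (openDom T) μ) ∧
    ∀ μ, IsAffineParameter s.metric (outgoingRay u θ z) (openDom T) μ →
      Tendsto μ (endFilter T) atTop

/-- The Ricci scalar decays to zero at the hypersurface `τ = T`. -/
def RicciScalarDecays (s : Fields) (T : EReal) : Prop :=
  ∀ u θ z : ℝ, u < 0 →
    Tendsto (fun τ => ricciScalar s.metric (outgoingRay u θ z τ)) (endFilter T) (𝓝 0)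

/-- There is a curvature singularity at the hypersurface `τ = T`: the Ricci scalar diverges. -/
def HasCurvatureSingularity (s : Fields) (T : EReal) : Prop :=
  ∀ u θ z : ℝ, u < 0 →
    Tendsto (fun τ => ricciScalar s.metric (outgoingRay u θ z τ)) (endFilter T) atTop

/-- The radius of the cylinders tends to zero at the hypersurface `τ = T`. -/
def RadiusVanishes (s : Fields) (T : EReal) : Prop :=
  ∀ u : ℝ, u < 0 → Tendsto (s.radius u) (endFilter T) (𝓝 0)

/-- The radius of the cylinders has a finite, positive limit at the hypersurface `τ = T`. -/
def RadiusFiniteNonzero (s : Fields) (T : EReal) : Prop :=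
  ∀ u : ℝ, u < 0 → ∃ r : ℝ, 0 < r ∧ Tendsto (s.radius u) (endFilter T) (𝓝 r)

/-- The specific length of the cylinders tends to zero at the hypersurface `τ = T`; on a regular
axis it would be finite and nonzero. -/
def SpecificLengthVanishes (s : Fields) (T : EReal) : Prop :=
  ∀ u : ℝ, u < 0 → Tendsto (s.specificLength u) (endFilter T) (𝓝 0)

/-- The past null cone `v = 0`, `u < 0` of the origin exists as part of the spacetime: after a
change `v = h w` of the null coordinate with `h 0 = 0`, which is continuously differentiable with
positive derivative for `w < 0`, the metric extends continuously and nondegenerately to `w = 0`.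
For `w < 0` the matrix of the extension in the coordinates `(u, w, θ, z)` is `J * g * J`, with
`J = diag (1, h', 1, 1)` the Jacobian matrix of the change of coordinates. -/
def PastNullConeIsRegular (s : Fields) : Prop :=
  ∃ (h : ℝ → ℝ) (G : MetricField),
    ContinuousOn h (Set.Iic 0) ∧ h 0 = 0 ∧ ContDiffOn ℝ 1 h (Set.Iio 0) ∧
    (∀ w < 0, 0 < deriv h w) ∧
    (∀ x : Event, x 0 < h (x 1) → x 1 < 0 →
      G x = Matrix.diagonal ![1, deriv h (x 1), 1, 1] * s.metric ![x 0, h (x 1), x 2, x 3] *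
        Matrix.diagonal ![1, deriv h (x 1), 1, 1]) ∧
    ContinuousOn G {x : Event | x 0 < h (x 1) ∧ x 1 ≤ 0} ∧
    ∀ x : Event, x 0 < 0 → x 1 = 0 → (G x).det ≠ 0

end SelfSimilarCylinder

namespace SelfSimilarCylinder

/-! ### Intervals of existence -/

/-! Write W = V₀ e^(λ l), x = R', y = R l'. The equations for R and l form the closed first order
system `Core`: x' = (1/4 - W) R and y' = (1/4 - (2/k²) W) R. The remaining equation `eq_e` is a
first integral that vanishes at the axis (`Core.constraint`), φ is a quadrature, and γ is algebraic,
so solutions and core systems correspond (`IsSolution.core`, `Core.exists_isSolution`).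

Near the axis R'/R = 1/τ + O(τ). Removing this pole gives a Fuchsian equation solved by contraction
(`exists_core`). Two solutions have the same pole, and the Riccati term only contracts where R'/R is
large, so a Gronwall estimate gives uniqueness (`Core.eq_XYl`). Patching all core systems gives the
maximal solution. The decisive continuation criterion is `Core.not_bounded`: a finite lifetime is
incompatible with R staying between positive bounds. It rests on Z = x - k² y / 2, from whose
equation Z' = -(λ/4) R the potential has dropped out, together with (k² l / 2 - log R)' = -Z / R.

The geometry reduces to two formulas. Affine parameters along outgoing rays satisfy μ' = C e^(k² l /
2 - τ / 2) (`IsSolution.deriv_affine`). The Ricci scalar is a positive constant times e^(τ / 2 - k²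
l / 2) (2 W + k² (l'² - 1/4) / 4) (`IsSolution.ricciScalar_eq`). Only the asymptotics of R, l and l'
remain.

If k² = 2 the potential is constant, and if V₀ e^(λ l₀) = k² / 8 then l is constant; both are solved
explicitly. If λ > 0 and V₀ < 0, Z becomes negative, so e^(k² l / 2) dominates R and R'' ≥ δ R^(1 +
σ) with σ = 1 - 2/k² > 0. Thus R blows up in finite time, with powers of R controlling all rates
(`Core.exists_power_bounds`). If λ < 0 and V₀ e^(λ l₀) < k² / 8, then l grows linearly, W decays
exponentially, and the system approaches R'' = R / 4; R e^(-τ / 2), l - τ / 2 and φ converge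
(`Core.exists_asymptotics`).

If V₀ > 0 and the solution collapses, (x + R/2) e^(-τ / 2) decreases, so R is bounded on bounded
intervals. A finite lifetime then forces x < 0 somewhere, and R goes to 0. For λ ≤ 0 the
monotonicity of l drives the argument. For λ > 0 an energy for l' and l, the Riccati equation of
R'/R, and the quantity Z² + λ R² / 4, which moves monotonically away from 1 and fixes the sign of y,
take its place. The bound away from zero of |y| produces the curvature singularity, and bounds on l
or on R e^(k² l) give finite affine time. -/

theorem ordConnected_openDom (T : EReal) : (openDom T).OrdConnected :=
  ⟨fun _ ha _ hb _ hx =>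
    ⟨ha.1.trans_le hx.1, (EReal.coe_le_coe_iff.2 hx.2).trans_lt hb.2⟩⟩

theorem isOpen_openDom (T : EReal) : IsOpen (openDom T) :=
  (isOpen_Ioi (a := (0 : ℝ))).inter (isOpen_Iio.preimage continuous_coe_real_ereal)

theorem openDom_mem_nhds {T : EReal} {τ : ℝ} (h : τ ∈ openDom T) : openDom T ∈ 𝓝 τ :=
  (isOpen_openDom T).mem_nhds h

theorem mem_openDom_of_le {T : EReal} {τ σ : ℝ} (h : τ ∈ openDom T) (h0 : 0 < σ) (hs : σ ≤ τ) :
    σ ∈ openDom T :=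
  ⟨h0, (EReal.coe_le_coe_iff.2 hs).trans_lt h.2⟩

theorem exists_mem_openDom {T : EReal} (hT : 0 < T) : ∃ τ, τ ∈ openDom T := by
  obtain ⟨q, hq0, hq⟩ := EReal.lt_iff_exists_real_btwn.1 hT
  exact ⟨q, by exact_mod_cast hq0, hq⟩

theorem openDom_mem_nhdsGT {T : EReal} (hT : 0 < T) : openDom T ∈ 𝓝[>] (0 : ℝ) := by
  obtain ⟨b, hb⟩ := exists_mem_openDom hT
  filter_upwards [Ioo_mem_nhdsGT hb.1] with t ht
  exact mem_openDom_of_le hb ht.1 ht.2.le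

theorem eq_top_or_eq_coe {T : EReal} (hT : 0 < T) : T = ⊤ ∨ ∃ t : ℝ, 0 < t ∧ T = t := by
  induction T with
  | bot => simp at hT
  | top => exact Or.inl rfl
  | coe t => exact Or.inr ⟨t, by exact_mod_cast hT, rfl⟩

theorem endFilter_coe (t : ℝ) : endFilter (t : EReal) = 𝓝[<] t := by
  rw [endFilter, nhdsWithin, comap_inf, comap_principal]
  have h1 : comap (fun τ : ℝ => (τ : EReal)) (𝓝 (t : EReal)) = 𝓝 t :=
    (EReal.isEmbedding_coe.nhds_eq_comap t).symm
  have h2 : (fun τ : ℝ => (τ : EReal)) ⁻¹' Set.Iio (t : EReal) = Set.Iio t := by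
    ext s; simp
  rw [h1, h2, nhdsWithin]

theorem endFilter_top : endFilter ⊤ = atTop := by
  have h : (𝓝[<] (⊤ : EReal)).HasBasis (fun x : ℝ => True) (fun x => Set.Ioo (x : EReal) ⊤) := by
    have := nhdsLT_basis_of_exists_lt (a := (⊤ : EReal)) ⟨⊥, bot_lt_top⟩
    refine this.to_hasBasis (fun x hx => ?_) (fun x _ => ⟨x, EReal.coe_lt_top x, subset_rfl⟩)
    obtain ⟨q, hq, hq'⟩ := EReal.lt_iff_exists_real_btwn.1 hx
    exact ⟨q, trivial, Set.Ioo_subset_Ioo_left hq.le⟩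
  refine (h.comap _).eq_of_same_basis ?_
  refine atTop_basis_Ioi.congr (fun _ => Iff.rfl) fun x _ => ?_
  ext s; simp

theorem endFilter_neBot {T : EReal} (hT : 0 < T) : (endFilter T).NeBot := by
  rcases eq_top_or_eq_coe hT with rfl | ⟨t, -, rfl⟩
  · rw [endFilter_top]; infer_instance
  · rw [endFilter_coe]; infer_instance

/-- Every point of `(0, T)` is eventually passed. -/
theorem eventually_endFilter {T : EReal} {τ : ℝ} (h : τ ∈ openDom T) :
    ∀ᶠ s in endFilter T, s ∈ openDom T ∧ τ < s := by
  rcases eq_top_or_eq_coe (T := T) (lt_trans (by exact_mod_cast h.1) h.2) with rfl | ⟨t, -, rfl⟩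
  · rw [endFilter_top]
    filter_upwards [eventually_gt_atTop τ] with s hs
    exact ⟨⟨h.1.trans hs, EReal.coe_lt_top s⟩, hs⟩
  · rw [endFilter_coe]
    have : τ < t := by exact_mod_cast h.2
    filter_upwards [Ioo_mem_nhdsLT this] with s hs
    exact ⟨⟨h.1.trans hs.1, by exact_mod_cast hs.2⟩, hs.1⟩

theorem eventually_mem_openDom {T : EReal} (hT : 0 < T) : ∀ᶠ s in endFilter T, s ∈ openDom T := by
  obtain ⟨τ, h⟩ := exists_mem_openDom hT
  exact (eventually_endFilter h).mono fun _ h => h.1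

/-- A property that holds near the end holds from some point on. -/
theorem exists_of_eventually {T : EReal} (hT : 0 < T) {p : ℝ → Prop}
    (hp : ∀ᶠ s in endFilter T, p s) : ∃ τ ∈ openDom T, ∀ s ∈ openDom T, τ ≤ s → p s := by
  rcases eq_top_or_eq_coe hT with rfl | ⟨t, ht, rfl⟩
  · rw [endFilter_top, eventually_atTop] at hp
    obtain ⟨a, ha⟩ := hp
    exact ⟨max a 1, ⟨lt_max_of_lt_right one_pos, EReal.coe_lt_top _⟩,
      fun s _ hs => ha s ((le_max_left _ _).trans hs)⟩
  · rw [endFilter_coe] at hp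
    obtain ⟨a, ha, h⟩ := (mem_nhdsLT_iff_exists_Ioo_subset).1 hp
    obtain ⟨b, hb, hbt⟩ := exists_between (max_lt (Set.mem_Iio.1 ha) ht)
    exact ⟨b, ⟨(le_max_right _ _).trans_lt hb, by exact_mod_cast hbt⟩,
      fun s hs hbs => h ⟨((le_max_left _ _).trans_lt hb).trans_le hbs, by exact_mod_cast hs.2⟩⟩

/-! ### Monotonicity on intervals -/

theorem hasDerivAt_sq {f : ℝ → ℝ} {f' t : ℝ} (h : HasDerivAt f f' t) :
    HasDerivAt (fun t => f t ^ 2) (2 * f t * f') t :=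
  (h.pow 2).congr_deriv (by simp)

section Monotone

variable {f f' : ℝ → ℝ} {D : Set ℝ}

theorem monotoneOn_of_hasDerivAt (hD : D.OrdConnected) (h : ∀ t ∈ D, HasDerivAt f (f' t) t)
    (h0 : ∀ t ∈ D, 0 ≤ f' t) : MonotoneOn f D :=
  monotoneOn_of_deriv_nonneg hD.convex (fun t ht => (h t ht).continuousAt.continuousWithinAt)
    (fun t ht => (h t (interior_subset ht)).differentiableAt.differentiableWithinAt)
    fun t ht => by rw [(h t (interior_subset ht)).deriv]; exact h0 t (interior_subset ht)

theorem strictMonoOn_of_hasDerivAt (hD : D.OrdConnected) (h : ∀ t ∈ D, HasDerivAt f (f' t) t)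
    (h0 : ∀ t ∈ D, 0 < f' t) : StrictMonoOn f D :=
  strictMonoOn_of_deriv_pos hD.convex (fun t ht => (h t ht).continuousAt.continuousWithinAt)
    fun t ht => by rw [(h t (interior_subset ht)).deriv]; exact h0 t (interior_subset ht)

theorem antitoneOn_of_hasDerivAt (hD : D.OrdConnected) (h : ∀ t ∈ D, HasDerivAt f (f' t) t)
    (h0 : ∀ t ∈ D, f' t ≤ 0) : AntitoneOn f D := by
  have := monotoneOn_of_hasDerivAt (f := -f) (f' := -f') hD (fun t ht => (h t ht).neg)
    fun t ht => by simpa using h0 t ht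
  intro a ha b hb hab
  simpa using this ha hb hab

theorem strictAntiOn_of_hasDerivAt (hD : D.OrdConnected) (h : ∀ t ∈ D, HasDerivAt f (f' t) t)
    (h0 : ∀ t ∈ D, f' t < 0) : StrictAntiOn f D := by
  have := strictMonoOn_of_hasDerivAt (f := -f) (f' := -f') hD (fun t ht => (h t ht).neg)
    fun t ht => by simpa using h0 t ht
  intro a ha b hb hab
  simpa using this ha hb hab

variable {T : EReal} {c : ℝ}

theorem tendsto_le_of_monotoneOn (h : MonotoneOn f (openDom T))
    (hc : Tendsto f (𝓝[>] 0) (𝓝 c)) {τ : ℝ} (hτ : τ ∈ openDom T) : c ≤ f τ := by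
  refine le_of_tendsto hc ?_
  filter_upwards [Ioo_mem_nhdsGT hτ.1] with t ht
  exact h (mem_openDom_of_le hτ ht.1 ht.2.le) hτ ht.2.le

theorem tendsto_lt_of_strictMonoOn (h : StrictMonoOn f (openDom T))
    (hc : Tendsto f (𝓝[>] 0) (𝓝 c)) {τ : ℝ} (hτ : τ ∈ openDom T) : c < f τ := by
  have h2 : τ / 2 ∈ openDom T := mem_openDom_of_le hτ (half_pos hτ.1) (half_le_self hτ.1.le)
  exact (tendsto_le_of_monotoneOn h.monotoneOn hc h2).trans_lt (h h2 hτ (half_lt_self hτ.1))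

theorem le_of_hasDerivAt_nonneg (h : ∀ t ∈ openDom T, HasDerivAt f (f' t) t)
    (h0 : ∀ t ∈ openDom T, 0 ≤ f' t) (hc : Tendsto f (𝓝[>] 0) (𝓝 c)) {τ : ℝ}
    (hτ : τ ∈ openDom T) : c ≤ f τ :=
  tendsto_le_of_monotoneOn (monotoneOn_of_hasDerivAt (ordConnected_openDom T) h h0) hc hτ

theorem lt_of_hasDerivAt_pos (h : ∀ t ∈ openDom T, HasDerivAt f (f' t) t)
    (h0 : ∀ t ∈ openDom T, 0 < f' t) (hc : Tendsto f (𝓝[>] 0) (𝓝 c)) {τ : ℝ}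
    (hτ : τ ∈ openDom T) : c < f τ :=
  tendsto_lt_of_strictMonoOn (strictMonoOn_of_hasDerivAt (ordConnected_openDom T) h h0) hc hτ

theorem ge_of_hasDerivAt_nonpos (h : ∀ t ∈ openDom T, HasDerivAt f (f' t) t)
    (h0 : ∀ t ∈ openDom T, f' t ≤ 0) (hc : Tendsto f (𝓝[>] 0) (𝓝 c)) {τ : ℝ}
    (hτ : τ ∈ openDom T) : f τ ≤ c := by
  have := le_of_hasDerivAt_nonneg (f := -f) (f' := -f') (fun t ht => (h t ht).neg)
    (fun t ht => by simpa using h0 t ht) hc.neg hτ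
  simpa using this

theorem eq_of_hasDerivAt_zero (h : ∀ t ∈ openDom T, HasDerivAt f 0 t)
    (hc : Tendsto f (𝓝[>] 0) (𝓝 c)) {τ : ℝ} (hτ : τ ∈ openDom T) : f τ = c :=
  le_antisymm (ge_of_hasDerivAt_nonpos (f' := fun _ => 0) h (fun _ _ => le_rfl) hc hτ)
    (le_of_hasDerivAt_nonneg (f' := fun _ => 0) h (fun _ _ => le_rfl) hc hτ)

end Monotone

/-- A continuous function on `(0, b]` with a limit at `0` is bounded. -/
theorem exists_abs_le_of_tendsto {f : ℝ → ℝ} {b c : ℝ} (hf : ContinuousOn f (Set.Ioc 0 b))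
    (hc : Tendsto f (𝓝[>] 0) (𝓝 c)) : ∃ M, ∀ t ∈ Set.Ioc 0 b, |f t| ≤ M := by
  have h1 : ∀ᶠ t in 𝓝[>] (0 : ℝ), |f t| < |c| + 1 :=
    hc.abs.eventually_lt_const (lt_add_one _)
  obtain ⟨ε, hε, h⟩ := (mem_nhdsGT_iff_exists_Ioo_subset).1 h1
  have hε' : (0 : ℝ) < ε := hε
  have hcomp : IsCompact (Set.Icc (ε / 2) b) := isCompact_Icc
  obtain ⟨M, hM⟩ := hcomp.exists_bound_of_continuousOn
    (hf.mono fun t ht => ⟨(half_pos hε').trans_le ht.1, ht.2⟩)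
  refine ⟨max (|c| + 1) M, fun t ht => ?_⟩
  rcases lt_or_ge t ε with h2 | h2
  · exact le_max_of_le_left (le_of_lt (h ⟨ht.1, h2⟩))
  · exact le_max_of_le_right (hM t ⟨(half_le_self hε'.le).trans h2, ht.2⟩)

/-! ### The core system -/

/-- The field equations as a first order system for `R`, `x = R'`, `l` and `y = R l'`. -/
structure Core (k V₀ l₀ : ℝ) (T : EReal) (R x l y : ℝ → ℝ) : Prop where
  pos : 0 < T
  R_pos : ∀ τ ∈ openDom T, 0 < R τ
  dR : ∀ τ ∈ openDom T, HasDerivAt R (x τ) τ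
  dx : ∀ τ ∈ openDom T, HasDerivAt x ((1 / 4 - V₀ * Real.exp (lam k * l τ)) * R τ) τ
  dl : ∀ τ ∈ openDom T, HasDerivAt l (y τ / R τ) τ
  dy : ∀ τ ∈ openDom T,
    HasDerivAt y ((1 / 4 - 2 / k ^ 2 * V₀ * Real.exp (lam k * l τ)) * R τ) τ
  R_lim : Tendsto R (𝓝[>] 0) (𝓝 0)
  x_lim : Tendsto x (𝓝[>] 0) (𝓝 1)
  l_lim : Tendsto l (𝓝[>] 0) (𝓝 l₀)
  y_lim : Tendsto y (𝓝[>] 0) (𝓝 0)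

namespace Core

variable {k V₀ l₀ : ℝ} {T : EReal} {R x l y : ℝ → ℝ}

theorem dW (c : Core k V₀ l₀ T R x l y) {τ : ℝ} (hτ : τ ∈ openDom T) :
    HasDerivAt (fun t => V₀ * Real.exp (lam k * l t))
      (lam k * (V₀ * Real.exp (lam k * l τ)) * (y τ / R τ)) τ := by
  have := (((c.dl τ hτ).const_mul (lam k)).exp).const_mul V₀
  exact this.congr_deriv (by ring)

theorem W_lim (c : Core k V₀ l₀ T R x l y) :
    Tendsto (fun t => V₀ * Real.exp (lam k * l t)) (𝓝[>] 0) (𝓝 (V₀ * Real.exp (lam k * l₀))) :=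
  (((Real.continuous_exp.tendsto _).comp (c.l_lim.const_mul (lam k)))).const_mul V₀

/-- The left side has derivative zero along the flow and tends to 0 at the axis. For this reason
`eq_e` need not be part of `Core`. -/
theorem constraint (c : Core k V₀ l₀ T R x l y) (hk : k ≠ 0) {τ : ℝ} (hτ : τ ∈ openDom T) :
    x τ ^ 2 - 1 + k ^ 2 * x τ * y τ - k ^ 2 / 2 * y τ ^ 2 +
      (2 * (V₀ * Real.exp (lam k * l τ)) - (2 + k ^ 2) / 8) * R τ ^ 2 = 0 := by
  refine eq_of_hasDerivAt_zero (f := fun τ => x τ ^ 2 - 1 + k ^ 2 * x τ * y τ - k ^ 2 / 2 * y τ ^ 2 +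
      (2 * (V₀ * Real.exp (lam k * l τ)) - (2 + k ^ 2) / 8) * R τ ^ 2) (T := T) (fun t ht => ?_) ?_ hτ
  · have hR := (c.R_pos t ht).ne'
    have := ((((hasDerivAt_sq (c.dx t ht)).sub_const 1).add (((c.dx t ht).const_mul (k ^ 2)).mul
      (c.dy t ht))).sub ((hasDerivAt_sq (c.dy t ht)).const_mul (k ^ 2 / 2))).add
      ((((c.dW ht).const_mul 2).sub_const ((2 + k ^ 2) / 8)).mul (hasDerivAt_sq (c.dR t ht)))
    refine this.congr_deriv ?_
    rw [lam]
    field_simp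
    ring
  · have h := ((((c.x_lim.pow 2).sub_const 1).add ((c.x_lim.const_mul (k ^ 2)).mul
      c.y_lim)).sub ((c.y_lim.pow 2).const_mul (k ^ 2 / 2))).add
      (((c.W_lim.const_mul 2).sub_const ((2 + k ^ 2) / 8)).mul (c.R_lim.pow 2))
    convert h using 2
    ring

theorem eventually_mem (c : Core k V₀ l₀ T R x l y) : ∀ᶠ t in 𝓝[>] (0 : ℝ), t ∈ openDom T :=
  openDom_mem_nhdsGT c.pos

theorem R_div_lim (c : Core k V₀ l₀ T R x l y) :
    Tendsto (fun t => R t / t) (𝓝[>] 0) (𝓝 1) := by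
  refine HasDerivAt.lhopital_zero_nhdsGT (f' := x) (g' := fun _ => 1)
    (c.eventually_mem.mono c.dR) (Eventually.of_forall fun t => hasDerivAt_id t)
    (Eventually.of_forall fun _ => one_ne_zero) c.R_lim
    ((tendsto_id (α := ℝ)).mono_left nhdsWithin_le_nhds) (by simpa using c.x_lim)

/-- Every solution has the same pole 1/t in R'/R at the axis, so the difference of two such
quotients tends to 0 there. This is the initial condition of the Gronwall argument. The proof is
l'Hôpital for (t x - R) / (t R). -/
theorem X_sub_lim (c : Core k V₀ l₀ T R x l y) :
    Tendsto (fun t => x t / R t - 1 / t) (𝓝[>] 0) (𝓝 0) := by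
  have hid : Tendsto (fun t : ℝ => t) (𝓝[>] 0) (𝓝 0) :=
    (tendsto_id (α := ℝ)).mono_left nhdsWithin_le_nhds
  have h := HasDerivAt.lhopital_zero_nhdsGT (a := 0) (l := 𝓝 0)
    (f := fun t => x t * t - R t) (g := fun t => t * R t)
    (f' := fun t => (1 / 4 - V₀ * Real.exp (lam k * l t)) * R t * t)
    (g' := fun t => R t + t * x t)
    (c.eventually_mem.mono fun t ht =>
      (((c.dx t ht).mul (hasDerivAt_id t)).sub (c.dR t ht)).congr_deriv (by simp))
    (c.eventually_mem.mono fun t ht =>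
      ((hasDerivAt_id t).mul (c.dR t ht)).congr_deriv (by simp))
    (by
      filter_upwards [c.eventually_mem, c.x_lim.eventually_const_lt zero_lt_one] with t ht hx
      have := c.R_pos t ht
      have := ht.1
      positivity)
    (by simpa using (c.x_lim.mul hid).sub c.R_lim) (by simpa using hid.mul c.R_lim)
    (by
      have h1 : Tendsto (fun t => (1 / 4 - V₀ * Real.exp (lam k * l t)) * R t / (R t / t + x t))
          (𝓝[>] 0) (𝓝 ((1 / 4 - V₀ * Real.exp (lam k * l₀)) * 0 / (1 + 1))) :=
        ((c.W_lim.const_sub _).mul c.R_lim).div (c.R_div_lim.add c.x_lim) (by norm_num)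
      rw [mul_zero, zero_div] at h1
      refine h1.congr' ?_
      filter_upwards [c.eventually_mem, c.x_lim.eventually_const_lt zero_lt_one] with t ht hx
      have := c.R_pos t ht
      have := ht.1
      field_simp)
  refine h.congr' ?_
  filter_upwards [c.eventually_mem] with t ht
  have := c.R_pos t ht
  have := ht.1
  field_simp

/-- By l'Hôpital, since (R²)' = 2 R x with x → 1. The limit determines the sign of y near the axis
and makes l'' continuous there. -/
theorem y_div_sq_lim (c : Core k V₀ l₀ T R x l y) :
    Tendsto (fun t => y t / R t ^ 2) (𝓝[>] 0)
      (𝓝 ((1 / 4 - 2 / k ^ 2 * V₀ * Real.exp (lam k * l₀)) / 2)) := by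
  refine HasDerivAt.lhopital_zero_nhdsGT (c.eventually_mem.mono fun t ht => c.dy t ht)
    (c.eventually_mem.mono fun t ht => hasDerivAt_sq (c.dR t ht)) ?_ c.y_lim
    (by simpa using c.R_lim.pow 2) ?_
  · filter_upwards [c.eventually_mem, c.x_lim.eventually_const_lt zero_lt_one] with t ht hx
    have := c.R_pos t ht
    positivity
  · have h1 := (((c.W_lim.const_mul (2 / k ^ 2)).const_sub (1 / 4))).div (c.x_lim.const_mul 2)
      (by norm_num)
    rw [mul_one, ← mul_assoc] at h1
    refine h1.congr' ?_
    filter_upwards [c.eventually_mem, c.x_lim.eventually_const_lt zero_lt_one] with t ht hx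
    have := c.R_pos t ht
    simp only [Pi.div_apply]
    field_simp

theorem one_sub_x_div_sq_lim (c : Core k V₀ l₀ T R x l y) :
    Tendsto (fun t => (1 - x t) / R t ^ 2) (𝓝[>] 0)
      (𝓝 (-(1 / 4 - V₀ * Real.exp (lam k * l₀)) / 2)) := by
  refine HasDerivAt.lhopital_zero_nhdsGT (c.eventually_mem.mono fun t ht => (c.dx t ht).const_sub 1)
    (c.eventually_mem.mono fun t ht => hasDerivAt_sq (c.dR t ht)) ?_ (by simpa using c.x_lim.const_sub 1)
    (by simpa using c.R_lim.pow 2) ?_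
  · filter_upwards [c.eventually_mem, c.x_lim.eventually_const_lt zero_lt_one] with t ht hx
    have := c.R_pos t ht
    positivity
  · have h1 := ((c.W_lim.const_sub (1 / 4)).neg).div (c.x_lim.const_mul 2) (by norm_num)
    rw [mul_one] at h1
    refine h1.congr' ?_
    filter_upwards [c.eventually_mem, c.x_lim.eventually_const_lt zero_lt_one] with t ht hx
    have := c.R_pos t ht
    simp only [Pi.div_apply]
    field_simp

theorem Y_lim (c : Core k V₀ l₀ T R x l y) :
    Tendsto (fun t => y t / R t) (𝓝[>] 0) (𝓝 0) := by
  have h := c.y_div_sq_lim.mul c.R_lim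
  rw [mul_zero] at h
  refine h.congr' ?_
  filter_upwards [c.eventually_mem] with t ht
  have := c.R_pos t ht
  field_simp

/-- A Riccati equation: in the quotients X = x / R, Y = y / R and in l the system closes up without
R. -/
theorem dX (c : Core k V₀ l₀ T R x l y) {τ : ℝ} (hτ : τ ∈ openDom T) :
    HasDerivAt (fun t => x t / R t)
      (1 / 4 - V₀ * Real.exp (lam k * l τ) - (x τ / R τ) ^ 2) τ := by
  have hR := (c.R_pos τ hτ).ne'
  refine ((c.dx τ hτ).div (c.dR τ hτ) hR).congr_deriv ?_
  field_simp

theorem dY (c : Core k V₀ l₀ T R x l y) {τ : ℝ} (hτ : τ ∈ openDom T) :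
    HasDerivAt (fun t => y t / R t)
      (1 / 4 - 2 / k ^ 2 * V₀ * Real.exp (lam k * l τ) - (x τ / R τ) * (y τ / R τ)) τ := by
  have hR := (c.R_pos τ hτ).ne'
  refine ((c.dy τ hτ).div (c.dR τ hτ) hR).congr_deriv ?_
  field_simp

end Core

/-! ### Uniqueness: a Gronwall estimate starting at the singular axis -/

theorem exists_lipschitz_potential (V₀ a M : ℝ) : ∃ K, 0 ≤ K ∧ ∀ s t, |s| ≤ M → |t| ≤ M →
    |V₀ * Real.exp (a * s) - V₀ * Real.exp (a * t)| ≤ K * |s - t| := by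
  have h : LocallyLipschitz fun s : ℝ => V₀ * Real.exp (a * s) :=
    ContDiff.locallyLipschitz (𝕂 := ℝ) (by fun_prop)
  obtain ⟨K, hK⟩ := (h.locallyLipschitzOn (s := Set.Icc (-M) M)).exists_lipschitzOnWith_of_compact
    isCompact_Icc
  refine ⟨K, K.2, fun s t hs ht => ?_⟩
  simpa [Real.dist_eq] using hK.dist_le_mul s (abs_le.1 hs) t (abs_le.1 ht)

/-- The left side is the derivative of the squared distance of two solutions in the variables X, Y,
l. The factors X enter only through -(X₁ + X₂) (X₁ - X₂)² and -X₁ (Y₁ - Y₂)², so lower bounds for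
them suffice. This matters because X → +∞ at the axis. -/
theorem gronwall_form {X₁ X₂ Y₁ Y₂ l₁ l₂ W₁ W₂ κ L M₁ M₂ M₃ : ℝ} (hk2 : 0 ≤ κ) (hL0 : 0 ≤ L)
    (hW : |W₁ - W₂| ≤ L * |l₁ - l₂|) (hX₁ : -|M₁| ≤ X₁) (hX₂ : -|M₂| ≤ X₂) (hY : |Y₂| ≤ |M₃|) :
    2 * (X₁ - X₂) * (1 / 4 - W₁ - X₁ ^ 2 - (1 / 4 - W₂ - X₂ ^ 2)) +
        2 * (Y₁ - Y₂) * (1 / 4 - κ * W₁ - X₁ * Y₁ - (1 / 4 - κ * W₂ - X₂ * Y₂)) +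
        2 * (l₁ - l₂) * (Y₁ - Y₂) ≤
      (L + 2 * (|M₁| + |M₂|) + κ * L + 2 * |M₁| + |M₃| + 1) *
        ((X₁ - X₂) ^ 2 + (Y₁ - Y₂) ^ 2 + (l₁ - l₂) ^ 2) := by
  have id1 : 2 * (X₁ - X₂) * (1 / 4 - W₁ - X₁ ^ 2 - (1 / 4 - W₂ - X₂ ^ 2)) +
    2 * (Y₁ - Y₂) * (1 / 4 - κ * W₁ - X₁ * Y₁ - (1 / 4 - κ * W₂ - X₂ * Y₂)) +
    2 * (l₁ - l₂) * (Y₁ - Y₂) = -2 * (X₁ - X₂) * (W₁ - W₂) - 2 * (X₁ + X₂) * (X₁ - X₂) ^ 2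
      - 2 * κ * ((Y₁ - Y₂) * (W₁ - W₂)) - 2 * X₁ * (Y₁ - Y₂) ^ 2
      - 2 * Y₂ * (X₁ - X₂) * (Y₁ - Y₂) + 2 * (l₁ - l₂) * (Y₁ - Y₂) := by ring
  rw [id1]
  generalize hdX : X₁ - X₂ = dX at *
  generalize Y₁ - Y₂ = dY at *
  generalize l₁ - l₂ = dl at *
  generalize W₁ - W₂ = dw at *
  have am : ∀ p q : ℝ, 2 * (|p| * |q|) ≤ p ^ 2 + q ^ 2 := fun p q => by
    rw [← sq_abs p, ← sq_abs q]; nlinarith [sq_nonneg (|p| - |q|)]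
  have t1 : -2 * dX * dw ≤ L * (dX ^ 2 + dY ^ 2 + dl ^ 2) := by
    have h1 : -2 * dX * dw ≤ 2 * (|dX| * |dw|) := by
      rw [← abs_mul]; linarith [neg_abs_le (dX * dw)]
    have h2 : |dX| * |dw| ≤ |dX| * (L * |dl|) := by gcongr
    nlinarith [am dX dl, mul_nonneg hL0 (sq_nonneg dY),
      mul_le_mul_of_nonneg_left (am dX dl) hL0]
  have t2 : - 2 * (X₁ + X₂) * dX ^ 2 ≤ 2 * (|M₁| + |M₂|) * (dX ^ 2 + dY ^ 2 + dl ^ 2) := by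
    have h1 : 0 ≤ (X₁ + X₂ + (|M₁| + |M₂|)) * dX ^ 2 :=
      mul_nonneg (by linarith) (sq_nonneg _)
    have h2 : 0 ≤ (|M₁| + |M₂|) * (dY ^ 2 + dl ^ 2) := by positivity
    linarith
  have t3 : - 2 * κ * (dY * dw) ≤ κ * L * (dX ^ 2 + dY ^ 2 + dl ^ 2) := by
    have h1 : - (dY * dw) ≤ |dY| * |dw| := by
      rw [← abs_mul]; linarith [neg_abs_le (dY * dw)]
    have h2 : |dY| * |dw| ≤ |dY| * (L * |dl|) := by gcongr
    have h3 : 0 ≤ κ * L * dX ^ 2 := by positivity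
    have h4 := mul_le_mul_of_nonneg_left (am dY dl) (mul_nonneg hk2 hL0)
    have h5 := mul_le_mul_of_nonneg_left (h1.trans h2) hk2
    nlinarith
  have t4 : - 2 * X₁ * dY ^ 2 ≤ 2 * |M₁| * (dX ^ 2 + dY ^ 2 + dl ^ 2) := by
    have h1 : 0 ≤ (X₁ + |M₁|) * dY ^ 2 := mul_nonneg (by linarith) (sq_nonneg _)
    have h2 : 0 ≤ |M₁| * (dX ^ 2 + dl ^ 2) := by positivity
    linarith
  have t5 : - 2 * Y₂ * dX * dY ≤ |M₃| * (dX ^ 2 + dY ^ 2 + dl ^ 2) := by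
    have h1 : - 2 * Y₂ * dX * dY ≤ 2 * (|Y₂| * (|dX| * |dY|)) := by
      rw [← abs_mul, ← abs_mul]; linarith [neg_abs_le (Y₂ * (dX * dY))]
    have h2 : |Y₂| * (|dX| * |dY|) ≤ |M₃| * (|dX| * |dY|) := by gcongr
    have h3 := mul_le_mul_of_nonneg_left (am dX dY) (abs_nonneg M₃)
    have h4 : 0 ≤ |M₃| * dl ^ 2 := by positivity
    linarith
  have t6 : 2 * dl * dY ≤ dX ^ 2 + dY ^ 2 + dl ^ 2 := by
    nlinarith [sq_nonneg (dl - dY), sq_nonneg dX]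
  linarith

namespace Core

variable {k V₀ l₀ : ℝ} {T₁ T₂ : EReal} {R₁ x₁ l₁ y₁ R₂ x₂ l₂ y₂ : ℝ → ℝ}

theorem eq_XYl (c₁ : Core k V₀ l₀ T₁ R₁ x₁ l₁ y₁) (c₂ : Core k V₀ l₀ T₂ R₂ x₂ l₂ y₂)
    {b : ℝ} (hb₁ : b ∈ openDom T₁) (hb₂ : b ∈ openDom T₂) :
    x₁ b / R₁ b = x₂ b / R₂ b ∧ y₁ b / R₁ b = y₂ b / R₂ b ∧ l₁ b = l₂ b := by
  have mem₁ : ∀ t ∈ Set.Ioc 0 b, t ∈ openDom T₁ := fun t ht => mem_openDom_of_le hb₁ ht.1 ht.2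
  have mem₂ : ∀ t ∈ Set.Ioc 0 b, t ∈ openDom T₂ := fun t ht => mem_openDom_of_le hb₂ ht.1 ht.2
  -- X exceeds 1/t - M, hence -M: the pole at the axis has the favourable sign.
  have lowX : ∀ {T : EReal} {R x l y : ℝ → ℝ}, Core k V₀ l₀ T R x l y → b ∈ openDom T →
      ∃ M, ∀ t ∈ Set.Ioc 0 b, -M ≤ x t / R t := by
    intro T R x l y c hb
    obtain ⟨M, hM⟩ := exists_abs_le_of_tendsto (b := b) (f := fun t => x t / R t - 1 / t)
      (fun t ht => ((c.dX (mem_openDom_of_le hb ht.1 ht.2)).continuousAt.sub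
        (continuousAt_const.div continuousAt_id ht.1.ne')).continuousWithinAt) c.X_sub_lim
    refine ⟨M, fun t ht => ?_⟩
    have h1 := (abs_le.1 (hM t ht)).1
    have h2 : 0 < 1 / t := one_div_pos.2 ht.1
    linarith
  have bl : ∀ {T : EReal} {R x l y : ℝ → ℝ}, Core k V₀ l₀ T R x l y → b ∈ openDom T →
      ∃ M, ∀ t ∈ Set.Ioc 0 b, |l t| ≤ M := fun c hb => exists_abs_le_of_tendsto
    (fun t ht => (c.dl t (mem_openDom_of_le hb ht.1 ht.2)).continuousAt.continuousWithinAt) c.l_lim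
  obtain ⟨M₁, hM₁⟩ := lowX c₁ hb₁
  obtain ⟨M₂, hM₂⟩ := lowX c₂ hb₂
  obtain ⟨M₃, hM₃⟩ := exists_abs_le_of_tendsto (b := b) (f := fun t => y₂ t / R₂ t)
      (fun t ht => (c₂.dY (mem₂ t ht)).continuousAt.continuousWithinAt) c₂.Y_lim
  obtain ⟨N₁, hN₁⟩ := bl c₁ hb₁
  obtain ⟨N₂, hN₂⟩ := bl c₂ hb₂
  obtain ⟨L, hL0, hL⟩ := exists_lipschitz_potential V₀ (lam k) (max N₁ N₂)
  set C : ℝ := L + 2 * (|M₁| + |M₂|) + 2 / k ^ 2 * L + 2 * |M₁| + |M₃| + 1 with hC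
  set N : ℝ → ℝ := fun t => (x₁ t / R₁ t - x₂ t / R₂ t) ^ 2 + (y₁ t / R₁ t - y₂ t / R₂ t) ^ 2 +
    (l₁ t - l₂ t) ^ 2 with hN
  -- With C the constant of `gronwall_form`, the weight e^(-C t) absorbs the growth of N. The
  -- weighted distance decreases from its limit 0 at the axis.
  have hmono : AntitoneOn (fun t => Real.exp (-C * t) * N t) (Set.Ioc 0 b) := by
    refine antitoneOn_of_hasDerivAt Set.ordConnected_Ioc (fun t ht =>
      (((hasDerivAt_id t).const_mul (-C)).exp).mul
      (((hasDerivAt_sq ((c₁.dX (mem₁ t ht)).sub (c₂.dX (mem₂ t ht)))).add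
      (hasDerivAt_sq ((c₁.dY (mem₁ t ht)).sub (c₂.dY (mem₂ t ht))))).add
      (hasDerivAt_sq ((c₁.dl t (mem₁ t ht)).sub (c₂.dl t (mem₂ t ht)))))) fun t ht => ?_
    have hW := hL (l₁ t) (l₂ t) ((hN₁ t ht).trans (le_max_left _ _))
      ((hN₂ t ht).trans (le_max_right _ _))
    have hX₁ := (neg_le_neg (le_abs_self M₁)).trans (hM₁ t ht)
    have hX₂ := (neg_le_neg (le_abs_self M₂)).trans (hM₂ t ht)
    have hY := (hM₃ t ht).trans (le_abs_self M₃)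
    simp only [hN, id, Pi.sub_apply]
    generalize x₁ t / R₁ t = X₁ at *
    generalize x₂ t / R₂ t = X₂ at *
    generalize y₁ t / R₁ t = Y₁ at *
    generalize y₂ t / R₂ t = Y₂ at *
    have hk2 : (0 : ℝ) ≤ 2 / k ^ 2 := by positivity
    have e1 : 2 / k ^ 2 * V₀ * Real.exp (lam k * l₁ t) = 2 / k ^ 2 * (V₀ * Real.exp (lam k * l₁ t)) :=
      by ring
    have e2 : 2 / k ^ 2 * V₀ * Real.exp (lam k * l₂ t) = 2 / k ^ 2 * (V₀ * Real.exp (lam k * l₂ t)) :=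
      by ring
    rw [e1, e2]
    generalize V₀ * Real.exp (lam k * l₁ t) = W₁ at *
    generalize V₀ * Real.exp (lam k * l₂ t) = W₂ at *
    generalize (2 : ℝ) / k ^ 2 = κ at *
    have hE := Real.exp_pos (-C * t)
    generalize Real.exp (-C * t) = E at *
    have key := gronwall_form hk2 hL0 hW hX₁ hX₂ hY (Y₁ := Y₁)
    rw [← hC] at key
    have := mul_le_mul_of_nonneg_left key hE.le
    linarith
  have hlim : Tendsto (fun t => Real.exp (-C * t) * N t) (𝓝[>] 0) (𝓝 0) := by
    have hE : Tendsto (fun t => Real.exp (-C * t)) (𝓝[>] 0) (𝓝 1) := by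
      have : Continuous fun t => Real.exp (-C * t) := by fun_prop
      have h := (this.tendsto 0).mono_left (nhdsWithin_le_nhds (s := Set.Ioi 0))
      simpa using h
    have hX := (c₁.X_sub_lim.sub c₂.X_sub_lim)
    have := hE.mul (((hX.pow 2).add ((c₁.Y_lim.sub c₂.Y_lim).pow 2)).add
      ((c₁.l_lim.sub c₂.l_lim).pow 2))
    simpa [hN] using this
  have hle : Real.exp (-C * b) * N b ≤ 0 := by
    refine ge_of_tendsto hlim ?_
    filter_upwards [Ioo_mem_nhdsGT hb₁.1] with t ht
    exact hmono ⟨ht.1, ht.2.le⟩ ⟨hb₁.1, le_rfl⟩ ht.2.le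
  have hNb : N b ≤ 0 := by
    by_contra h
    push Not at h
    have := mul_pos (Real.exp_pos (-C * b)) h
    linarith
  have s1 := sq_nonneg (x₁ b / R₁ b - x₂ b / R₂ b)
  have s2 := sq_nonneg (y₁ b / R₁ b - y₂ b / R₂ b)
  have s3 := sq_nonneg (l₁ b - l₂ b)
  simp only [hN] at hNb
  refine ⟨sub_eq_zero.1 (pow_eq_zero_iff two_ne_zero |>.1 ?_),
    sub_eq_zero.1 (pow_eq_zero_iff two_ne_zero |>.1 ?_),
    sub_eq_zero.1 (pow_eq_zero_iff two_ne_zero |>.1 ?_)⟩ <;> linarith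

/-- Agreement of x / R, y / R and l already forces agreement of R: the constraint divided by R²
expresses 1 / R² through these quantities. -/
theorem eq (c₁ : Core k V₀ l₀ T₁ R₁ x₁ l₁ y₁) (c₂ : Core k V₀ l₀ T₂ R₂ x₂ l₂ y₂) (hk : k ≠ 0)
    {b : ℝ} (hb₁ : b ∈ openDom T₁) (hb₂ : b ∈ openDom T₂) :
    R₁ b = R₂ b ∧ x₁ b = x₂ b ∧ l₁ b = l₂ b ∧ y₁ b = y₂ b := by
  obtain ⟨hX, hY, hl⟩ := eq_XYl c₁ c₂ hb₁ hb₂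
  have h1 := c₁.constraint hk hb₁
  have h2 := c₂.constraint hk hb₂
  have p1 := c₁.R_pos b hb₁
  have p2 := c₂.R_pos b hb₂
  rw [div_eq_div_iff p1.ne' p2.ne'] at hX hY
  rw [hl] at h1
  have hR : R₁ b ^ 2 = R₂ b ^ 2 := by
    -- The quadratic parts of the two constraints, multiplied by r'² and r², coincide, so only r² =
    -- r'² survives from the constant terms.
    have e : ∀ X Y X' Y' w r r' : ℝ, X * r' = X' * r → Y * r' = Y' * r →
        X ^ 2 - 1 + k ^ 2 * X * Y - k ^ 2 / 2 * Y ^ 2 + w * r ^ 2 = 0 →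
        X' ^ 2 - 1 + k ^ 2 * X' * Y' - k ^ 2 / 2 * Y' ^ 2 + w * r' ^ 2 = 0 → r ^ 2 = r' ^ 2 := by
      intro X Y X' Y' w r r' hx hy e1 e2
      have : (X ^ 2 - 1 + k ^ 2 * X * Y - k ^ 2 / 2 * Y ^ 2 + w * r ^ 2) * r' ^ 2 -
          (X' ^ 2 - 1 + k ^ 2 * X' * Y' - k ^ 2 / 2 * Y' ^ 2 + w * r' ^ 2) * r ^ 2 = 0 := by
        rw [e1, e2]; ring
      linear_combination this - (X * r' + X' * r) * hx - k ^ 2 * (Y * r') * hx - k ^ 2 * (X' * r) * hy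
        + k ^ 2 / 2 * (Y * r' + Y' * r) * hy
    exact e _ _ _ _ _ _ _ hX hY h1 h2
  have hR' : R₁ b = R₂ b := (pow_left_inj₀ p1.le p2.le two_ne_zero).1 hR
  rw [hR'] at hX hY
  exact ⟨hR', mul_right_cancel₀ p2.ne' hX, hl, mul_right_cancel₀ p2.ne' hY⟩

end Core

end SelfSimilarCylinder


namespace SelfSimilarCylinder

/-! ### Local existence at the axis -/

/-- Picard iteration for the singular equation `u(t) = ∫₀¹ D(r) G(t r, u(t r)) dr`, the integral
form of `t u' = -A u + G(t, u)`, `D(r) = r ^ (A - 1)`. -/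
theorem exists_singular_picard {E : Type*} [NormedAddCommGroup E] [NormedSpace ℝ E]
    [CompleteSpace E] (D : ℝ → E → E) (G : ℝ → E → E)
    (hD : Continuous (Function.uncurry D)) (hG : Continuous (Function.uncurry G))
    (hDsub : ∀ r v w, D r v - D r w = D r (v - w))
    (hDnorm : ∀ r ∈ Set.Icc (0 : ℝ) 1, ∀ v, ‖D r v‖ ≤ ‖v‖) {δ M : ℝ} (hδ : 0 ≤ δ) (hM : 0 ≤ M)
    (hGM : ∀ t ∈ Set.Icc 0 δ, ∀ v, ‖v‖ ≤ M → ‖G t v‖ ≤ M)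
    (hGL : ∀ t ∈ Set.Icc 0 δ, ∀ v w, ‖v‖ ≤ M → ‖w‖ ≤ M → ‖G t v - G t w‖ ≤ 1 / 2 * ‖v - w‖) :
    ∃ u : ℝ → E, Continuous u ∧
      ∀ t ∈ Set.Icc 0 δ, u t = ∫ r in (0 : ℝ)..1, D r (G (t * r) (u (t * r))) := by
  classical
  -- Freezing t outside [0, δ] lets the iteration run on bounded continuous functions on all of ℝ.
  set clamp : ℝ → ℝ := fun t => max 0 (min δ t) with hclamp
  have hcc : Continuous clamp := by fun_prop
  have hcm : ∀ t, ∀ r ∈ Set.Icc (0 : ℝ) 1, clamp t * r ∈ Set.Icc 0 δ := by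
    intro t r hr
    have h0 : 0 ≤ clamp t := le_max_left _ _
    have h1 : clamp t ≤ δ := max_le hδ (min_le_left _ _)
    exact ⟨mul_nonneg h0 hr.1, (mul_le_of_le_one_right h0 hr.2).trans h1⟩
  have hint : ∀ (u : ℝ → E), Continuous u →
      Continuous fun p : ℝ × ℝ => D p.2 (G (clamp p.1 * p.2) (u (clamp p.1 * p.2))) := by
    intro u hu
    have h1 : Continuous fun p : ℝ × ℝ => clamp p.1 * p.2 := by fun_prop
    exact hD.comp (continuous_snd.prodMk (hG.comp (h1.prodMk (hu.comp h1))))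
  let f : (ℝ → E) → ℝ → E := fun u t => ∫ r in (0 : ℝ)..1, D r (G (clamp t * r) (u (clamp t * r)))
  have hfc : ∀ u, Continuous u → Continuous (f u) := fun u hu =>
    intervalIntegral.continuous_parametric_intervalIntegral_of_continuous' (hint u hu) 0 1
  have hfb : ∀ u : ℝ → E, (∀ t, ‖u t‖ ≤ M) → ∀ t, ‖f u t‖ ≤ M := by
    intro u hu t
    have := intervalIntegral.norm_integral_le_of_norm_le_const (a := (0 : ℝ)) (b := 1) (C := M)
      (f := fun r => D r (G (clamp t * r) (u (clamp t * r)))) fun r hr => by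
        rw [Set.uIoc_of_le zero_le_one] at hr
        have hr' : r ∈ Set.Icc (0 : ℝ) 1 := ⟨hr.1.le, hr.2⟩
        exact (hDnorm r hr' _).trans (hGM _ (hcm t r hr') _ (hu _))
    simpa using this
  let α := Metric.closedBall (0 : BoundedContinuousFunction ℝ E) M
  have hα : ∀ u : α, ∀ t, ‖(u : BoundedContinuousFunction ℝ E) t‖ ≤ M := fun u t =>
    ((u : BoundedContinuousFunction ℝ E).norm_coe_le_norm t).trans
      (mem_closedBall_zero_iff.1 u.2)
  let Φ : α → α := fun u =>
    ⟨BoundedContinuousFunction.ofNormedAddCommGroup (f u.1) (hfc _ u.1.continuous) M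
      (hfb _ (hα u)), mem_closedBall_zero_iff.2
        (BoundedContinuousFunction.norm_ofNormedAddCommGroup_le _ hM _)⟩
  have hcontr : ContractingWith (1 / 2) Φ := by
    refine ⟨by rw [← NNReal.coe_lt_coe]; norm_num, LipschitzWith.of_dist_le_mul fun u v => ?_⟩
    rw [Subtype.dist_eq, Subtype.dist_eq]
    refine (BoundedContinuousFunction.dist_le (by positivity)).2 fun t => ?_
    change dist (f u.1 t) (f v.1 t) ≤ _
    rw [dist_eq_norm]
    have hi : ∀ w : α, IntervalIntegrable (fun r => D r (G (clamp t * r) (w.1 (clamp t * r))))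
        MeasureTheory.volume 0 1 := fun w =>
      ((hint w.1 w.1.continuous).comp (continuous_const.prodMk continuous_id)).intervalIntegrable _ _
    change ‖(∫ r in (0 : ℝ)..1, D r (G (clamp t * r) (u.1 (clamp t * r)))) -
      ∫ r in (0 : ℝ)..1, D r (G (clamp t * r) (v.1 (clamp t * r)))‖ ≤ _
    rw [← intervalIntegral.integral_sub (hi u) (hi v)]
    have := intervalIntegral.norm_integral_le_of_norm_le_const (a := (0 : ℝ)) (b := 1)
      (C := 1 / 2 * dist u.1 v.1)
      (f := fun r => D r (G (clamp t * r) (u.1 (clamp t * r))) -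
        D r (G (clamp t * r) (v.1 (clamp t * r)))) fun r hr => by
        rw [Set.uIoc_of_le zero_le_one] at hr
        have hr' : r ∈ Set.Icc (0 : ℝ) 1 := ⟨hr.1.le, hr.2⟩
        rw [hDsub]
        refine (hDnorm r hr' _).trans ((hGL _ (hcm t r hr') _ _ (hα u _) (hα v _)).trans ?_)
        rw [← dist_eq_norm]
        gcongr
        exact BoundedContinuousFunction.dist_coe_le_dist _
    simpa using this
  have : Nonempty α := ⟨⟨0, Metric.mem_closedBall_self hM⟩⟩
  have : CompleteSpace α := Metric.isClosed_closedBall.completeSpace_coe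
  have hfix := hcontr.fixedPoint_isFixedPt
  set w := ContractingWith.fixedPoint Φ hcontr
  refine ⟨w.1, w.1.continuous, fun t ht => ?_⟩
  have h1 : clamp t = t := by simp [hclamp, ht.1, ht.2]
  have h2 : (Φ w).1 t = w.1 t := by rw [hfix]
  rw [← h2]
  change (∫ r in (0 : ℝ)..1, D r (G (clamp t * r) (w.1 (clamp t * r)))) = _
  rw [h1]

/-- The weighted mean `n(t) = ∫₀¹ r ^ j g(t r) dr` solves `t n' = -(j + 1) n + g`. -/
theorem hasDerivAt_weighted_mean {g n : ℝ → ℝ} (hg : Continuous g) (j : ℕ) {δ : ℝ}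
    (hn : ∀ t ∈ Set.Ioo 0 δ, n t = ∫ r in (0 : ℝ)..1, r ^ j * g (t * r)) {t : ℝ}
    (ht : t ∈ Set.Ioo 0 δ) : HasDerivAt n ((g t - (j + 1) * n t) / t) t := by
  -- Substituting s r for r turns the mean into a primitive divided by a power of s, which can be
  -- differentiated.
  have hform : ∀ s ∈ Set.Ioo 0 δ, n s = (∫ r in (0 : ℝ)..s, r ^ j * g r) / s ^ (j + 1) := by
    intro s hs
    have hs0 := hs.1.ne'
    have h := intervalIntegral.integral_comp_mul_left (a := 0) (b := 1)
      (fun r => r ^ j * g r) hs0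
    have h' : ∫ r in (0 : ℝ)..1, (s * r) ^ j * g (s * r) =
        s ^ j * ∫ r in (0 : ℝ)..1, r ^ j * g (s * r) := by
      rw [← intervalIntegral.integral_const_mul]
      congr 1
      ext r
      ring
    rw [h', ← hn s hs, mul_zero, mul_one, smul_eq_mul] at h
    rw [eq_div_iff (by positivity), pow_succ]
    field_simp at h
    linarith
  have hc : Continuous fun r => r ^ j * g r := by fun_prop
  have ht0 := ht.1.ne'
  have hd := (hc.integral_hasStrictDerivAt 0 t).hasDerivAt.div (hasDerivAt_pow (j + 1) t)
    (by positivity)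
  have heq : n =ᶠ[𝓝 t] fun s => (∫ r in (0 : ℝ)..s, r ^ j * g r) / s ^ (j + 1) := by
    filter_upwards [isOpen_Ioo.mem_nhds ht] with s hs using hform s hs
  refine (hd.congr_of_eventuallyEq heq).congr_deriv ?_
  rw [hform t ht, Nat.add_sub_cancel]
  push_cast
  field_simp
  ring

/-- Set R'/R = 1/t + t n, l' = t m, l = l₀ + t p. Then t n' = -3 n + ..., t m' = -2 m + ... and t p'
= -p + t m, which is the form solved by `exists_singular_picard` with weights r², r and 1. The
unknowns enter the right sides only with a factor t, so a short interval gives a contraction. -/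
theorem exists_core (k V₀ l₀ : ℝ) : ∃ (T : EReal) (R x l y : ℝ → ℝ), Core k V₀ l₀ T R x l y := by
  set V : ℝ → ℝ := fun s => V₀ * Real.exp (lam k * s) with hV
  have hVc : Continuous V := by fun_prop
  set κ : ℝ := 2 / k ^ 2 with hκ
  have hκ0 : 0 ≤ κ := by positivity
  -- One more than a bound for the source term `G t 0`, leaving room for the iterates in the ball of
  -- radius M.
  set M : ℝ := |1 / 4 - V l₀| + |1 / 4 - κ * V l₀| + 1 with hM
  have hM1 : 1 ≤ M := by
    rw [hM]; linarith [abs_nonneg (1 / 4 - V l₀), abs_nonneg (1 / 4 - κ * V l₀)]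
  obtain ⟨L, hL0, hL⟩ := exists_lipschitz_potential V₀ (lam k) (|l₀| + M)
  set B : ℝ := L + κ * L + 2 * M + 1 with hB
  have hκL : 0 ≤ κ * L := by positivity
  have hB1 : 1 ≤ B := by rw [hB]; linarith
  -- Since B bounds the Lipschitz constant of G divided by t, this gives δ B M = 1/2. Hence the
  -- contraction factor δ B is at most 1/2, and G moves by at most 1/2 within the ball.
  set δ : ℝ := 1 / (2 * B * M) with hδ
  have hBM : 1 ≤ B * M := one_le_mul_of_one_le_of_one_le hB1 hM1
  have hδ0 : 0 < δ := by positivity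
  have hδ1 : δ ≤ 1 := by
    rw [hδ, div_le_one (by positivity)]; linarith
  have hδB : δ * B * M = 1 / 2 := by
    rw [hδ]; field_simp
  set D : ℝ → ℝ × ℝ × ℝ → ℝ × ℝ × ℝ := fun r v => (r ^ 2 * v.1, r ^ 1 * v.2.1, r ^ 0 * v.2.2) with hD
  set G : ℝ → ℝ × ℝ × ℝ → ℝ × ℝ × ℝ := fun t v =>
    (1 / 4 - V (l₀ + t * v.2.2) - t ^ 2 * v.1 ^ 2,
      1 / 4 - κ * V (l₀ + t * v.2.2) - t ^ 2 * (v.1 * v.2.1), t * v.2.1) with hG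
  have hDc : Continuous (Function.uncurry D) := by
    change Continuous fun p : ℝ × ℝ × ℝ × ℝ =>
      (p.1 ^ 2 * p.2.1, p.1 ^ 1 * p.2.2.1, p.1 ^ 0 * p.2.2.2)
    fun_prop
  have hGc : Continuous (Function.uncurry G) := by
    change Continuous fun p : ℝ × ℝ × ℝ × ℝ => (1 / 4 - V (l₀ + p.1 * p.2.2.2) - p.1 ^ 2 * p.2.1 ^ 2,
      1 / 4 - κ * V (l₀ + p.1 * p.2.2.2) - p.1 ^ 2 * (p.2.1 * p.2.2.1), p.1 * p.2.2.1)
    fun_prop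
  have hGL : ∀ t ∈ Set.Icc 0 δ, ∀ v w, ‖v‖ ≤ M → ‖w‖ ≤ M →
      ‖G t v - G t w‖ ≤ δ * B * ‖v - w‖ := by
    rintro t ⟨ht0, htδ⟩ ⟨n, m, p⟩ ⟨n', m', p'⟩ hv hw
    simp only [Prod.norm_def, max_le_iff, Real.norm_eq_abs] at hv hw
    obtain ⟨hn, hm, hp⟩ := hv
    obtain ⟨hn', hm', hp'⟩ := hw
    have ht1 : t ≤ 1 := htδ.trans hδ1
    set S : ℝ := ‖((n, m, p) : ℝ × ℝ × ℝ) - (n', m', p')‖ with hS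
    have hS0 : 0 ≤ S := norm_nonneg _
    have h1 : |n - n'| ≤ S := by
      rw [hS, Prod.norm_def]; exact le_max_left _ _
    have h2 : |m - m'| ≤ S := by
      rw [hS, Prod.norm_def, Prod.norm_def]; exact (le_max_left _ _).trans (le_max_right _ _)
    have h3 : |p - p'| ≤ S := by
      rw [hS, Prod.norm_def, Prod.norm_def]; exact (le_max_right _ _).trans (le_max_right _ _)
    have hlb : ∀ q, |q| ≤ M → |l₀ + t * q| ≤ |l₀| + M := fun q hq => by
      refine (abs_add_le _ _).trans (add_le_add_right ?_ _)
      rw [abs_mul, abs_of_nonneg ht0]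
      exact (mul_le_of_le_one_left (abs_nonneg _) ht1).trans hq
    have hW : |V (l₀ + t * p) - V (l₀ + t * p')| ≤ L * (t * S) := by
      refine (hL _ _ (hlb p hp) (hlb p' hp')).trans ?_
      rw [show l₀ + t * p - (l₀ + t * p') = t * (p - p') by ring, abs_mul, abs_of_nonneg ht0]
      gcongr
    have htt : t ^ 2 ≤ t := by nlinarith
    have hnn : |n ^ 2 - n' ^ 2| ≤ 2 * M * S := by
      rw [show n ^ 2 - n' ^ 2 = (n + n') * (n - n') by ring, abs_mul]
      have : |n + n'| ≤ 2 * M := (abs_add_le _ _).trans (by linarith)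
      gcongr
    have hnm : |n * m - n' * m'| ≤ 2 * M * S := by
      rw [show n * m - n' * m' = n * (m - m') + (n - n') * m' by ring]
      refine (abs_add_le _ _).trans ?_
      rw [abs_mul, abs_mul]
      have e1 : |n| * |m - m'| ≤ M * S := by gcongr
      have e2 : |n - n'| * |m'| ≤ S * M := by gcongr
      linarith
    have hMS : 0 ≤ 2 * M * S := by positivity
    have hLS : 0 ≤ L * S := by positivity
    have hκLS : 0 ≤ κ * L * S := by positivity
    have hfin : t * (B * S) ≤ δ * B * S := by
      rw [mul_assoc]; gcongr
    have hquad : t ^ 2 * (2 * M * S) ≤ t * (2 * M * S) := by gcongr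
    simp only [hG, Prod.mk_sub_mk, Prod.norm_def, max_le_iff, Real.norm_eq_abs]
    refine ⟨le_trans ?_ hfin, le_trans ?_ hfin, le_trans ?_ hfin⟩
    · rw [show 1 / 4 - V (l₀ + t * p) - t ^ 2 * n ^ 2 - (1 / 4 - V (l₀ + t * p') - t ^ 2 * n' ^ 2) =
        -(V (l₀ + t * p) - V (l₀ + t * p')) + -(t ^ 2 * (n ^ 2 - n' ^ 2)) by ring]
      refine (abs_add_le _ _).trans ?_
      rw [abs_neg, abs_neg, abs_mul, abs_of_nonneg (sq_nonneg t)]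
      have : t ^ 2 * |n ^ 2 - n' ^ 2| ≤ t ^ 2 * (2 * M * S) := by gcongr
      have e : t * (B * S) = t * (L * S) + t * (κ * L * S) + t * (2 * M * S) + t * S := by
        rw [hB]; ring
      rw [e]
      have := mul_nonneg ht0 hκLS
      have := mul_nonneg ht0 hS0
      linarith
    · rw [show 1 / 4 - κ * V (l₀ + t * p) - t ^ 2 * (n * m) -
        (1 / 4 - κ * V (l₀ + t * p') - t ^ 2 * (n' * m')) =
        -(κ * (V (l₀ + t * p) - V (l₀ + t * p'))) + -(t ^ 2 * (n * m - n' * m')) by ring]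
      refine (abs_add_le _ _).trans ?_
      rw [abs_neg, abs_neg, abs_mul, abs_mul, abs_of_nonneg (sq_nonneg t), abs_of_nonneg hκ0]
      have : t ^ 2 * |n * m - n' * m'| ≤ t ^ 2 * (2 * M * S) := by gcongr
      have := mul_le_mul_of_nonneg_left hW hκ0
      have e : t * (B * S) = t * (L * S) + t * (κ * L * S) + t * (2 * M * S) + t * S := by
        rw [hB]; ring
      rw [e]
      have := mul_nonneg ht0 hLS
      have := mul_nonneg ht0 hS0
      linarith
    · rw [← mul_sub, abs_mul, abs_of_nonneg ht0]
      have : S ≤ B * S := le_mul_of_one_le_left hS0 hB1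
      gcongr
      exact h2.trans this
  have hGM : ∀ t ∈ Set.Icc 0 δ, ∀ v, ‖v‖ ≤ M → ‖G t v‖ ≤ M := by
    intro t ht v hv
    have h1 := hGL t ht v 0 hv (by rw [norm_zero]; linarith)
    have h2 : δ * B * ‖v - 0‖ ≤ 1 / 2 := by
      rw [sub_zero, ← hδB]; gcongr
    have h3 : ‖G t 0‖ ≤ M - 1 := by
      simp only [hG, Prod.norm_def, Prod.fst_zero, Prod.snd_zero, mul_zero, add_zero, sub_zero,
        max_le_iff, Real.norm_eq_abs, abs_zero, hM, ne_eq, OfNat.ofNat_ne_zero, not_false_eq_true,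
        zero_pow]
      refine ⟨?_, ?_, ?_⟩ <;> linarith [abs_nonneg (1 / 4 - V l₀), abs_nonneg (1 / 4 - κ * V l₀)]
    calc ‖G t v‖ = ‖(G t v - G t 0) + G t 0‖ := by rw [sub_add_cancel]
      _ ≤ _ := norm_add_le _ _
      _ ≤ M := by linarith
  have hδB2 : δ * B ≤ 1 / 2 := by
    rw [← hδB]; exact le_mul_of_one_le_right (by positivity) hM1
  obtain ⟨u, huc, hu⟩ := exists_singular_picard D G hDc hGc
    (fun r v w => by simp only [hD, Prod.mk_sub_mk, Prod.fst_sub, Prod.snd_sub, mul_sub])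
    (fun r hr v => by
      have a1 : |r| ≤ 1 := abs_le.2 ⟨by linarith [hr.1], hr.2⟩
      simp only [hD, Prod.norm_def, norm_mul, norm_pow, Real.norm_eq_abs]
      refine max_le_max ?_ (max_le_max ?_ ?_)
      · exact mul_le_of_le_one_left (abs_nonneg _) (pow_le_one₀ (abs_nonneg _) a1)
      · exact mul_le_of_le_one_left (abs_nonneg _) (pow_le_one₀ (abs_nonneg _) a1)
      · exact mul_le_of_le_one_left (abs_nonneg _) (pow_le_one₀ (abs_nonneg _) a1))
    hδ0.le (by linarith) hGM
    (fun t ht v w hv hw => (hGL t ht v w hv hw).trans (by gcongr))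
  have hintg : ∀ t, IntervalIntegrable (fun r => D r (G (t * r) (u (t * r))))
      MeasureTheory.volume 0 1 := fun t => by
    refine Continuous.intervalIntegrable ?_ _ _
    have h1 : Continuous fun r : ℝ => t * r := by fun_prop
    exact hDc.comp (continuous_id.prodMk (hGc.comp (h1.prodMk (huc.comp h1))))
  set n : ℝ → ℝ := fun t => (u t).1 with hn
  set m : ℝ → ℝ := fun t => (u t).2.1 with hm
  set p : ℝ → ℝ := fun t => (u t).2.2 with hp
  have hnc : Continuous n := by fun_prop
  have hmc : Continuous m := by fun_prop
  have hpc : Continuous p := by fun_prop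
  have proj : ∀ (A : ℝ × ℝ × ℝ →L[ℝ] ℝ), ∀ t ∈ Set.Ioo 0 δ,
      A (u t) = ∫ r in (0 : ℝ)..1, A (D r (G (t * r) (u (t * r)))) := fun A t ht => by
    rw [A.intervalIntegral_comp_comm (hintg t), ← hu t ⟨ht.1.le, ht.2.le⟩]
  have dn : ∀ t ∈ Set.Ioo 0 δ, HasDerivAt n ((1 / 4 - V (l₀ + t * p t) - t ^ 2 * n t ^ 2 -
      3 * n t) / t) t := fun t ht => by
    have := hasDerivAt_weighted_mean (n := n) (g := fun t => 1 / 4 - V (l₀ + t * p t) -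
      t ^ 2 * n t ^ 2) (by fun_prop) 2 (proj (ContinuousLinearMap.fst ℝ ℝ (ℝ × ℝ))) ht
    exact this.congr_deriv (by norm_num)
  have dm : ∀ t ∈ Set.Ioo 0 δ, HasDerivAt m ((1 / 4 - κ * V (l₀ + t * p t) - t ^ 2 * (n t * m t) -
      2 * m t) / t) t := fun t ht => by
    have := hasDerivAt_weighted_mean (n := m) (g := fun t => 1 / 4 - κ * V (l₀ + t * p t) -
      t ^ 2 * (n t * m t)) (by fun_prop) 1 (proj ((ContinuousLinearMap.fst ℝ ℝ ℝ).comp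
        (ContinuousLinearMap.snd ℝ ℝ (ℝ × ℝ)))) ht
    exact this.congr_deriv (by norm_num)
  have dp : ∀ t ∈ Set.Ioo 0 δ, HasDerivAt p ((t * m t - p t) / t) t := fun t ht => by
    have := hasDerivAt_weighted_mean (n := p) (g := fun t => t * m t) (by fun_prop) 0
      (proj ((ContinuousLinearMap.snd ℝ ℝ ℝ).comp (ContinuousLinearMap.snd ℝ ℝ (ℝ × ℝ)))) ht
    exact this.congr_deriv (by norm_num)
  -- The integral of R'/R - 1/t, so that R = t e^N.
  set N : ℝ → ℝ := fun t => ∫ s in (0 : ℝ)..t, s * n s with hN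
  have dN : ∀ t, HasDerivAt N (t * n t) t := fun t =>
    ((by fun_prop : Continuous fun s => s * n s).integral_hasStrictDerivAt 0 t).hasDerivAt
  have hNc : Continuous N := continuous_iff_continuousAt.2 fun t => (dN t).continuousAt
  have hN0 : N 0 = 0 := by simp [hN]
  have mem : ∀ t ∈ openDom (δ : EReal), t ∈ Set.Ioo 0 δ := fun t ht =>
    ⟨ht.1, by exact_mod_cast ht.2⟩
  have lim : ∀ (f : ℝ → ℝ) (a : ℝ), Continuous f → f 0 = a → Tendsto f (𝓝[>] 0) (𝓝 a) :=
    fun f a hf h0 => h0 ▸ (hf.tendsto 0).mono_left nhdsWithin_le_nhds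
  refine ⟨δ, fun t => t * Real.exp (N t), fun t => Real.exp (N t) * (1 + t ^ 2 * n t),
    fun t => l₀ + t * p t, fun t => t * Real.exp (N t) * (t * m t), by exact_mod_cast hδ0,
    fun t ht => mul_pos ht.1 (Real.exp_pos _), fun t ht => ?_, fun t ht => ?_, fun t ht => ?_,
    fun t ht => ?_, lim _ _ (by fun_prop) (by simp), lim _ _ (by fun_prop) (by simp [hN0]),
    lim _ _ (by fun_prop) (by simp), lim _ _ (by fun_prop) (by simp)⟩
  · refine ((hasDerivAt_id t).mul (dN t).exp).congr_deriv ?_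
    simp only [id]
    ring
  · have ht0 := ht.1.ne'
    refine ((dN t).exp.mul (((hasDerivAt_sq (hasDerivAt_id t)).mul (dn t (mem t ht))).const_add
      1)).congr_deriv ?_
    simp only [id, hV, Pi.mul_apply]
    field_simp
    ring
  · have ht0 := ht.1.ne'
    have he := (Real.exp_pos (N t)).ne'
    refine (((hasDerivAt_id t).mul (dp t (mem t ht))).const_add l₀).congr_deriv ?_
    simp only [id]
    field_simp
    ring
  · have ht0 := ht.1.ne'
    refine (((hasDerivAt_id t).mul (dN t).exp).mul ((hasDerivAt_id t).mul
      (dm t (mem t ht)))).congr_deriv ?_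
    simp only [id, hV, hκ, Pi.mul_apply]
    -- The coefficient is kept opaque because k ≠ 0 is not assumed here.
    generalize hK : (2 : ℝ) / k ^ 2 = K
    field_simp
    ring

end SelfSimilarCylinder


namespace SelfSimilarCylinder

/-! ### Regularity at the axis -/

theorem openDom_subset_dom (T : EReal) : openDom T ⊆ dom T := fun _ h => ⟨h.1.le, h.2⟩

theorem mem_openDom_of_mem_dom {T : EReal} {τ : ℝ} (h : τ ∈ dom T) (h0 : τ ≠ 0) : τ ∈ openDom T :=
  ⟨h.1.lt_of_ne' h0, h.2⟩

theorem zero_mem_dom {T : EReal} (hT : 0 < T) : (0 : ℝ) ∈ dom T := ⟨le_rfl, by exact_mod_cast hT⟩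

theorem ordConnected_dom (T : EReal) : (dom T).OrdConnected :=
  ⟨fun _ ha _ hb _ hx => ⟨ha.1.trans hx.1, (EReal.coe_le_coe_iff.2 hx.2).trans_lt hb.2⟩⟩

theorem uniqueDiffOn_dom {T : EReal} (hT : 0 < T) : UniqueDiffOn ℝ (dom T) := by
  refine uniqueDiffOn_convex (ordConnected_dom T).convex ?_
  obtain ⟨τ, h⟩ := exists_mem_openDom hT
  exact ⟨τ, interior_maximal (openDom_subset_dom T) (isOpen_openDom T) h⟩

theorem nhdsGT_zero_le_nhdsWithin_dom {T : EReal} (hT : 0 < T) :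
    𝓝[>] (0 : ℝ) ≤ 𝓝[dom T] 0 := by
  refine le_inf nhdsWithin_le_nhds (le_principal_iff.2 ?_)
  exact mem_of_superset (openDom_mem_nhdsGT hT) (openDom_subset_dom T)

/-- A function with one-sided limits of its derivatives up to order two at `0` is `C²`. -/
theorem contDiffOn_two_of_openDom {T : EReal} (hT : 0 < T) {f f' f'' : ℝ → ℝ} {a b : ℝ}
    (h : ∀ τ ∈ openDom T, HasDerivAt f (f' τ) τ) (h' : ∀ τ ∈ openDom T, HasDerivAt f' (f'' τ) τ)
    (hc : ContinuousOn f'' (openDom T)) (h0 : Tendsto f (𝓝[>] 0) (𝓝 (f 0)))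
    (h1 : Tendsto f' (𝓝[>] 0) (𝓝 a)) (h2 : Tendsto f'' (𝓝[>] 0) (𝓝 b)) :
    ContDiffOn ℝ 2 f (dom T) ∧ HasDerivWithinAt f a (Set.Ici 0) 0 := by
  have base : ∀ {g g' : ℝ → ℝ} {e : ℝ}, (∀ τ ∈ openDom T, HasDerivAt g (g' τ) τ) →
      Tendsto g (𝓝[>] 0) (𝓝 (g 0)) → Tendsto g' (𝓝[>] 0) (𝓝 e) →
      HasDerivWithinAt g e (Set.Ici 0) 0 := by
    intro g g' e hg h0 h1
    refine hasDerivWithinAt_Ici_of_tendsto_deriv (s := openDom T)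
      (fun t ht => (hg t ht).differentiableAt.differentiableWithinAt)
      (h0.mono_left (nhdsWithin_mono _ fun t ht => ht.1)) (openDom_mem_nhdsGT hT) (h1.congr' ?_)
    filter_upwards [openDom_mem_nhdsGT hT] with t ht using (hg t ht).deriv.symm
  -- The derivatives are known only on the open interval; their one-sided limits become their values
  -- at 0.
  have ext : ∀ (g : ℝ → ℝ) (e : ℝ), Set.EqOn (Function.update g 0 e) g (openDom T) :=
    fun g e t ht => Function.update_of_ne ht.1.ne' _ _
  have whole : ∀ {g g' : ℝ → ℝ} {e : ℝ}, (∀ τ ∈ openDom T, HasDerivAt g (g' τ) τ) →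
      Tendsto g (𝓝[>] 0) (𝓝 (g 0)) → Tendsto g' (𝓝[>] 0) (𝓝 e) →
      ∀ τ ∈ dom T, HasDerivWithinAt g (Function.update g' 0 e τ) (dom T) τ := by
    intro g g' e hg h0 h1 τ hτ
    rcases eq_or_ne τ 0 with rfl | hne
    · rw [Function.update_self]
      exact (base hg h0 h1).mono fun t ht => ht.1
    · rw [Function.update_of_ne hne]
      exact (hg τ (mem_openDom_of_mem_dom hτ hne)).hasDerivWithinAt
  have e1 := whole h h0 h1
  have h'' : ∀ τ ∈ openDom T, HasDerivAt (Function.update f' 0 a) (f'' τ) τ := fun τ hτ =>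
    (h' τ hτ).congr_of_eventuallyEq ((ext f' a).eventuallyEq_of_mem (openDom_mem_nhds hτ))
  have h1' : Tendsto (Function.update f' 0 a) (𝓝[>] 0) (𝓝 (Function.update f' 0 a 0)) := by
    rw [Function.update_self]
    exact h1.congr' (((ext f' a).symm).eventuallyEq_of_mem (openDom_mem_nhdsGT hT))
  have e2 := whole h'' h1' h2
  have hu := uniqueDiffOn_dom hT
  refine ⟨?_, base h h0 h1⟩
  have e3 : ContinuousOn (Function.update f'' 0 b) (dom T) := by
    intro τ hτ
    rcases eq_or_ne τ 0 with rfl | hne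
    · rw [continuousWithinAt_update_same]
      refine h2.mono_left (nhdsWithin_mono _ fun t ht => ht.1.1.lt_of_ne' ht.2)
    · have hτ' := mem_openDom_of_mem_dom hτ hne
      refine ContinuousAt.continuousWithinAt ?_
      exact ((hc.continuousAt (openDom_mem_nhds hτ')).congr
        (((ext f'' b).symm).eventuallyEq_of_mem (openDom_mem_nhds hτ')))
  have e4 : ContDiffOn ℝ 1 (Function.update f' 0 a) (dom T) := by
    rw [show (1 : WithTop ℕ∞) = 0 + 1 from rfl, contDiffOn_succ_iff_derivWithin hu]
    refine ⟨fun τ hτ => (e2 τ hτ).differentiableWithinAt, by simp, ?_⟩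
    refine contDiffOn_zero.2 (e3.congr fun τ hτ => (e2 τ hτ).derivWithin (hu τ hτ))
  rw [show (2 : WithTop ℕ∞) = 1 + 1 from one_add_one_eq_two.symm, contDiffOn_succ_iff_derivWithin hu]
  exact ⟨fun τ hτ => (e1 τ hτ).differentiableWithinAt, by simp,
    e4.congr fun τ hτ => (e1 τ hτ).derivWithin (hu τ hτ)⟩

theorem hasDerivAt_of_contDiffOn {T : EReal} {f : ℝ → ℝ} (h : ContDiffOn ℝ 2 f (dom T)) {τ : ℝ}
    (hτ : τ ∈ openDom T) :
    HasDerivAt f (deriv f τ) τ ∧ HasDerivAt (deriv f) (deriv (deriv f) τ) τ := by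
  have h' := h.mono (openDom_subset_dom T)
  rw [show (2 : WithTop ℕ∞) = 1 + 1 from one_add_one_eq_two.symm,
    contDiffOn_succ_iff_deriv_of_isOpen (isOpen_openDom T)] at h'
  have hn := openDom_mem_nhds hτ
  exact ⟨(h'.1.differentiableAt hn).hasDerivAt,
    ((h'.2.2.differentiableOn one_ne_zero).differentiableAt hn).hasDerivAt⟩

theorem tendsto_deriv_of_contDiffOn {T : EReal} (hT : 0 < T) {f : ℝ → ℝ} {e : ℝ}
    (h : ContDiffOn ℝ 2 f (dom T)) (he : HasDerivWithinAt f e (Set.Ici 0) 0) :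
    Tendsto (deriv f) (𝓝[>] 0) (𝓝 e) := by
  have hu := uniqueDiffOn_dom hT
  have h1 := (h.continuousOn_derivWithin hu one_le_two) 0 (zero_mem_dom hT)
  rw [ContinuousWithinAt, (he.mono fun t ht => ht.1).derivWithin (hu 0 (zero_mem_dom hT))] at h1
  refine (h1.mono_left (nhdsGT_zero_le_nhdsWithin_dom hT)).congr' ?_
  filter_upwards [openDom_mem_nhdsGT hT] with t ht
  exact derivWithin_of_mem_nhds (mem_of_superset (openDom_mem_nhds ht) (openDom_subset_dom T))

theorem tendsto_zero_of_continuousOn {T : EReal} (hT : 0 < T) {f : ℝ → ℝ}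
    (h : ContinuousOn f (dom T)) : Tendsto f (𝓝[>] 0) (𝓝 (f 0)) :=
  (h 0 (zero_mem_dom hT)).mono_left (nhdsGT_zero_le_nhdsWithin_dom hT)

/-- Antiderivatives starting from the axis. -/
theorem exists_antideriv {T : EReal} (hT : 0 < T) {f : ℝ → ℝ} {a : ℝ}
    (hf : ContinuousOn f (openDom T)) (ha : Tendsto f (𝓝[>] 0) (𝓝 a)) :
    ∃ F : ℝ → ℝ, F 0 = 0 ∧ (∀ τ ∈ openDom T, HasDerivAt F (f τ) τ) ∧
      Tendsto F (𝓝[>] 0) (𝓝 0) := by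
  set g := Function.update f 0 a with hg
  have heq : Set.EqOn g f (openDom T) := fun t ht => Function.update_of_ne ht.1.ne' _ _
  have hgc : ContinuousOn g (dom T) := by
    intro τ hτ
    rcases eq_or_ne τ 0 with rfl | hne
    · rw [hg, continuousWithinAt_update_same]
      exact ha.mono_left (nhdsWithin_mono _ fun t ht => ht.1.1.lt_of_ne' ht.2)
    · have hτ' := mem_openDom_of_mem_dom hτ hne
      exact ((hf.continuousAt (openDom_mem_nhds hτ')).congr
        (heq.symm.eventuallyEq_of_mem (openDom_mem_nhds hτ'))).continuousWithinAt
  have hgi : ∀ τ ∈ openDom T, IntervalIntegrable g MeasureTheory.volume 0 τ := fun τ hτ => by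
    refine (hgc.mono ?_).intervalIntegrable
    rw [Set.uIcc_of_le hτ.1.le]
    exact fun t ht => ⟨ht.1, (EReal.coe_le_coe_iff.2 ht.2).trans_lt hτ.2⟩
  have hgo : ContinuousOn g (openDom T) := hgc.mono (openDom_subset_dom T)
  refine ⟨fun τ => ∫ s in (0 : ℝ)..τ, g s, intervalIntegral.integral_same, fun τ hτ => ?_, ?_⟩
  · rw [← heq hτ]
    exact intervalIntegral.integral_hasDerivAt_right (hgi τ hτ)
      (hgo.stronglyMeasurableAtFilter (isOpen_openDom T) τ hτ)
      (hgo.continuousAt (openDom_mem_nhds hτ))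
  · obtain ⟨b, hb⟩ := exists_mem_openDom hT
    have h1 := intervalIntegral.continuousOn_primitive_interval' (hgi b hb) Set.left_mem_uIcc
    rw [Set.uIcc_of_le hb.1.le] at h1
    have h2 := h1 0 ⟨le_rfl, hb.1.le⟩
    rw [ContinuousWithinAt, intervalIntegral.integral_same] at h2
    refine h2.mono_left (le_inf nhdsWithin_le_nhds (le_principal_iff.2 ?_))
    exact mem_of_superset (Ioo_mem_nhdsGT hb.1) Set.Ioo_subset_Icc_self

/-! ### Core systems and solutions -/

theorem Core.congr {k V₀ l₀ : ℝ} {T : EReal} {R x l y R' x' l' y' : ℝ → ℝ}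
    (c : Core k V₀ l₀ T R x l y)
    (h : ∀ τ ∈ openDom T, R' τ = R τ ∧ x' τ = x τ ∧ l' τ = l τ ∧ y' τ = y τ) :
    Core k V₀ l₀ T R' x' l' y' := by
  have ev : ∀ {f g : ℝ → ℝ}, (∀ τ ∈ openDom T, f τ = g τ) → ∀ τ ∈ openDom T, f =ᶠ[𝓝 τ] g :=
    fun hfg τ hτ => by filter_upwards [openDom_mem_nhds hτ] with s hs using hfg s hs
  have ev0 : ∀ {f g : ℝ → ℝ}, (∀ τ ∈ openDom T, f τ = g τ) → g =ᶠ[𝓝[>] 0] f :=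
    fun hfg => by filter_upwards [openDom_mem_nhdsGT c.pos] with s hs using (hfg s hs).symm
  have hR := fun τ hτ => (h τ hτ).1
  have hx := fun τ hτ => (h τ hτ).2.1
  have hl := fun τ hτ => (h τ hτ).2.2.1
  have hy := fun τ hτ => (h τ hτ).2.2.2
  exact
  { pos := c.pos
    R_pos := fun τ hτ => by rw [hR τ hτ]; exact c.R_pos τ hτ
    dR := fun τ hτ => by rw [hx τ hτ]; exact (c.dR τ hτ).congr_of_eventuallyEq (ev hR τ hτ)
    dx := fun τ hτ => by
      rw [hR τ hτ, hl τ hτ]; exact (c.dx τ hτ).congr_of_eventuallyEq (ev hx τ hτ)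
    dl := fun τ hτ => by
      rw [hR τ hτ, hy τ hτ]; exact (c.dl τ hτ).congr_of_eventuallyEq (ev hl τ hτ)
    dy := fun τ hτ => by
      rw [hR τ hτ, hl τ hτ]; exact (c.dy τ hτ).congr_of_eventuallyEq (ev hy τ hτ)
    R_lim := c.R_lim.congr' (ev0 hR)
    x_lim := c.x_lim.congr' (ev0 hx)
    l_lim := c.l_lim.congr' (ev0 hl)
    y_lim := c.y_lim.congr' (ev0 hy) }

variable {k V₀ l₀ φ₀ c₁ : ℝ}

theorem IsSolution.core {T : EReal} {s : Fields} (h : IsSolution k V₀ l₀ φ₀ c₁ T s) :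
    Core k V₀ l₀ T s.R (deriv s.R) s.l (fun τ => s.R τ * deriv s.l τ) where
  pos := h.pos
  R_pos := h.R_pos
  dR τ hτ := (hasDerivAt_of_contDiffOn h.smooth_R hτ).1
  dx τ hτ := by rw [← h.eq_b τ hτ]; exact (hasDerivAt_of_contDiffOn h.smooth_R hτ).2
  dl τ hτ := by
    rw [mul_div_cancel_left₀ _ (h.R_pos τ hτ).ne']
    exact (hasDerivAt_of_contDiffOn h.smooth_l hτ).1
  dy τ hτ := by
    rw [← h.eq_d τ hτ, add_comm]
    exact (hasDerivAt_of_contDiffOn h.smooth_R hτ).1.mul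
      (hasDerivAt_of_contDiffOn h.smooth_l hτ).2
  R_lim := by
    have := tendsto_zero_of_continuousOn h.pos h.smooth_R.continuousOn
    rwa [h.R_zero] at this
  x_lim := tendsto_deriv_of_contDiffOn h.pos h.smooth_R h.deriv_R_zero
  l_lim := by
    have := tendsto_zero_of_continuousOn h.pos h.smooth_l.continuousOn
    rwa [h.l_zero] at this
  y_lim := by
    have := (tendsto_zero_of_continuousOn h.pos h.smooth_R.continuousOn).mul
      (tendsto_deriv_of_contDiffOn h.pos h.smooth_l h.deriv_l_zero)
    rwa [h.R_zero, mul_zero] at this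

theorem IsSolution.deriv_φ {T : EReal} {s : Fields} (h : IsSolution k V₀ l₀ φ₀ c₁ T s) {τ : ℝ}
    (hτ : τ ∈ openDom T) : HasDerivAt s.φ (1 / 4 + (1 - deriv s.R τ) / (2 * s.R τ)) τ := by
  have hR := (h.R_pos τ hτ).ne'
  refine (hasDerivAt_of_contDiffOn h.smooth_φ hτ).1.congr_deriv ?_
  have := h.eq_c τ hτ
  field_simp
  linarith

theorem IsSolution.eq {T T' : EReal} {s s' : Fields} (hk : k ≠ 0)
    (h : IsSolution k V₀ l₀ φ₀ c₁ T s) (h' : IsSolution k V₀ l₀ φ₀ c₁ T' s') (hT : T' ≤ T) {τ : ℝ}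
    (hτ : τ ∈ dom T') :
    s'.R τ = s.R τ ∧ s'.l τ = s.l τ ∧ s'.φ τ = s.φ τ ∧ s'.γ τ = s.γ τ := by
  have mem : ∀ t ∈ openDom T', t ∈ openDom T := fun t ht => ⟨ht.1, ht.2.trans_le hT⟩
  have hφ : ∀ t ∈ openDom T', s'.φ t = s.φ t := by
    intro t ht
    rw [← sub_eq_zero]
    refine eq_of_hasDerivAt_zero (f := fun t => s'.φ t - s.φ t) (T := T') (fun σ hσ => ?_) ?_ ht
    · refine ((h'.deriv_φ hσ).sub (h.deriv_φ (mem σ hσ))).congr_deriv ?_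
      obtain ⟨e1, e2, -, -⟩ := h'.core.eq h.core hk hσ (mem σ hσ)
      rw [e1, e2, sub_self]
    · have := (tendsto_zero_of_continuousOn h'.pos h'.smooth_φ.continuousOn).sub
        (tendsto_zero_of_continuousOn h.pos h.smooth_φ.continuousOn)
      rwa [h.φ_zero, h'.φ_zero, sub_self] at this
  have hγ : ∀ t ∈ openDom T', s'.γ t = s.γ t := by
    intro t ht
    have e1 := h.eq_a t (mem t ht)
    have e2 := h'.eq_a t ht
    rw [(h'.core.eq h.core hk ht (mem t ht)).2.2.1, hφ t ht] at e2
    linarith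
  rcases eq_or_ne τ 0 with rfl | hne
  · refine ⟨by rw [h.R_zero, h'.R_zero], by rw [h.l_zero, h'.l_zero], by rw [h.φ_zero, h'.φ_zero],
      ?_⟩
    refine tendsto_nhds_unique
      ((tendsto_zero_of_continuousOn h'.pos h'.smooth_γ.continuousOn).congr' ?_)
      (tendsto_zero_of_continuousOn h.pos h.smooth_γ.continuousOn)
    filter_upwards [openDom_mem_nhdsGT h'.pos] with t ht using hγ t ht
  · have ht := mem_openDom_of_mem_dom hτ hne
    obtain ⟨e1, -, e3, -⟩ := h'.core.eq h.core hk ht (mem τ ht)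
    exact ⟨e1, e3, hφ τ ht, hγ τ ht⟩

/-- φ is the primitive of the right side of `eq_c`, γ is read off from `eq_a`, and `eq_e` is the
conserved constraint. The quotient limits at the axis give C² regularity there. -/
theorem Core.exists_isSolution {T : EReal} {R x l y : ℝ → ℝ} (hk : k ≠ 0)
    (c : Core k V₀ l₀ T R x l y) (φ₀ c₁ : ℝ) : ∃ s : Fields, IsSolution k V₀ l₀ φ₀ c₁ T s := by
  -- A core system prescribes limits at 0 only, so the values there may be corrected.
  wlog h0 : R 0 = 0 ∧ l 0 = l₀ generalizing R l
  · refine this (R := Function.update R 0 0) (l := Function.update l 0 l₀) (c.congr fun τ hτ => ?_)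
      (by simp)
    simp [Function.update_of_ne hτ.1.ne']
  obtain ⟨hR0, hl0⟩ := h0
  have hRne := fun τ hτ => (c.R_pos τ hτ).ne'
  have cR : ContinuousOn R (openDom T) := fun τ hτ => (c.dR τ hτ).continuousAt.continuousWithinAt
  have cx : ContinuousOn x (openDom T) := fun τ hτ => (c.dx τ hτ).continuousAt.continuousWithinAt
  have cl : ContinuousOn l (openDom T) := fun τ hτ => (c.dl τ hτ).continuousAt.continuousWithinAt
  have cy : ContinuousOn y (openDom T) := fun τ hτ => (c.dy τ hτ).continuousAt.continuousWithinAt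
  have cW : ContinuousOn (fun τ => V₀ * Real.exp (lam k * l τ)) (openDom T) := fun τ hτ =>
    (c.dW hτ).continuousAt.continuousWithinAt
  have sR := contDiffOn_two_of_openDom c.pos c.dR c.dx ((continuousOn_const.sub cW).mul cR)
    (by rw [hR0]; exact c.R_lim) c.x_lim ((c.W_lim.const_sub _).mul c.R_lim)
  have hW2 : ∀ τ, 2 / k ^ 2 * V₀ * Real.exp (lam k * l τ) =
    2 / k ^ 2 * (V₀ * Real.exp (lam k * l τ)) := fun τ => by ring
  have l2 : Tendsto (fun τ => 1 / 4 - 2 / k ^ 2 * V₀ * Real.exp (lam k * l τ) -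
      (x τ / R τ) * (y τ / R τ)) (𝓝[>] 0) (𝓝 (1 / 4 - 2 / k ^ 2 * (V₀ * Real.exp (lam k * l₀)) -
      1 * ((1 / 4 - 2 / k ^ 2 * V₀ * Real.exp (lam k * l₀)) / 2))) := by
    refine (((c.W_lim.const_mul _).const_sub _).sub (c.x_lim.mul c.y_div_sq_lim)).congr' ?_
    filter_upwards [openDom_mem_nhdsGT c.pos] with τ hτ
    have := hRne τ hτ
    field_simp
  have sl := contDiffOn_two_of_openDom c.pos c.dl (fun τ hτ => c.dY hτ)
    (by
      simp only [hW2]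
      exact (continuousOn_const.sub (continuousOn_const.mul cW)).sub
        ((cx.div cR hRne).mul (cy.div cR hRne)))
    (by rw [hl0]; exact c.l_lim) c.Y_lim l2
  have lφ : Tendsto (fun τ => 1 / 4 + (1 - x τ) / (2 * R τ)) (𝓝[>] 0) (𝓝 (1 / 4)) := by
    have h := ((c.one_sub_x_div_sq_lim.mul c.R_lim).div_const 2).const_add (1 / 4)
    rw [mul_zero, zero_div, add_zero] at h
    refine h.congr' ?_
    filter_upwards [openDom_mem_nhdsGT c.pos] with τ hτ
    have := hRne τ hτ
    field_simp
  have hR2 : ∀ τ ∈ openDom T, 2 * R τ ≠ 0 := fun τ hτ => mul_ne_zero two_ne_zero (hRne τ hτ)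
  obtain ⟨F, hF0, hF, hFl⟩ := exists_antideriv c.pos (f := fun τ => 1 / 4 + (1 - x τ) / (2 * R τ))
    (continuousOn_const.add ((continuousOn_const.sub cx).div (continuousOn_const.mul cR) hR2)) lφ
  have dφ' : ∀ τ ∈ openDom T, HasDerivAt (fun τ => 1 / 4 + (1 - x τ) / (2 * R τ))
      (-(1 / 4 - V₀ * Real.exp (lam k * l τ)) / 2 - x τ * (1 - x τ) / (2 * R τ ^ 2)) τ := by
    intro τ hτ
    have := hRne τ hτ
    refine ((((c.dx τ hτ).const_sub 1).div ((c.dR τ hτ).const_mul 2) (hR2 τ hτ)).const_add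
      (1 / 4)).congr_deriv ?_
    field_simp
  have sφ := contDiffOn_two_of_openDom c.pos (f := fun τ => φ₀ + F τ)
    (fun τ hτ => (hF τ hτ).const_add φ₀) dφ'
    ((((continuousOn_const.sub cW).neg).div_const 2).sub ((cx.mul (continuousOn_const.sub cx)).div
      (continuousOn_const.mul (cR.pow 2)) fun τ hτ => mul_ne_zero two_ne_zero
        (pow_ne_zero 2 (hRne τ hτ))))
    (by rw [hF0]; exact hFl.const_add φ₀) lφ
    (b := -(1 / 4 - V₀ * Real.exp (lam k * l₀)) / 2 -
      1 * (-(1 / 4 - V₀ * Real.exp (lam k * l₀)) / 2) / 2) (by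
      refine (((c.W_lim.const_sub _).neg.div_const 2).sub
        ((c.x_lim.mul c.one_sub_x_div_sq_lim).div_const 2)).congr' ?_
      filter_upwards [openDom_mem_nhdsGT c.pos] with τ hτ
      have := hRne τ hτ
      field_simp)
  have evx : ∀ τ ∈ openDom T, deriv R =ᶠ[𝓝 τ] x := fun τ hτ => by
    filter_upwards [openDom_mem_nhds hτ] with t ht using (c.dR t ht).deriv
  have evl : ∀ τ ∈ openDom T, deriv l =ᶠ[𝓝 τ] fun t => y t / R t := fun τ hτ => by
    filter_upwards [openDom_mem_nhds hτ] with t ht using (c.dl t ht).deriv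
  refine ⟨⟨R, l, fun τ => φ₀ + F τ, fun τ => (k ^ 2 * l τ / 2 + τ / 2 + c₁) / 2 - (φ₀ + F τ)⟩, ?_⟩
  exact
  { pos := c.pos
    smooth_R := sR.1
    smooth_l := sl.1
    smooth_φ := sφ.1
    smooth_γ := by
      refine ContDiffOn.sub (ContDiffOn.div_const ?_ 2) sφ.1
      exact ((((contDiffOn_const (c := k ^ 2)).mul sl.1).div_const 2).add
        (contDiffOn_id.div_const 2)).add contDiffOn_const
    R_pos := c.R_pos
    eq_a := fun τ hτ => by ring
    eq_b := fun τ hτ => by rw [(evx τ hτ).deriv_eq, (c.dx τ hτ).deriv]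
    eq_c := fun τ hτ => by
      have := hRne τ hτ
      rw [((hF τ hτ).const_add φ₀).deriv, (c.dR τ hτ).deriv]
      field_simp
      ring
    eq_d := fun τ hτ => by
      have := hRne τ hτ
      rw [(evl τ hτ).deriv_eq, (c.dY hτ).deriv, (c.dR τ hτ).deriv, (c.dl τ hτ).deriv]
      generalize (2 : ℝ) / k ^ 2 = K
      field_simp
      ring
    eq_e := fun τ hτ => by
      have hR := hRne τ hτ
      rw [(c.dR τ hτ).deriv, (c.dl τ hτ).deriv]
      have := c.constraint hk hτ
      field_simp
      linear_combination 16 * this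
    R_zero := hR0
    deriv_R_zero := sR.2
    l_zero := hl0
    deriv_l_zero := sl.2
    φ_zero := by simp [hF0] }

/-- The lifetime is the supremum of the lifetimes of all core systems with these data; by uniqueness
they patch together. -/
theorem exists_isMaximalSolution (hk : k ≠ 0) :
    ∃ (T : EReal) (s : Fields), IsMaximalSolution k V₀ l₀ φ₀ c₁ T s := by
  classical
  let P : EReal → (ℝ → ℝ) × (ℝ → ℝ) × (ℝ → ℝ) × (ℝ → ℝ) → Prop := fun T' f =>
    Core k V₀ l₀ T' f.1 f.2.1 f.2.2.1 f.2.2.2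
  let S : Set EReal := {T' | ∃ f, P T' f}
  have hS : ∀ τ ∈ openDom (sSup S), ∃ T' f, P T' f ∧ τ ∈ openDom T' := fun τ hτ => by
    obtain ⟨T', ⟨f, hf⟩, h⟩ := lt_sSup_iff.1 hτ.2
    exact ⟨T', f, hf, hτ.1, h⟩
  -- At each time τ one core system alive at τ is selected and evaluated at τ. By uniqueness this
  -- agrees with every core system alive there, hence is locally one of them.
  choose! T' f hf hmem using hS
  have loc : ∀ σ T'' g, P T'' g → σ ∈ openDom T'' → σ ∈ openDom (sSup S) → (f σ).1 σ = g.1 σ ∧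
      (f σ).2.1 σ = g.2.1 σ ∧ (f σ).2.2.1 σ = g.2.2.1 σ ∧ (f σ).2.2.2 σ = g.2.2.2 σ :=
    fun σ T'' g hg h1 h2 => (hf σ h2).eq hg hk (hmem σ h2) h1
  have sub : ∀ T'' g, P T'' g → ∀ σ ∈ openDom T'', σ ∈ openDom (sSup S) := fun T'' g hg σ hσ =>
    ⟨hσ.1, hσ.2.trans_le (le_sSup ⟨g, hg⟩)⟩
  have cc : ∀ T'' g, P T'' g → Core k V₀ l₀ T'' (fun σ => (f σ).1 σ) (fun σ => (f σ).2.1 σ)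
      (fun σ => (f σ).2.2.1 σ) (fun σ => (f σ).2.2.2 σ) := fun T'' g hg =>
    Core.congr hg fun σ hσ => loc σ T'' g hg hσ (sub T'' g hg σ hσ)
  obtain ⟨T₀, R, x, l, y, c₀⟩ := exists_core k V₀ l₀
  have c₀' : P T₀ (R, x, l, y) := c₀
  have d := cc _ _ c₀'
  have c : Core k V₀ l₀ (sSup S) (fun σ => (f σ).1 σ) (fun σ => (f σ).2.1 σ)
      (fun σ => (f σ).2.2.1 σ) (fun σ => (f σ).2.2.2 σ) :=
  { pos := d.pos.trans_le (le_sSup ⟨_, c₀'⟩)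
    R_pos := fun τ hτ => (cc _ _ (hf τ hτ)).R_pos τ (hmem τ hτ)
    dR := fun τ hτ => (cc _ _ (hf τ hτ)).dR τ (hmem τ hτ)
    dx := fun τ hτ => (cc _ _ (hf τ hτ)).dx τ (hmem τ hτ)
    dl := fun τ hτ => (cc _ _ (hf τ hτ)).dl τ (hmem τ hτ)
    dy := fun τ hτ => (cc _ _ (hf τ hτ)).dy τ (hmem τ hτ)
    R_lim := d.R_lim
    x_lim := d.x_lim
    l_lim := d.l_lim
    y_lim := d.y_lim }
  obtain ⟨s, hs⟩ := c.exists_isSolution hk φ₀ c₁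
  refine ⟨sSup S, s, hs, fun T'' s' hs' => ?_⟩
  have hle : T'' ≤ sSup S := le_sSup ⟨(_, _, _, _), hs'.core⟩
  exact ⟨hle, fun τ hτ => hs.eq hk hs' hle hτ⟩

/-- No core system with the same data lives longer. -/
def IsMaximalTime (k V₀ l₀ : ℝ) (T : EReal) : Prop :=
  ∀ (T' : EReal) (R x l y : ℝ → ℝ), Core k V₀ l₀ T' R x l y → T' ≤ T

theorem IsMaximalSolution.isMaximalTime (hk : k ≠ 0) {T : EReal} {s : Fields}
    (h : IsMaximalSolution k V₀ l₀ φ₀ c₁ T s) : IsMaximalTime k V₀ l₀ T := by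
  intro T' R x l y c
  obtain ⟨s', hs'⟩ := c.exists_isSolution hk φ₀ c₁
  exact (h.2 T' s' hs').1

/-! ### Continuation -/

theorem hasDerivAt_glue {f g : ℝ → ℝ} {a d τ : ℝ} (hf : τ ≤ a → HasDerivAt f d τ)
    (hg : a ≤ τ → HasDerivAt g d τ) (h : f a = g a) :
    HasDerivAt (fun t => if t ≤ a then f t else g t) d τ := by
  rcases lt_trichotomy τ a with h1 | rfl | h1
  · refine (hf h1.le).congr_of_eventuallyEq ?_
    filter_upwards [Iio_mem_nhds h1] with t ht using if_pos (le_of_lt ht)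
  · have e1 : HasDerivWithinAt (fun t => if t ≤ τ then f t else g t) d (Set.Iic τ) τ :=
      (hf le_rfl).hasDerivWithinAt.congr (fun t ht => if_pos ht) (if_pos le_rfl)
    have e2 : HasDerivWithinAt (fun t => if t ≤ τ then f t else g t) d (Set.Ici τ) τ := by
      refine (hg le_rfl).hasDerivWithinAt.congr (fun t ht => ?_) (by rw [if_pos le_rfl, h])
      rcases eq_or_lt_of_le (Set.mem_Ici.1 ht) with rfl | h2
      · rw [if_pos le_rfl, h]
      · rw [if_neg h2.not_ge]
    have := e1.union e2
    rwa [Set.Iic_union_Ici, hasDerivWithinAt_univ] at this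
  · refine (hg h1.le).congr_of_eventuallyEq ?_
    filter_upwards [Ioi_mem_nhds h1] with t ht using if_neg (not_le.2 ht)

theorem exists_abs_le_of_hasDerivAt {f f' : ℝ → ℝ} {a b B : ℝ}
    (h : ∀ t ∈ Set.Ico a b, HasDerivAt f (f' t) t) (hB : ∀ t ∈ Set.Ico a b, |f' t| ≤ B) :
    ∃ C, ∀ t ∈ Set.Ico a b, |f t| ≤ C := by
  refine ⟨|f a| + |B| * (b - a), fun t ht => ?_⟩
  have ha : a ∈ Set.Ico a b := ⟨le_rfl, ht.1.trans_lt ht.2⟩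
  have := (convex_Ico a b).norm_image_sub_le_of_norm_hasDerivWithin_le
    (fun s hs => (h s hs).hasDerivWithinAt) (fun s hs => (hB s hs).trans (le_abs_self B)) ha ht
  rw [Real.norm_eq_abs, Real.norm_eq_abs, abs_of_nonneg (sub_nonneg.2 ht.1)] at this
  have h2 : |B| * (t - a) ≤ |B| * (b - a) := by gcongr; exact ht.2.le
  have h3 := abs_sub_abs_le_abs_sub (f t) (f a)
  linarith

/-- The quantity `R' - k² R l' / 2` has derivative `-(λ / 4) R`. -/
theorem Core.dZ {T : EReal} {R x l y : ℝ → ℝ} (c : Core k V₀ l₀ T R x l y) (hk : k ≠ 0) {τ : ℝ}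
    (hτ : τ ∈ openDom T) :
    HasDerivAt (fun t => x t - k ^ 2 / 2 * y t) (-(lam k / 4) * R τ) τ := by
  refine ((c.dx τ hτ).sub ((c.dy τ hτ).const_mul (k ^ 2 / 2))).congr_deriv ?_
  rw [lam]
  field_simp
  ring

/-- Together with `Core.dZ`, this controls l by R without reference to the potential. -/
theorem Core.d_log {T : EReal} {R x l y : ℝ → ℝ} (c : Core k V₀ l₀ T R x l y) {τ : ℝ}
    (hτ : τ ∈ openDom T) :
    HasDerivAt (fun t => k ^ 2 / 2 * l t - Real.log (R t))
      (-((x τ - k ^ 2 / 2 * y τ) / R τ)) τ := by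
  have hR := (c.R_pos τ hτ).ne'
  refine (((c.dl τ hτ).const_mul (k ^ 2 / 2)).sub ((c.dR τ hτ).log hR)).congr_deriv ?_
  field_simp
  ring

/-- R bounded above bounds Z' = -(λ/4) R, hence Z on a bounded interval. R bounded below then bounds
Z / R, hence k² l / 2 - log R. No a priori bound for e^(λ l) is needed. -/
theorem Core.l_bounded {T : EReal} {R x l y : ℝ → ℝ} (c : Core k V₀ l₀ T R x l y) (hk : k ≠ 0)
    {t : ℝ} (hT : T = t) {τ₁ a b : ℝ} (h1 : τ₁ ∈ openDom T) (ha : 0 < a)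
    (hR : ∀ τ ∈ Set.Ico τ₁ t, a ≤ R τ ∧ R τ ≤ b) : ∃ C, ∀ τ ∈ Set.Ico τ₁ t, |l τ| ≤ C := by
  subst hT
  have mem : ∀ τ ∈ Set.Ico τ₁ t, τ ∈ openDom (t : EReal) := fun τ hτ =>
    ⟨h1.1.trans_le hτ.1, by exact_mod_cast hτ.2⟩
  obtain ⟨C₁, hC₁⟩ := exists_abs_le_of_hasDerivAt (B := |lam k / 4| * b)
    (fun τ hτ => c.dZ hk (mem τ hτ))
    (fun τ hτ => by
      rw [abs_mul, abs_neg, abs_of_pos (c.R_pos τ (mem τ hτ))]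
      gcongr
      exact (hR τ hτ).2)
  obtain ⟨C₂, hC₂⟩ := exists_abs_le_of_hasDerivAt (B := |C₁| / a)
    (fun τ hτ => c.d_log (mem τ hτ))
    (fun τ hτ => by
      rw [abs_neg, abs_div, abs_of_pos (c.R_pos τ (mem τ hτ))]
      have := (hC₁ τ hτ).trans (le_abs_self _)
      gcongr
      exact (hR τ hτ).1)
  refine ⟨2 / k ^ 2 * (C₂ + (|Real.log a| + |Real.log b|)), fun τ hτ => ?_⟩
  have e1 := hC₂ τ hτ
  have e2 : |Real.log (R τ)| ≤ |Real.log a| + |Real.log b| := by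
    have p1 := Real.log_le_log ha (hR τ hτ).1
    have p2 := Real.log_le_log (c.R_pos τ (mem τ hτ)) (hR τ hτ).2
    rw [abs_le]
    constructor
    · linarith [neg_abs_le (Real.log a), abs_nonneg (Real.log b)]
    · linarith [le_abs_self (Real.log b), abs_nonneg (Real.log a)]
  have e3 : |k ^ 2 / 2 * l τ| ≤ C₂ + (|Real.log a| + |Real.log b|) := by
    have := abs_sub_abs_le_abs_sub (k ^ 2 / 2 * l τ) (Real.log (R τ))
    linarith
  have hk2 : 0 < k ^ 2 / 2 := by positivity
  rw [abs_mul, abs_of_pos hk2] at e3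
  calc |l τ| = 2 / k ^ 2 * (k ^ 2 / 2 * |l τ|) := by field_simp
    _ ≤ _ := by gcongr

/-- A maximal solution of finite lifetime cannot keep `R` between positive bounds. -/
theorem Core.not_bounded {T : EReal} {R x l y : ℝ → ℝ} (c : Core k V₀ l₀ T R x l y) (hk : k ≠ 0)
    (hmax : IsMaximalTime k V₀ l₀ T) {t : ℝ} (hT : T = t) {τ₁ a b : ℝ} (h1 : τ₁ ∈ openDom T)
    (ha : 0 < a) (hR : ∀ τ ∈ Set.Ico τ₁ t, a ≤ R τ ∧ R τ ≤ b) : False := by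
  obtain ⟨C, hC⟩ := c.l_bounded hk hT h1 ha hR
  subst hT
  have mem : ∀ τ ∈ Set.Ico τ₁ t, τ ∈ openDom (t : EReal) := fun τ hτ =>
    ⟨h1.1.trans_le hτ.1, by exact_mod_cast hτ.2⟩
  have h1t : τ₁ < t := by exact_mod_cast h1.2
  have hpot : ∀ (q : ℝ) , ∀ τ ∈ Set.Ico τ₁ t, |(1 / 4 - q * Real.exp (lam k * l τ)) * R τ| ≤
      (1 / 4 + |q| * Real.exp (|lam k| * C)) * b := fun q τ hτ => by
    rw [abs_mul, abs_of_pos (c.R_pos τ (mem τ hτ))]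
    have e1 : Real.exp (lam k * l τ) ≤ Real.exp (|lam k| * C) := by
      apply Real.exp_le_exp.2
      refine (le_abs_self _).trans ?_
      rw [abs_mul]
      exact mul_le_mul_of_nonneg_left (hC τ hτ) (abs_nonneg _)
    have e2 : |1 / 4 - q * Real.exp (lam k * l τ)| ≤ 1 / 4 + |q| * Real.exp (|lam k| * C) := by
      refine (abs_sub _ _).trans ?_
      rw [abs_mul, abs_of_pos (Real.exp_pos _), abs_of_pos (by norm_num : (0 : ℝ) < 1 / 4)]
      gcongr
    exact mul_le_mul e2 (hR τ hτ).2 (c.R_pos τ (mem τ hτ)).le (by positivity)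
  obtain ⟨Cx, hCx⟩ := exists_abs_le_of_hasDerivAt (fun τ hτ => c.dx τ (mem τ hτ)) (hpot V₀)
  obtain ⟨Cy, hCy⟩ := exists_abs_le_of_hasDerivAt (fun τ hτ => c.dy τ (mem τ hτ))
    (hpot (2 / k ^ 2 * V₀))
  -- With log R in place of R the vector field is smooth on the whole space, and positivity of R is
  -- automatic.
  set u : ℝ → ℝ × ℝ × ℝ × ℝ := fun τ => (Real.log (R τ), x τ, l τ, y τ) with hu
  set F : ℝ × ℝ × ℝ × ℝ → ℝ × ℝ × ℝ × ℝ := fun v =>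
    (v.2.1 * Real.exp (-v.1), (1 / 4 - V₀ * Real.exp (lam k * v.2.2.1)) * Real.exp v.1,
      v.2.2.2 * Real.exp (-v.1),
      (1 / 4 - 2 / k ^ 2 * V₀ * Real.exp (lam k * v.2.2.1)) * Real.exp v.1) with hF
  have hFs : ContDiff ℝ 1 F := by rw [hF]; fun_prop
  have hK : IsCompact (Set.Icc (Real.log a) (Real.log b) ×ˢ Set.Icc (-Cx) Cx ×ˢ Set.Icc (-C) C ×ˢ
      Set.Icc (-Cy) Cy) :=
    isCompact_Icc.prod (isCompact_Icc.prod (isCompact_Icc.prod isCompact_Icc))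
  have hev : ∀ᶠ τ in 𝓝[<] t, τ ∈ Set.Ico τ₁ t := Ico_mem_nhdsLT h1t
  -- The trajectory stays in a compact box, so it has a cluster point v at the final time. Near v
  -- all trajectories exist for a common time ε.
  obtain ⟨v, -, hv⟩ := hK.exists_mapClusterPt (f := 𝓝[<] t) (u := u) (by
    refine le_principal_iff.2 (mem_map.2 ?_)
    filter_upwards [hev] with τ hτ
    have hp := c.R_pos τ (mem τ hτ)
    exact ⟨⟨Real.log_le_log ha (hR τ hτ).1, Real.log_le_log hp (hR τ hτ).2⟩, abs_le.1 (hCx τ hτ),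
      abs_le.1 (hC τ hτ), abs_le.1 (hCy τ hτ)⟩)
  obtain ⟨r, hr, ε, hε, H⟩ := (hFs.contDiffAt
    (x := v)).exists_forall_mem_closedBall_exists_eq_forall_mem_Ioo_hasDerivAt 0
  have hfreq := hv.frequently (Metric.closedBall_mem_nhds v hr)
  -- A time later than t - ε at which the trajectory is near v: restarting there reaches τ₀ + ε > t.
  obtain ⟨τ₀, h0, hτ₀, hε0⟩ := (hfreq.and_eventually
    (hev.and (Ioo_mem_nhdsLT (show t - ε < t by linarith)))).exists
  obtain ⟨α, hα0, hα⟩ := H (u τ₀) h0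
  have hα' : ∀ s, τ₀ ≤ s → s < τ₀ + ε → HasDerivAt (fun s => α (s - τ₀)) (F (α (s - τ₀))) s := by
    intro s hs hs'
    have := (hα (s - τ₀) ⟨by linarith, by linarith⟩).comp_sub_const s τ₀
    exact this
  set T' : EReal := ((τ₀ + ε : ℝ) : EReal) with hT'
  have hu0 : α (τ₀ - τ₀) = u τ₀ := by rw [sub_self]; exact hα0
  have ht0 : (0 : ℝ) < τ₀ := h1.1.trans_le hτ₀.1
  have memt : ∀ s, 0 < s → s ≤ τ₀ → s ∈ openDom (t : EReal) := fun s hs h =>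
    mem_openDom_of_le (mem τ₀ hτ₀) hs h
  have mem' : ∀ s ∈ openDom T', s < τ₀ + ε := fun s hs => EReal.coe_lt_coe_iff.1 hs.2
  have hRpos := c.R_pos τ₀ (mem τ₀ hτ₀)
  have pr1 : ∀ s, τ₀ ≤ s → s < τ₀ + ε → HasDerivAt (fun s => (α (s - τ₀)).1) (F (α (s - τ₀))).1 s :=
    fun s hs hs' => (hα' s hs hs').fst
  have pr2 : ∀ s, τ₀ ≤ s → s < τ₀ + ε →
      HasDerivAt (fun s => (α (s - τ₀)).2.1) (F (α (s - τ₀))).2.1 s :=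
    fun s hs hs' => (hα' s hs hs').snd.fst
  have pr3 : ∀ s, τ₀ ≤ s → s < τ₀ + ε →
      HasDerivAt (fun s => (α (s - τ₀)).2.2.1) (F (α (s - τ₀))).2.2.1 s :=
    fun s hs hs' => (hα' s hs hs').snd.snd.fst
  have pr4 : ∀ s, τ₀ ≤ s → s < τ₀ + ε →
      HasDerivAt (fun s => (α (s - τ₀)).2.2.2) (F (α (s - τ₀))).2.2.2 s :=
    fun s hs hs' => (hα' s hs hs').snd.snd.snd
  have g1 : R τ₀ = Real.exp (α (τ₀ - τ₀)).1 := by rw [hu0, Real.exp_log hRpos]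
  have g2 : x τ₀ = (α (τ₀ - τ₀)).2.1 := by rw [hu0]
  have g3 : l τ₀ = (α (τ₀ - τ₀)).2.2.1 := by rw [hu0]
  have g4 : y τ₀ = (α (τ₀ - τ₀)).2.2.2 := by rw [hu0]
  have glue : ∀ {f g : ℝ → ℝ} {e : ℝ}, Tendsto f (𝓝[>] 0) (𝓝 e) →
      Tendsto (fun s => if s ≤ τ₀ then f s else g s) (𝓝[>] 0) (𝓝 e) := fun h => by
    refine h.congr' ?_
    filter_upwards [Ioo_mem_nhdsGT ht0] with s hs using (if_pos hs.2.le).symm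
  have c' : Core k V₀ l₀ T' (fun s => if s ≤ τ₀ then R s else Real.exp (α (s - τ₀)).1)
      (fun s => if s ≤ τ₀ then x s else (α (s - τ₀)).2.1)
      (fun s => if s ≤ τ₀ then l s else (α (s - τ₀)).2.2.1)
      (fun s => if s ≤ τ₀ then y s else (α (s - τ₀)).2.2.2) :=
  { pos := by rw [hT']; exact_mod_cast (by linarith : 0 < τ₀ + ε)
    R_pos := fun s hs => by
      split_ifs with h
      · exact c.R_pos s (memt s hs.1 h)
      · exact Real.exp_pos _
    dR := fun s hs => hasDerivAt_glue
      (fun h => by simp only [if_pos h]; exact c.dR s (memt s hs.1 h))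
      (fun h => by
        refine (pr1 s h (mem' s hs)).exp.congr_deriv ?_
        rw [hF, mul_comm, mul_assoc, ← Real.exp_add, neg_add_cancel, Real.exp_zero, mul_one]
        rcases h.eq_or_lt with rfl | h
        · rw [if_pos le_rfl, g2]
        · rw [if_neg h.not_ge]) g1
    dx := fun s hs => hasDerivAt_glue
      (fun h => by simp only [if_pos h]; exact c.dx s (memt s hs.1 h))
      (fun h => by
        refine (pr2 s h (mem' s hs)).congr_deriv ?_
        rcases h.eq_or_lt with rfl | h
        · simp only [le_refl, if_true, g1, g3, hF]
        · simp only [if_neg h.not_ge, hF]) g2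
    dl := fun s hs => hasDerivAt_glue
      (fun h => by simp only [if_pos h]; exact c.dl s (memt s hs.1 h))
      (fun h => by
        refine (pr3 s h (mem' s hs)).congr_deriv ?_
        rcases h.eq_or_lt with rfl | h
        · simp only [le_refl, if_true, g1, g4, hF, Real.exp_neg, div_eq_mul_inv]
        · simp only [if_neg h.not_ge, hF, Real.exp_neg, div_eq_mul_inv]) g3
    dy := fun s hs => hasDerivAt_glue
      (fun h => by simp only [if_pos h]; exact c.dy s (memt s hs.1 h))
      (fun h => by
        refine (pr4 s h (mem' s hs)).congr_deriv ?_
        rcases h.eq_or_lt with rfl | h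
        · simp only [le_refl, if_true, g1, g3, hF]
        · simp only [if_neg h.not_ge, hF]) g4
    R_lim := glue c.R_lim
    x_lim := glue c.x_lim
    l_lim := glue c.l_lim
    y_lim := glue c.y_lim }
  have hle := hmax _ _ _ _ _ c'
  have : τ₀ + ε ≤ t := EReal.coe_le_coe_iff.1 hle
  linarith [hε0.1]

end SelfSimilarCylinder


namespace SelfSimilarCylinder

/-! ### Christoffel symbols and curvature of a self-similar cylindrical metric -/

/-- The points with `u, v < 0` and `-log (v / u) ∈ D`. -/
def region (D : Set ℝ) : Set Event := {y | y 0 < 0 ∧ y 1 < 0 ∧ -Real.log (y 1 / y 0) ∈ D}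

theorem isOpen_region {D : Set ℝ} (hD : IsOpen D) : IsOpen (region D) := by
  have h1 : IsOpen {y : Event | y 0 < 0 ∧ y 1 < 0} :=
    (isOpen_Iio.preimage (continuous_apply 0)).inter (isOpen_Iio.preimage (continuous_apply 1))
  have h2 : ContinuousOn (fun y : Event => -Real.log (y 1 / y 0)) {y : Event | y 0 < 0 ∧ y 1 < 0} :=
    ((((continuous_apply 1).continuousOn).div (continuous_apply 0).continuousOn
      fun y hy => hy.1.ne).log fun y hy => div_ne_zero hy.2.ne hy.1.ne).neg
  have := h2.isOpen_inter_preimage h1 hD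
  convert this using 1
  ext y
  simp [region, and_assoc]

theorem eventually_update_mem_region {D : Set ℝ} (hD : IsOpen D) {x : Event} (hx : x ∈ region D)
    (i : Fin 4) : ∀ᶠ s in 𝓝 (x i), Function.update x i s ∈ region D := by
  have hc : Continuous fun s => Function.update x i s := continuous_const.update i continuous_id
  have := hc.tendsto (x i)
  rw [Function.update_eq_self] at this
  exact this.eventually ((isOpen_region hD).mem_nhds hx)

theorem pd_congr {D : Set ℝ} (hD : IsOpen D) {f f' : Event → ℝ} (h : ∀ y ∈ region D, f y = f' y)
    {x : Event} (hx : x ∈ region D) (i : Fin 4) : pd i f x = pd i f' x := by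
  refine Filter.EventuallyEq.deriv_eq ?_
  filter_upwards [eventually_update_mem_region hD hx i] with s hs using h _ hs

theorem pd_zero_eq (f : ℝ → ℝ → ℝ) (x : Event) :
    pd 0 (fun y => f (y 0) (y 1)) x = deriv (fun u => f u (x 1)) (x 0) := by
  simp [pd, Function.update]

theorem pd_one_eq (f : ℝ → ℝ → ℝ) (x : Event) :
    pd 1 (fun y => f (y 0) (y 1)) x = deriv (fun v => f (x 0) v) (x 1) := by
  simp [pd, Function.update]

theorem pd_two_eq (f : ℝ → ℝ → ℝ) (x : Event) : pd 2 (fun y => f (y 0) (y 1)) x = 0 := by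
  simp [pd, Function.update]

theorem pd_three_eq (f : ℝ → ℝ → ℝ) (x : Event) : pd 3 (fun y => f (y 0) (y 1)) x = 0 := by
  simp [pd, Function.update]

theorem hasDerivAt_time_fst {u v : ℝ} (hu : u ≠ 0) (hv : v ≠ 0) :
    HasDerivAt (fun u => -Real.log (v / u)) (1 / u) u := by
  refine ((((hasDerivAt_const u v).div (hasDerivAt_id u) hu)).log
    (div_ne_zero hv hu)).neg.congr_deriv ?_
  simp only [id, Pi.div_apply]
  field_simp
  ring

theorem hasDerivAt_time_snd {u v : ℝ} (hu : u ≠ 0) (hv : v ≠ 0) :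
    HasDerivAt (fun v => -Real.log (v / u)) (-(1 / v)) v := by
  refine ((((hasDerivAt_id v).div_const u)).log (div_ne_zero hv hu)).neg.congr_deriv ?_
  simp only [id]
  field_simp

/-- The metric `2 a du dv + b dθ² + c dz²`. -/
def blockMetric (a b c : ℝ) : Matrix (Fin 4) (Fin 4) ℝ :=
  !![0, a, 0, 0; a, 0, 0, 0; 0, 0, b, 0; 0, 0, 0, c]

theorem blockMetric_inv {a b c : ℝ} (ha : a ≠ 0) (hb : b ≠ 0) (hc : c ≠ 0) :
    (blockMetric a b c)⁻¹ = blockMetric a⁻¹ b⁻¹ c⁻¹ := by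
  refine Matrix.inv_eq_right_inv ?_
  ext i j
  fin_cases i <;> fin_cases j <;>
    simp [blockMetric, Matrix.mul_apply, Fin.sum_univ_four, ha, hb, hc]

theorem blockMetric_det (a b c : ℝ) : (blockMetric a b c).det = -(a ^ 2 * b * c) := by
  simp [blockMetric, Matrix.det_succ_row_zero, Fin.sum_univ_succ, Fin.succAbove]
  ring

theorem pd_blockMetric (a b c : Event → ℝ) (i m n : Fin 4) (x : Event) :
    pd i (fun y => blockMetric (a y) (b y) (c y) m n) x =
      blockMetric (pd i a x) (pd i b x) (pd i c x) m n := by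
  have h0 : pd i (fun _ => 0) x = 0 := by simp [pd]
  fin_cases m <;> fin_cases n <;> first | rfl | exact h0

/-- A metric that is `2 u⁻¹ e ^ E du dv - u e ^ (2 b) dθ² - u e ^ (2 c) dz²` on `region D`, where
`E, b, c` are functions of `-log (v / u)` with derivatives `E₁, b₁, c₁` and `E₂, b₂, c₂`. -/
structure IsSelfSimilar (g : MetricField) (D : Set ℝ) (E b c E₁ b₁ c₁ E₂ b₂ c₂ : ℝ → ℝ) :
    Prop where
  isOpen : IsOpen D
  eq : ∀ y ∈ region D, g y = blockMetric ((y 0)⁻¹ * Real.exp (E (-Real.log (y 1 / y 0))))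
    (-(y 0) * Real.exp (2 * b (-Real.log (y 1 / y 0))))
    (-(y 0) * Real.exp (2 * c (-Real.log (y 1 / y 0))))
  dE : ∀ τ ∈ D, HasDerivAt E (E₁ τ) τ
  db : ∀ τ ∈ D, HasDerivAt b (b₁ τ) τ
  dc : ∀ τ ∈ D, HasDerivAt c (c₁ τ) τ
  dE₁ : ∀ τ ∈ D, HasDerivAt E₁ (E₂ τ) τ
  db₁ : ∀ τ ∈ D, HasDerivAt b₁ (b₂ τ) τ
  dc₁ : ∀ τ ∈ D, HasDerivAt c₁ (c₂ τ) τ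

/-- The Christoffel symbols `Γ^i_{jk}` of a self-similar metric, as functions of `u`, `v` and
`τ = -log (v / u)`. -/
noncomputable def selfSimilarChristoffel (E b c E₁ b₁ c₁ : ℝ → ℝ) (u v τ : ℝ) :
    Fin 4 → Matrix (Fin 4) (Fin 4) ℝ :=
  ![!![(E₁ τ - 1) / u, 0, 0, 0; 0, 0, 0, 0;
      0, 0, -(u ^ 2 * Real.exp (2 * b τ - E τ) * b₁ τ / v), 0;
      0, 0, 0, -(u ^ 2 * Real.exp (2 * c τ - E τ) * c₁ τ / v)],
    !![0, 0, 0, 0; 0, -(E₁ τ / v), 0, 0;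
      0, 0, u * Real.exp (2 * b τ - E τ) * (1 / 2 + b₁ τ), 0;
      0, 0, 0, u * Real.exp (2 * c τ - E τ) * (1 / 2 + c₁ τ)],
    !![0, 0, (1 / 2 + b₁ τ) / u, 0; 0, 0, -(b₁ τ / v), 0;
      (1 / 2 + b₁ τ) / u, -(b₁ τ / v), 0, 0; 0, 0, 0, 0],
    !![0, 0, 0, (1 / 2 + c₁ τ) / u; 0, 0, 0, -(c₁ τ / v); 0, 0, 0, 0;
      (1 / 2 + c₁ τ) / u, -(c₁ τ / v), 0, 0]]

namespace IsSelfSimilar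

variable {g : MetricField} {D : Set ℝ} {E b c E₁ b₁ c₁ E₂ b₂ c₂ : ℝ → ℝ} {x : Event}

theorem pd_component (h : IsSelfSimilar g D E b c E₁ b₁ c₁ E₂ b₂ c₂) (hx : x ∈ region D)
    {τ : ℝ} (hτ : τ = -Real.log (x 1 / x 0)) (i m n : Fin 4) :
    pd i (fun y => g y m n) x =
      blockMetric ((![(x 0)⁻¹ * Real.exp (E τ) * ((E₁ τ - 1) / x 0),
          -((x 0)⁻¹ * Real.exp (E τ) * (E₁ τ / x 1)), 0, 0] : Fin 4 → ℝ) i)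
        ((![-Real.exp (2 * b τ) * (1 + 2 * b₁ τ), x 0 * Real.exp (2 * b τ) * (2 * b₁ τ / x 1), 0, 0] :
          Fin 4 → ℝ) i)
        ((![-Real.exp (2 * c τ) * (1 + 2 * c₁ τ), x 0 * Real.exp (2 * c τ) * (2 * c₁ τ / x 1), 0, 0] :
          Fin 4 → ℝ) i) m n := by
  obtain ⟨hu, hv, hD⟩ := hx
  have hu0 := hu.ne
  have hv0 := hv.ne
  rw [pd_congr (f' := fun y => blockMetric ((y 0)⁻¹ * Real.exp (E (-Real.log (y 1 / y 0))))
    (-(y 0) * Real.exp (2 * b (-Real.log (y 1 / y 0))))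
    (-(y 0) * Real.exp (2 * c (-Real.log (y 1 / y 0)))) m n) h.isOpen
    (fun y hy => by rw [h.eq y hy]) ⟨hu, hv, hD⟩]
  rw [← hτ] at hD
  have tu := hasDerivAt_time_fst hu0 hv0
  have tv := hasDerivAt_time_snd hu0 hv0
  have cu : ∀ {f f' : ℝ → ℝ}, (∀ τ ∈ D, HasDerivAt f (f' τ) τ) →
      HasDerivAt (fun u => f (-Real.log (x 1 / u))) (f' τ * (1 / x 0)) (x 0) := fun hf =>
    HasDerivAt.comp (x 0) (by rw [← hτ]; exact hf τ hD) tu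
  have cv : ∀ {f f' : ℝ → ℝ}, (∀ τ ∈ D, HasDerivAt f (f' τ) τ) →
      HasDerivAt (fun v => f (-Real.log (v / x 0))) (f' τ * -(1 / x 1)) (x 1) := fun hf =>
    HasDerivAt.comp (x 1) (by rw [← hτ]; exact hf τ hD) tv
  have au := ((hasDerivAt_inv hu0).mul (cu h.dE).exp).deriv
  have bu := ((hasDerivAt_id (x 0)).neg.mul ((cu h.db).const_mul 2).exp).deriv
  have cu' := ((hasDerivAt_id (x 0)).neg.mul ((cu h.dc).const_mul 2).exp).deriv
  have av := ((cv h.dE).exp.const_mul (x 0)⁻¹).deriv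
  have bv := (((cv h.db).const_mul 2).exp.const_mul (-(x 0))).deriv
  have cv' := (((cv h.dc).const_mul 2).exp.const_mul (-(x 0))).deriv
  simp only [← hτ] at au bu cu' av bv cv'
  have key : ∀ f : ℝ → ℝ → ℝ, ∀ i : Fin 4, pd i (fun y => f (y 0) (y 1)) x =
      (![deriv (fun u => f u (x 1)) (x 0), deriv (fun v => f (x 0) v) (x 1), 0, 0] :
        Fin 4 → ℝ) i := by
    intro f i
    fin_cases i
    · exact pd_zero_eq f x
    · exact pd_one_eq f x
    · exact pd_two_eq f x
    · exact pd_three_eq f x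
  have keyA := key (fun u v => u⁻¹ * Real.exp (E (-Real.log (v / u))))
  have keyB := key (fun u v => -u * Real.exp (2 * b (-Real.log (v / u))))
  have keyC := key (fun u v => -u * Real.exp (2 * c (-Real.log (v / u))))
  have eA : ∀ i, pd i (fun y => (y 0)⁻¹ * Real.exp (E (-Real.log (y 1 / y 0)))) x =
      (![(x 0)⁻¹ * Real.exp (E τ) * ((E₁ τ - 1) / x 0),
        -((x 0)⁻¹ * Real.exp (E τ) * (E₁ τ / x 1)), 0, 0] : Fin 4 → ℝ) i := by
    intro i
    rw [keyA i]
    congr 2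
    · refine au.trans ?_
      field_simp
      ring
    · refine av.trans ?_
      field_simp
  have eB : ∀ i, pd i (fun y => -(y 0) * Real.exp (2 * b (-Real.log (y 1 / y 0)))) x =
      (![-Real.exp (2 * b τ) * (1 + 2 * b₁ τ), x 0 * Real.exp (2 * b τ) * (2 * b₁ τ / x 1), 0, 0] :
        Fin 4 → ℝ) i := by
    intro i
    rw [keyB i]
    congr 2
    · refine bu.trans ?_
      simp only [Pi.neg_apply, id]
      field_simp
      ring
    · refine bv.trans ?_
      field_simp
  have eC : ∀ i, pd i (fun y => -(y 0) * Real.exp (2 * c (-Real.log (y 1 / y 0)))) x =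
      (![-Real.exp (2 * c τ) * (1 + 2 * c₁ τ), x 0 * Real.exp (2 * c τ) * (2 * c₁ τ / x 1), 0, 0] :
        Fin 4 → ℝ) i := by
    intro i
    rw [keyC i]
    congr 2
    · refine cu'.trans ?_
      simp only [Pi.neg_apply, id]
      field_simp
      ring
    · refine cv'.trans ?_
      field_simp
  rw [pd_blockMetric, eA i, eB i, eC i]

theorem christoffel_eq (h : IsSelfSimilar g D E b c E₁ b₁ c₁ E₂ b₂ c₂) (hx : x ∈ region D)
    (i j k : Fin 4) : christoffel g i j k x =
      selfSimilarChristoffel E b c E₁ b₁ c₁ (x 0) (x 1) (-Real.log (x 1 / x 0)) i j k := by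
  have hu0 := hx.1.ne
  have hv0 := hx.2.1.ne
  have hinv := blockMetric_inv (a := (x 0)⁻¹ * Real.exp (E (-Real.log (x 1 / x 0))))
    (b := -(x 0) * Real.exp (2 * b (-Real.log (x 1 / x 0))))
    (c := -(x 0) * Real.exp (2 * c (-Real.log (x 1 / x 0)))) (by positivity)
    (mul_ne_zero (neg_ne_zero.2 hu0) (Real.exp_pos _).ne')
    (mul_ne_zero (neg_ne_zero.2 hu0) (Real.exp_pos _).ne')
  simp only [christoffel, h.pd_component hx rfl]
  rw [h.eq x hx, hinv]
  generalize -Real.log (x 1 / x 0) = τ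
  generalize x 0 = u at *
  generalize x 1 = v at *
  simp only [Fin.sum_univ_four, selfSimilarChristoffel, Real.exp_sub]
  have e1 := (Real.exp_pos (E τ)).ne'
  have e2 := (Real.exp_pos (2 * b τ)).ne'
  have e3 := (Real.exp_pos (2 * c τ)).ne'
  generalize Real.exp (E τ) = eE at *
  generalize Real.exp (2 * b τ) = eb at *
  generalize Real.exp (2 * c τ) = ec at *
  clear hinv h hx
  fin_cases i <;> fin_cases j <;> fin_cases k <;> simp [blockMetric] 
  all_goals field_simp
  all_goals ring

end IsSelfSimilar

end SelfSimilarCylinder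


namespace SelfSimilarCylinder

/-! ### The Ricci scalar of a self-similar metric -/

namespace IsSelfSimilar

variable {g : MetricField} {D : Set ℝ} {E b c E₁ b₁ c₁ E₂ b₂ c₂ : ℝ → ℝ} {x : Event}

theorem pd_christoffel (h : IsSelfSimilar g D E b c E₁ b₁ c₁ E₂ b₂ c₂) (hx : x ∈ region D)
    (i j k m : Fin 4) : pd m (christoffel g i j k) x =
      pd m (fun y => selfSimilarChristoffel E b c E₁ b₁ c₁ (y 0) (y 1)
        (-Real.log (y 1 / y 0)) i j k) x :=
  pd_congr h.isOpen (fun _ hy => h.christoffel_eq hy i j k) hx m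

theorem hasDerivAt_comp_fst {f f' : ℝ → ℝ} (hf : ∀ τ ∈ D, HasDerivAt f (f' τ) τ)
    (hx : x ∈ region D) : HasDerivAt (fun u => f (-Real.log (x 1 / u)))
      (f' (-Real.log (x 1 / x 0)) * (1 / x 0)) (x 0) :=
  HasDerivAt.comp (x 0) (hf _ hx.2.2) (hasDerivAt_time_fst hx.1.ne hx.2.1.ne)

theorem hasDerivAt_comp_snd {f f' : ℝ → ℝ} (hf : ∀ τ ∈ D, HasDerivAt f (f' τ) τ)
    (hx : x ∈ region D) : HasDerivAt (fun v => f (-Real.log (v / x 0)))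
      (f' (-Real.log (x 1 / x 0)) * -(1 / x 1)) (x 1) :=
  HasDerivAt.comp (x 1) (hf _ hx.2.2) (hasDerivAt_time_snd hx.1.ne hx.2.1.ne)

theorem pd_const_zero (i : Fin 4) (x : Event) : pd i (fun _ => 0) x = 0 := by simp [pd]

/-- This and the next three lemmas differentiate the shapes in which the Christoffel symbols depend
on u and v. -/
theorem pd_zero_div_snd {f f' : ℝ → ℝ} (hf : ∀ τ ∈ D, HasDerivAt f (f' τ) τ)
    (hx : x ∈ region D) (a : ℝ) :
    pd 0 (fun y => (a + f (-Real.log (y 1 / y 0))) / y 1) x =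
    f' (-Real.log (x 1 / x 0)) / (x 0 * x 1) := by
  rw [pd_zero_eq (fun u v => (a + f (-Real.log (v / u))) / v)]
  refine (((hasDerivAt_comp_fst hf hx).const_add a).div_const (x 1)).deriv.trans ?_
  have := hx.1.ne
  have := hx.2.1.ne
  field_simp

theorem pd_one_div_fst {f f' : ℝ → ℝ} (hf : ∀ τ ∈ D, HasDerivAt f (f' τ) τ)
    (hx : x ∈ region D) (a : ℝ) :
    pd 1 (fun y => (a + f (-Real.log (y 1 / y 0))) / y 0) x =
    -(f' (-Real.log (x 1 / x 0)) / (x 0 * x 1)) := by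
  rw [pd_one_eq (fun u v => (a + f (-Real.log (v / u))) / u)]
  refine (((hasDerivAt_comp_snd hf hx).const_add a).div_const (x 0)).deriv.trans ?_
  have := hx.1.ne
  have := hx.2.1.ne
  field_simp

theorem pd_zero_exp_div {f f' : ℝ → ℝ} (hf : ∀ τ ∈ D, HasDerivAt f (f' τ) τ)
    (hx : x ∈ region D) {w w' : ℝ → ℝ} (hw : ∀ τ ∈ D, HasDerivAt w (w' τ) τ) :
    pd 0 (fun y => -(y 0 ^ 2 * Real.exp (w (-Real.log (y 1 / y 0))) *
      f (-Real.log (y 1 / y 0)) / y 1)) x =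
    -(x 0 * Real.exp (w (-Real.log (x 1 / x 0))) * ((2 + w' (-Real.log (x 1 / x 0))) *
      f (-Real.log (x 1 / x 0)) + f' (-Real.log (x 1 / x 0))) / x 1) := by
  rw [pd_zero_eq (fun u v => -(u ^ 2 * Real.exp (w (-Real.log (v / u))) *
      f (-Real.log (v / u)) / v))]
  refine ((((hasDerivAt_sq (hasDerivAt_id (x 0))).mul (hasDerivAt_comp_fst hw hx).exp).mul
    (hasDerivAt_comp_fst hf hx)).div_const (x 1)).neg.deriv.trans ?_
  have := hx.1.ne
  have := hx.2.1.ne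
  simp only [id, Pi.mul_apply]
  field_simp

theorem pd_one_exp_mul {f f' : ℝ → ℝ} (hf : ∀ τ ∈ D, HasDerivAt f (f' τ) τ)
    (hx : x ∈ region D) {w w' : ℝ → ℝ} (hw : ∀ τ ∈ D, HasDerivAt w (w' τ) τ) :
    pd 1 (fun y => y 0 * Real.exp (w (-Real.log (y 1 / y 0))) *
      (2⁻¹ + f (-Real.log (y 1 / y 0)))) x =
    -(x 0 * Real.exp (w (-Real.log (x 1 / x 0))) * (w' (-Real.log (x 1 / x 0)) *
      (2⁻¹ + f (-Real.log (x 1 / x 0))) + f' (-Real.log (x 1 / x 0))) / x 1) := by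
  rw [pd_one_eq (fun u v => u * Real.exp (w (-Real.log (v / u))) *
      (2⁻¹ + f (-Real.log (v / u))))]
  refine ((((hasDerivAt_comp_snd hw hx).exp.const_mul (x 0))).mul
    ((hasDerivAt_comp_snd hf hx).const_add (2⁻¹))).deriv.trans ?_
  have := hx.1.ne
  have := hx.2.1.ne
  field_simp
  ring

/-- A direct computation. The exponentials of b and c cancel against the inverse metric, so only the
factor e^(-E) remains. -/
theorem ricciScalar_eq (h : IsSelfSimilar g D E b c E₁ b₁ c₁ E₂ b₂ c₂) (hx : x ∈ region D)
    {τ : ℝ} (hτ : τ = -Real.log (x 1 / x 0)) : ricciScalar g x =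
      2 * Real.exp (-E τ) / x 1 * (E₂ τ + 2 * (b₂ τ + c₂ τ + b₁ τ * (1 / 2 + b₁ τ) +
        c₁ τ * (1 / 2 + c₁ τ)) + (1 / 2 + b₁ τ) * c₁ τ + b₁ τ * (1 / 2 + c₁ τ)) := by
  have hu0 := hx.1.ne
  have hv0 := hx.2.1.ne
  have hinv := blockMetric_inv (a := (x 0)⁻¹ * Real.exp (E (-Real.log (x 1 / x 0))))
    (b := -(x 0) * Real.exp (2 * b (-Real.log (x 1 / x 0))))
    (c := -(x 0) * Real.exp (2 * c (-Real.log (x 1 / x 0)))) (by positivity)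
    (mul_ne_zero (neg_ne_zero.2 hu0) (Real.exp_pos _).ne')
    (mul_ne_zero (neg_ne_zero.2 hu0) (Real.exp_pos _).ne')
  -- The inverse metric has only the uv block and two diagonal entries, so four Ricci components
  -- suffice.
  have hr : ricciScalar g x = (g x)⁻¹ 0 1 * (ricciTensor g 0 1 x + ricciTensor g 1 0 x) +
      (g x)⁻¹ 2 2 * ricciTensor g 2 2 x + (g x)⁻¹ 3 3 * ricciTensor g 3 3 x := by
    rw [h.eq x hx, ricciScalar, h.eq x hx, hinv]
    simp [Fin.sum_univ_four, blockMetric]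
    ring
  have dbE : ∀ τ ∈ D, HasDerivAt (fun τ => 2 * b τ - E τ) (2 * b₁ τ - E₁ τ) τ := fun τ hτ =>
    ((h.db τ hτ).const_mul 2).sub (h.dE τ hτ)
  have dcE : ∀ τ ∈ D, HasDerivAt (fun τ => 2 * c τ - E τ) (2 * c₁ τ - E₁ τ) τ := fun τ hτ =>
    ((h.dc τ hτ).const_mul 2).sub (h.dE τ hτ)
  have t1 := pd_one_div_fst h.dE₁ hx (-1)
  have t2 := pd_one_div_fst h.db₁ hx 2⁻¹
  have t3 := pd_one_div_fst h.dc₁ hx 2⁻¹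
  have n : ∀ {f f' : ℝ → ℝ}, (∀ τ ∈ D, HasDerivAt f (f' τ) τ) →
      ∀ τ ∈ D, HasDerivAt (fun t => -f t) (-f' τ) τ := fun hf τ hτ => (hf τ hτ).neg
  have t4 := pd_zero_div_snd (n h.dE₁) hx 0
  have t5 := pd_zero_div_snd (n h.db₁) hx 0
  have t6 := pd_zero_div_snd (n h.dc₁) hx 0
  have t7 := pd_zero_exp_div h.db₁ hx dbE
  have t8 := pd_zero_exp_div h.dc₁ hx dcE
  have t9 := pd_one_exp_mul h.db₁ hx dbE
  have t10 := pd_one_exp_mul h.dc₁ hx dcE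
  have t0 := fun i => pd_const_zero i x
  simp only [zero_add, neg_div] at t4 t5 t6
  simp only [neg_add_eq_sub] at t1
  rw [← hτ] at t1 t2 t3 t4 t5 t6 t7 t8 t9 t10
  have r01 : ricciTensor g 0 1 x = (E₂ τ + b₂ τ + c₂ τ) / (x 0 * x 1) +
      ((1 / 2 + b₁ τ) * b₁ τ + (1 / 2 + c₁ τ) * c₁ τ) / (x 0 * x 1) := by
    simp only [ricciTensor, Fin.sum_univ_four, h.pd_christoffel hx, h.christoffel_eq hx, ← hτ]
    simp only [selfSimilarChristoffel]
    simp [t0]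
    rw [t1, t2, t3]
    field_simp
    ring
  have r10 : ricciTensor g 1 0 x = (E₂ τ + b₂ τ + c₂ τ) / (x 0 * x 1) +
      ((1 / 2 + b₁ τ) * b₁ τ + (1 / 2 + c₁ τ) * c₁ τ) / (x 0 * x 1) := by
    simp only [ricciTensor, Fin.sum_univ_four, h.pd_christoffel hx, h.christoffel_eq hx, ← hτ]
    simp only [selfSimilarChristoffel]
    simp [t0]
    rw [t4, t5, t6]
    field_simp
    ring
  have r22 : ricciTensor g 2 2 x = -(x 0 * Real.exp (2 * b τ - E τ) / x 1 *
      (2 * b₂ τ + 2 * b₁ τ * (1 / 2 + b₁ τ) + b₁ τ * (1 / 2 + c₁ τ) + c₁ τ * (1 / 2 + b₁ τ))) := by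
    simp only [ricciTensor, Fin.sum_univ_four, h.pd_christoffel hx, h.christoffel_eq hx, ← hτ]
    simp only [selfSimilarChristoffel]
    simp [t0]
    rw [t7, t9]
    field_simp
    ring
  have r33 : ricciTensor g 3 3 x = -(x 0 * Real.exp (2 * c τ - E τ) / x 1 *
      (2 * c₂ τ + 2 * c₁ τ * (1 / 2 + c₁ τ) + c₁ τ * (1 / 2 + b₁ τ) + b₁ τ * (1 / 2 + c₁ τ))) := by
    simp only [ricciTensor, Fin.sum_univ_four, h.pd_christoffel hx, h.christoffel_eq hx, ← hτ]
    simp only [selfSimilarChristoffel]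
    simp [t0]
    rw [t8, t10]
    field_simp
    ring
  rw [hr, r01, r10, r22, r33, h.eq x hx, hinv, ← hτ]
  simp only [blockMetric, Real.exp_neg, Real.exp_sub]
  simp
  have e1 := (Real.exp_pos (E τ)).ne'
  have e2 := (Real.exp_pos (2 * b τ)).ne'
  have e3 := (Real.exp_pos (2 * c τ)).ne'
  field_simp
  ring

end IsSelfSimilar

end SelfSimilarCylinder


namespace SelfSimilarCylinder

/-! ### Limits at the end of the interval of existence -/

/-- A monotone bounded function converges at the end of the interval. -/
theorem exists_tendsto_endFilter_of_monotoneOn {T : EReal} {f : ℝ → ℝ} {τ₁ B : ℝ}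
    (h1 : τ₁ ∈ openDom T) (hf : MonotoneOn f {τ | τ ∈ openDom T ∧ τ₁ ≤ τ})
    (hB : ∀ τ ∈ openDom T, τ₁ ≤ τ → f τ ≤ B) :
    ∃ a, Tendsto f (endFilter T) (𝓝 a) ∧ ∀ τ ∈ openDom T, τ₁ ≤ τ → f τ ≤ a := by
  set S := f '' {τ | τ ∈ openDom T ∧ τ₁ ≤ τ} with hS
  have hne : S.Nonempty := ⟨f τ₁, τ₁, ⟨h1, le_rfl⟩, rfl⟩
  have hbdd : BddAbove S := ⟨B, by rintro _ ⟨τ, hτ, rfl⟩; exact hB τ hτ.1 hτ.2⟩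
  have hle : ∀ τ ∈ openDom T, τ₁ ≤ τ → f τ ≤ sSup S := fun τ hτ h =>
    le_csSup hbdd ⟨τ, ⟨hτ, h⟩, rfl⟩
  refine ⟨sSup S, tendsto_order.2 ⟨fun b hb => ?_, fun b hb => ?_⟩, hle⟩
  · obtain ⟨_, ⟨τ, hτ, rfl⟩, hlt⟩ := exists_lt_of_lt_csSup hne hb
    filter_upwards [eventually_endFilter hτ.1] with s hs
    exact hlt.trans_le (hf hτ ⟨hs.1, hτ.2.trans hs.2.le⟩ hs.2.le)
  · filter_upwards [eventually_endFilter h1] with s hs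
    exact (hle s hs.1 hs.2.le).trans_lt hb

theorem exists_tendsto_endFilter_of_antitoneOn {T : EReal} {f : ℝ → ℝ} {τ₁ B : ℝ}
    (h1 : τ₁ ∈ openDom T) (hf : AntitoneOn f {τ | τ ∈ openDom T ∧ τ₁ ≤ τ})
    (hB : ∀ τ ∈ openDom T, τ₁ ≤ τ → B ≤ f τ) :
    ∃ a, Tendsto f (endFilter T) (𝓝 a) ∧ ∀ τ ∈ openDom T, τ₁ ≤ τ → a ≤ f τ := by
  obtain ⟨a, ha, hb⟩ := exists_tendsto_endFilter_of_monotoneOn (f := fun τ => -f τ) (B := -B) h1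
    (fun s hs t ht hst => neg_le_neg (hf hs ht hst)) fun τ hτ h => neg_le_neg (hB τ hτ h)
  exact ⟨-a, by simpa using ha.neg, fun τ hτ h => by linarith [hb τ hτ h]⟩

theorem ordConnected_tail (T : EReal) (τ₁ : ℝ) :
    {τ | τ ∈ openDom T ∧ τ₁ ≤ τ}.OrdConnected :=
  (ordConnected_openDom T).inter Set.ordConnected_Ici

/-! ### The spacetime of a solution -/

variable {k V₀ l₀ φ₀ c₁ : ℝ} {T : EReal} {s : Fields}

namespace IsSolution

/-- `eq_a` replaces 2 γ + 2 φ by an expression in l and τ alone. The factor S² is absorbed into the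
exponent as -τ / 2 + log R, and u < 0 turns |u| into -u. -/
theorem isSelfSimilar (h : IsSolution k V₀ l₀ φ₀ c₁ T s) : IsSelfSimilar s.metric (openDom T)
    (fun τ => k ^ 2 * s.l τ / 2 + τ / 2 + c₁)
    (fun τ => s.φ τ - τ / 2 + Real.log (s.R τ))
    (fun τ => -s.φ τ)
    (fun τ => k ^ 2 / 2 * deriv s.l τ + 1 / 2)
    (fun τ => 1 / 4 + (1 - deriv s.R τ) / (2 * s.R τ) - 1 / 2 + deriv s.R τ / s.R τ)
    (fun τ => -(1 / 4 + (1 - deriv s.R τ) / (2 * s.R τ)))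
    (fun τ => k ^ 2 / 2 * deriv (deriv s.l) τ)
    (fun τ => (-deriv (deriv s.R) τ * (2 * s.R τ) - (1 - deriv s.R τ) * (2 * deriv s.R τ)) /
        (2 * s.R τ) ^ 2 +
      (deriv (deriv s.R) τ * s.R τ - deriv s.R τ * deriv s.R τ) / s.R τ ^ 2)
    (fun τ => -((-deriv (deriv s.R) τ * (2 * s.R τ) - (1 - deriv s.R τ) * (2 * deriv s.R τ)) /
        (2 * s.R τ) ^ 2)) := by
  have dl := fun τ hτ => (hasDerivAt_of_contDiffOn h.smooth_l (τ := τ) hτ)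
  have dR := fun τ hτ => (hasDerivAt_of_contDiffOn h.smooth_R (τ := τ) hτ)
  have hR := fun τ hτ => (h.R_pos τ hτ).ne'
  have hφ' : ∀ τ ∈ openDom T, HasDerivAt (fun τ => 1 / 4 + (1 - deriv s.R τ) / (2 * s.R τ))
      ((-deriv (deriv s.R) τ * (2 * s.R τ) - (1 - deriv s.R τ) * (2 * deriv s.R τ)) /
        (2 * s.R τ) ^ 2) τ := fun τ hτ =>
    ((((dR τ hτ).2.const_sub 1).div ((dR τ hτ).1.const_mul 2)
      (mul_ne_zero two_ne_zero (hR τ hτ))).const_add (1 / 4))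
  refine ⟨isOpen_openDom T, ?_, ?_, ?_, ?_, ?_, ?_, ?_⟩
  · rintro y ⟨hu, hv, hD⟩
    have e1 := h.eq_a _ hD
    have e2 := h.R_pos _ hD
    simp only [Fields.metric, Fields.S]
    generalize -Real.log (y 1 / y 0) = τ at *
    have a1 : -(|y 0|⁻¹ * Real.exp (2 * s.γ τ + 2 * s.φ τ)) =
        (y 0)⁻¹ * Real.exp (k ^ 2 * s.l τ / 2 + τ / 2 + c₁) := by
      rw [e1, abs_of_neg hu, inv_neg, neg_mul, neg_neg]
    have a2 : |y 0| * Real.exp (2 * s.φ τ) * (Real.exp (-τ / 2) * s.R τ) ^ 2 =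
        -(y 0) * Real.exp (2 * (s.φ τ - τ / 2 + Real.log (s.R τ))) := by
      rw [abs_of_neg hu, show 2 * (s.φ τ - τ / 2 + Real.log (s.R τ)) = 2 * s.φ τ + -τ / 2 + -τ / 2 +
        Real.log (s.R τ) + Real.log (s.R τ) by ring, Real.exp_add, Real.exp_add, Real.exp_add,
        Real.exp_add, Real.exp_log e2]
      ring
    have a3 : |y 0| * Real.exp (-2 * s.φ τ) = -(y 0) * Real.exp (2 * -s.φ τ) := by
      rw [abs_of_neg hu]; ring_nf
    rw [a1, a2, a3, blockMetric]
  · intro τ hτ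
    exact (((((dl τ hτ).1.const_mul (k ^ 2)).div_const 2).add
      ((hasDerivAt_id τ).div_const 2)).add_const c₁).congr_deriv (by ring)
  · intro τ hτ
    exact (((h.deriv_φ hτ).sub ((hasDerivAt_id τ).div_const 2)).add ((dR τ hτ).1.log (hR τ hτ)))
  · exact fun τ hτ => (h.deriv_φ hτ).neg
  · exact fun τ hτ => ((dl τ hτ).2.const_mul (k ^ 2 / 2)).add_const (1 / 2)
  · exact fun τ hτ => ((hφ' τ hτ).sub_const (1 / 2)).add ((dR τ hτ).2.div (dR τ hτ).1 (hR τ hτ))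
  · exact fun τ hτ => (hφ' τ hτ).neg

theorem outgoingRay_mem_region {u θ z τ : ℝ} (hu : u < 0) (hτ : τ ∈ openDom T) :
    outgoingRay u θ z τ ∈ region (openDom T) ∧
      τ = -Real.log (outgoingRay u θ z τ 1 / outgoingRay u θ z τ 0) := by
  have e : -Real.log (outgoingRay u θ z τ 1 / outgoingRay u θ z τ 0) = τ := by
    simp [outgoingRay, hu.ne]
  refine ⟨⟨hu, mul_neg_of_neg_of_pos hu (Real.exp_pos _), ?_⟩, e.symm⟩
  rw [e]
  exact hτ

/-- The second derivatives are removed by `eq_b` and `eq_d`, and `eq_e` then eliminates all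
dependence on R and R'. -/
theorem ricciScalar_eq (h : IsSolution k V₀ l₀ φ₀ c₁ T s) (hk : k ≠ 0) {u θ z τ : ℝ} (hu : u < 0)
    (hτ : τ ∈ openDom T) : ricciScalar s.metric (outgoingRay u θ z τ) =
      2 / |u| * Real.exp (τ / 2 - k ^ 2 * s.l τ / 2 - c₁) *
        (2 * (V₀ * Real.exp (lam k * s.l τ)) + k ^ 2 / 4 * (deriv s.l τ ^ 2 - 1 / 4)) := by
  obtain ⟨h1, h2⟩ := outgoingRay_mem_region (θ := θ) (z := z) hu hτ
  rw [h.isSelfSimilar.ricciScalar_eq h1 h2]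
  have hR := (h.R_pos τ hτ).ne'
  have e1 : deriv (deriv s.l) τ = 1 / 4 - 2 / k ^ 2 * V₀ * Real.exp (lam k * s.l τ) -
      deriv s.R τ / s.R τ * deriv s.l τ := by
    have := h.eq_d τ hτ
    generalize (2 : ℝ) / k ^ 2 = K at *
    field_simp
    linear_combination 4 * this
  have e2 := h.eq_b τ hτ
  have e3 := h.eq_e τ hτ
  have e4 : Real.exp (-(k ^ 2 * s.l τ / 2 + τ / 2 + c₁)) / (u * Real.exp (-τ)) =
      -(1 / |u| * Real.exp (τ / 2 - k ^ 2 * s.l τ / 2 - c₁)) := by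
    rw [show τ / 2 - k ^ 2 * s.l τ / 2 - c₁ = -(k ^ 2 * s.l τ / 2 + τ / 2 + c₁) - -τ by ring,
      Real.exp_sub, abs_of_neg hu]
    have := (Real.exp_pos (-τ)).ne'
    have := hu.ne
    field_simp
  have e5 : outgoingRay u θ z τ 1 = u * Real.exp (-τ) := rfl
  rw [e5, mul_div_assoc, e4, e1, e2]
  generalize Real.exp (τ / 2 - k ^ 2 * s.l τ / 2 - c₁) = A
  have hk2 : (2 : ℝ) / k ^ 2 * V₀ * Real.exp (lam k * s.l τ) =
      2 / k ^ 2 * (V₀ * Real.exp (lam k * s.l τ)) := by ring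
  have e3' : 2 * V₀ * Real.exp (lam k * s.l τ) = 2 * (V₀ * Real.exp (lam k * s.l τ)) := by ring
  rw [e3'] at e3
  rw [hk2]
  generalize V₀ * Real.exp (lam k * s.l τ) = W at *
  generalize deriv s.R τ = x at *
  generalize deriv s.l τ = Y at *
  generalize s.R τ = R at *
  have hu' : |u| ≠ 0 := abs_ne_zero.2 hu.ne
  field_simp at e3 ⊢
  linear_combination 2 * A * e3

/-- Only the v component of the geodesic equation is nontrivial. Along the ray v' = -v and Γ^v_{vv}
= -E' / v, which leaves μ'' / μ' = E' - 1 with E = k² l / 2 + τ / 2 + c₁. -/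
theorem isAffineParameter_iff (h : IsSolution k V₀ l₀ φ₀ c₁ T s) {u θ z : ℝ} (hu : u < 0)
    {μ : ℝ → ℝ} : IsAffineParameter s.metric (outgoingRay u θ z) (openDom T) μ ↔
      ContDiffOn ℝ 2 μ (openDom T) ∧ ∀ t ∈ openDom T, 0 < deriv μ t ∧
        deriv (deriv μ) t = (k ^ 2 / 2 * deriv s.l t - 1 / 2) * deriv μ t := by
  refine and_congr_right fun _ => forall₂_congr fun t ht => and_congr_right fun hpos => ?_
  have hE : ∀ t, HasDerivAt (fun t => u * Real.exp (-t)) (-(u * Real.exp (-t))) t := fun t =>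
    (((hasDerivAt_id t).neg.exp).const_mul u).congr_deriv (by simp)
  have d1 : (deriv fun s => outgoingRay u θ z s 1) = fun t => -(u * Real.exp (-t)) :=
    funext fun t => (hE t).deriv
  have d0 : (deriv fun s => outgoingRay u θ z s 0) = fun _ => 0 := by simp [outgoingRay]
  have d2 : (deriv fun s => outgoingRay u θ z s 2) = fun _ => 0 := by simp [outgoingRay]
  have d3 : (deriv fun s => outgoingRay u θ z s 3) = fun _ => 0 := by simp [outgoingRay]
  obtain ⟨h1, h2⟩ := outgoingRay_mem_region (θ := θ) (z := z) hu ht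
  have hchr := fun i j k => h.isSelfSimilar.christoffel_eq h1 i j k
  rw [← h2] at hchr
  have hv : outgoingRay u θ z t 1 = u * Real.exp (-t) := rfl
  have hne : u * Real.exp (-t) ≠ 0 := mul_ne_zero hu.ne (Real.exp_pos _).ne'
  have hdd : deriv (fun t => -(u * Real.exp (-t))) t = u * Real.exp (-t) := by
    exact ((hE t).neg.deriv).trans (neg_neg _)
  have key : (∀ i, deriv (deriv fun s => outgoingRay u θ z s i) t +
      ∑ j, ∑ k, christoffel s.metric i j k (outgoingRay u θ z t) *
        deriv (fun s => outgoingRay u θ z s j) t * deriv (fun s => outgoingRay u θ z s k) t =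
      deriv (deriv μ) t / deriv μ t * deriv (fun s => outgoingRay u θ z s i) t) ↔
      u * Real.exp (-t) + -((k ^ 2 / 2 * deriv s.l t + 1 / 2) / (u * Real.exp (-t))) *
        -(u * Real.exp (-t)) * -(u * Real.exp (-t)) =
      deriv (deriv μ) t / deriv μ t * -(u * Real.exp (-t)) := by
    simp only [Fin.forall_fin_succ, Fin.sum_univ_four, hchr, selfSimilarChristoffel]
    simp [d0, d1, d2, d3, hdd, hv]
  rw [key]
  have hp := hpos.ne'
  constructor
  · intro e
    field_simp at e ⊢
    refine mul_left_cancel₀ hu.ne ?_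
    linear_combination e
  · intro e
    rw [e]
    field_simp
    ring

/-- The rate `e ^ (k² l / 2 - τ / 2)` of affine parameters. -/
theorem hasDerivAt_rate (h : IsSolution k V₀ l₀ φ₀ c₁ T s) {t : ℝ} (ht : t ∈ openDom T) :
    HasDerivAt (fun t => Real.exp (k ^ 2 / 2 * s.l t - t / 2))
      ((k ^ 2 / 2 * deriv s.l t - 1 / 2) * Real.exp (k ^ 2 / 2 * s.l t - t / 2)) t := by
  refine (((hasDerivAt_of_contDiffOn h.smooth_l ht).1.const_mul (k ^ 2 / 2)).sub
    ((hasDerivAt_id t).div_const 2)).exp.congr_deriv ?_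
  change Real.exp (k ^ 2 / 2 * s.l t - t / 2) * _ = _
  ring

theorem exists_isAffineParameter (h : IsSolution k V₀ l₀ φ₀ c₁ T s) {u θ z : ℝ} (hu : u < 0) :
    ∃ μ, IsAffineParameter s.metric (outgoingRay u θ z) (openDom T) μ := by
  have hc : ContinuousOn (fun t => Real.exp (k ^ 2 / 2 * s.l t - t / 2)) (openDom T) := fun t ht =>
    (h.hasDerivAt_rate ht).continuousAt.continuousWithinAt
  have hid : Tendsto (fun t : ℝ => t) (𝓝[>] 0) (𝓝 0) :=
    (tendsto_id (α := ℝ)).mono_left nhdsWithin_le_nhds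
  obtain ⟨F, -, hF, -⟩ := exists_antideriv h.pos hc ((Real.continuous_exp.tendsto _).comp
    ((h.core.l_lim.const_mul (k ^ 2 / 2)).sub (hid.div_const 2)))
  have e : Set.EqOn (deriv F) (fun t => Real.exp (k ^ 2 / 2 * s.l t - t / 2)) (openDom T) :=
    fun t ht => (hF t ht).deriv
  refine ⟨F, (h.isAffineParameter_iff hu).2 ⟨?_, fun t ht => ⟨?_, ?_⟩⟩⟩
  · rw [show (2 : WithTop ℕ∞) = 1 + 1 from one_add_one_eq_two.symm,
      contDiffOn_succ_iff_deriv_of_isOpen (isOpen_openDom T)]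
    refine ⟨fun t ht => (hF t ht).differentiableAt.differentiableWithinAt, by simp, ?_⟩
    have hl := (h.smooth_l.mono (openDom_subset_dom T)).of_le one_le_two
    exact (((contDiffOn_const.mul hl).sub (contDiffOn_id.div_const 2)).exp).congr e
  · rw [e ht]; exact Real.exp_pos _
  · rw [(e.eventuallyEq_of_mem (openDom_mem_nhds ht)).deriv_eq, (h.hasDerivAt_rate ht).deriv, e ht]

/-- The quotient of μ' by the rate has derivative zero, hence is constant. -/
theorem deriv_affine (h : IsSolution k V₀ l₀ φ₀ c₁ T s) {u θ z : ℝ} (hu : u < 0) {μ : ℝ → ℝ}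
    (hμ : IsAffineParameter s.metric (outgoingRay u θ z) (openDom T) μ) :
    ∃ C, 0 < C ∧ ∀ t ∈ openDom T,
      HasDerivAt μ (C * Real.exp (k ^ 2 / 2 * s.l t - t / 2)) t := by
  obtain ⟨h2, h1⟩ := (h.isAffineParameter_iff hu).1 hμ
  rw [show (2 : WithTop ℕ∞) = 1 + 1 from one_add_one_eq_two.symm,
    contDiffOn_succ_iff_deriv_of_isOpen (isOpen_openDom T)] at h2
  set f : ℝ → ℝ := fun t => deriv μ t / Real.exp (k ^ 2 / 2 * s.l t - t / 2) with hf
  have hd : ∀ t ∈ openDom T, HasDerivAt f 0 t := by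
    intro t ht
    have e1 := ((h2.2.2.differentiableOn one_ne_zero).differentiableAt
      (openDom_mem_nhds ht)).hasDerivAt
    refine (e1.div (h.hasDerivAt_rate ht) (Real.exp_pos _).ne').congr_deriv ?_
    rw [(h1 t ht).2]
    have := (Real.exp_pos (k ^ 2 / 2 * s.l t - t / 2)).ne'
    field_simp
    ring
  obtain ⟨t₀, h0⟩ := exists_mem_openDom h.pos
  refine ⟨f t₀, div_pos (h1 t₀ h0).1 (Real.exp_pos _), fun t ht => ?_⟩
  have hmono := monotoneOn_of_hasDerivAt (ordConnected_openDom T) hd fun _ _ => le_rfl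
  have hanti := antitoneOn_of_hasDerivAt (ordConnected_openDom T) hd fun _ _ => le_rfl
  have e : f t = f t₀ := by
    rcases le_total t t₀ with h' | h'
    · exact le_antisymm (hmono ht h0 h') (hanti ht h0 h')
    · exact le_antisymm (hanti h0 ht h') (hmono h0 ht h')
  rw [← e, hf]
  simp only
  rw [div_mul_cancel₀ _ (Real.exp_pos _).ne']
  exact (h2.1.differentiableAt (openDom_mem_nhds ht)).hasDerivAt

/-- Comparison: μ increases, and μ - C G decreases for the constant C of `deriv_affine`. A primitive
G of an upper bound of the rate that is bounded above thus bounds μ. -/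
theorem reachedInFiniteAffineTime (h : IsSolution k V₀ l₀ φ₀ c₁ T s) {τ₁ B : ℝ} {G G' : ℝ → ℝ}
    (h1 : τ₁ ∈ openDom T) (hG : ∀ t ∈ openDom T, τ₁ ≤ t → HasDerivAt G (G' t) t)
    (hle : ∀ t ∈ openDom T, τ₁ ≤ t → Real.exp (k ^ 2 / 2 * s.l t - t / 2) ≤ G' t)
    (hB : ∀ t ∈ openDom T, τ₁ ≤ t → G t ≤ B) : ReachedInFiniteAffineTime s T := by
  refine fun u θ z hu => ⟨h.exists_isAffineParameter hu, fun μ hμ => ?_⟩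
  obtain ⟨C, hC, hd⟩ := h.deriv_affine hu hμ
  have m1 := monotoneOn_of_hasDerivAt (ordConnected_tail T τ₁) (fun t ht => hd t ht.1)
    fun t _ => (mul_pos hC (Real.exp_pos _)).le
  have m2 := antitoneOn_of_hasDerivAt (ordConnected_tail T τ₁)
    (fun t ht => (hd t ht.1).sub ((hG t ht.1 ht.2).const_mul C))
    fun t ht => sub_nonpos.2 (mul_le_mul_of_nonneg_left (hle t ht.1 ht.2) hC.le)
  obtain ⟨a, ha, -⟩ := exists_tendsto_endFilter_of_monotoneOn (B := μ τ₁ - C * G τ₁ + C * B) h1 m1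
    fun t ht h' => by
      have e1 : μ t - C * G t ≤ μ τ₁ - C * G τ₁ := m2 ⟨h1, le_rfl⟩ ⟨ht, h'⟩ h'
      have e2 := mul_le_mul_of_nonneg_left (hB t ht h') hC.le
      linarith
  exact ⟨a, ha⟩

theorem isRadialNullInfinity (h : IsSolution k V₀ l₀ φ₀ c₁ T s) {τ₁ : ℝ} {G G' : ℝ → ℝ}
    (h1 : τ₁ ∈ openDom T) (hG : ∀ t ∈ openDom T, τ₁ ≤ t → HasDerivAt G (G' t) t)
    (hle : ∀ t ∈ openDom T, τ₁ ≤ t → G' t ≤ Real.exp (k ^ 2 / 2 * s.l t - t / 2))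
    (hlim : Tendsto G (endFilter T) atTop) : IsRadialNullInfinity s T := by
  refine fun u θ z hu => ⟨h.exists_isAffineParameter hu, fun μ hμ => ?_⟩
  obtain ⟨C, hC, hd⟩ := h.deriv_affine hu hμ
  have m2 := monotoneOn_of_hasDerivAt (ordConnected_tail T τ₁)
    (fun t ht => (hd t ht.1).sub ((hG t ht.1 ht.2).const_mul C))
    fun t ht => sub_nonneg.2 (mul_le_mul_of_nonneg_left (hle t ht.1 ht.2) hC.le)
  refine tendsto_atTop_mono' _ ?_
    (tendsto_atTop_add_const_left _ (μ τ₁ - C * G τ₁) (hlim.const_mul_atTop hC))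
  filter_upwards [eventually_endFilter h1] with t ht
  have e1 : μ τ₁ - C * G τ₁ ≤ μ t - C * G t := m2 ⟨h1, le_rfl⟩ ⟨ht.1, ht.2.le⟩ ht.2.le
  linarith

end IsSolution

end SelfSimilarCylinder


namespace SelfSimilarCylinder

/-! ### Criteria for the radius and the Ricci scalar in terms of R and l -/

variable {k V₀ l₀ φ₀ c₁ : ℝ} {T : EReal} {s : Fields}

namespace IsSolution

theorem radiusVanishes (h : Tendsto (fun τ => Real.exp (-τ / 2) * s.R τ) (endFilter T) (𝓝 0)) :
    RadiusVanishes s T := fun u _ => by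
  have := h.const_mul |u|
  rw [mul_zero] at this
  exact this

theorem hasCurvatureSingularity (h : IsSolution k V₀ l₀ φ₀ c₁ T s) (hk : k ≠ 0)
    (hlim : Tendsto (fun τ => Real.exp (τ / 2 - k ^ 2 / 2 * s.l τ) *
      (2 * (V₀ * Real.exp (lam k * s.l τ)) + k ^ 2 / 4 * (deriv s.l τ ^ 2 - 1 / 4)))
      (endFilter T) atTop) : HasCurvatureSingularity s T := fun u θ z hu => by
  have hp : 0 < 2 / |u| * Real.exp (-c₁) :=
    mul_pos (div_pos two_pos (abs_pos.2 hu.ne)) (Real.exp_pos _)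
  refine (hlim.const_mul_atTop hp).congr' ?_
  filter_upwards [eventually_mem_openDom h.pos] with τ hτ
  rw [h.ricciScalar_eq hk hu hτ, show τ / 2 - k ^ 2 * s.l τ / 2 - c₁ =
    -c₁ + (τ / 2 - k ^ 2 / 2 * s.l τ) by ring, Real.exp_add]
  ring

theorem ricciScalarDecays (h : IsSolution k V₀ l₀ φ₀ c₁ T s) (hk : k ≠ 0)
    (hlim : Tendsto (fun τ => Real.exp (τ / 2 - k ^ 2 / 2 * s.l τ) *
      (2 * (V₀ * Real.exp (lam k * s.l τ)) + k ^ 2 / 4 * (deriv s.l τ ^ 2 - 1 / 4)))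
      (endFilter T) (𝓝 0)) : RicciScalarDecays s T := fun u θ z hu => by
  have h0 := hlim.const_mul (2 / |u| * Real.exp (-c₁))
  rw [mul_zero] at h0
  refine h0.congr' ?_
  filter_upwards [eventually_mem_openDom h.pos] with τ hτ
  rw [h.ricciScalar_eq hk hu hτ, show τ / 2 - k ^ 2 * s.l τ / 2 - c₁ =
    -c₁ + (τ / 2 - k ^ 2 / 2 * s.l τ) by ring, Real.exp_add]
  ring

end IsSolution

/-! ### Explicit solutions -/

theorem tendsto_nhdsGT_zero {f : ℝ → ℝ} (hf : Continuous f) {c : ℝ} (hc : f 0 = c) :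
    Tendsto f (𝓝[>] 0) (𝓝 c) := by
  rw [← hc]
  exact (hf.tendsto 0).mono_left nhdsWithin_le_nhds

theorem hasDerivAt_sinh_mul_div {a : ℝ} (ha : a ≠ 0) (τ : ℝ) :
    HasDerivAt (fun τ => Real.sinh (a * τ) / a) (Real.cosh (a * τ)) τ :=
  ((((hasDerivAt_id τ).const_mul a).sinh).div_const a).congr_deriv (by
    simp only [id]; field_simp)

theorem hasDerivAt_cosh_mul {a : ℝ} (ha : a ≠ 0) (τ : ℝ) :
    HasDerivAt (fun τ => Real.cosh (a * τ)) (a ^ 2 * (Real.sinh (a * τ) / a)) τ :=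
  (((hasDerivAt_id τ).const_mul a).cosh).congr_deriv (by
    simp only [id]; field_simp)

theorem cosh_mul_eq (a τ : ℝ) :
    Real.cosh (a * τ) - 1 = 2 * Real.sinh (a * τ / 2) ^ 2 ∧
      Real.sinh (a * τ) = 2 * Real.sinh (a * τ / 2) * Real.cosh (a * τ / 2) := by
  have e : a * τ = 2 * (a * τ / 2) := by ring
  constructor
  · conv_lhs => rw [e]
    rw [Real.cosh_two_mul, Real.cosh_sq]
    ring
  · conv_lhs => rw [e]
    rw [Real.sinh_two_mul]

/-- For λ = 0 the potential is the constant V₀ and both equations are linear with R'' = a² R.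
Moreover y' = x', so y = x - 1 and l' = a tanh(a τ / 2). -/
theorem core_sinh_of_sq_eq_two {a : ℝ} (hk : k ^ 2 = 2) (ha : 0 < a) (hV : a ^ 2 = 1 / 4 - V₀)
    (l₀ : ℝ) : Core k V₀ l₀ ⊤ (fun τ => Real.sinh (a * τ) / a) (fun τ => Real.cosh (a * τ))
      (fun τ => l₀ + 2 * Real.log (Real.cosh (a * τ / 2))) (fun τ => Real.cosh (a * τ) - 1) where
  pos := EReal.zero_lt_top
  R_pos τ hτ := div_pos (Real.sinh_pos_iff.2 (mul_pos ha hτ.1)) ha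
  dR τ _ := hasDerivAt_sinh_mul_div ha.ne' τ
  dx τ _ := by
    have hl : lam k = 0 := by rw [lam, hk]; norm_num
    refine (hasDerivAt_cosh_mul ha.ne' τ).congr_deriv ?_
    rw [hl, zero_mul, Real.exp_zero, mul_one, hV]
  dl τ hτ := by
    have hc := Real.cosh_pos (a * τ / 2)
    have hs : 0 < Real.sinh (a * τ / 2) := Real.sinh_pos_iff.2 (half_pos (mul_pos ha hτ.1))
    refine (((((((hasDerivAt_id τ).const_mul a).div_const 2).cosh).log hc.ne').const_mul
      2).const_add l₀).congr_deriv ?_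
    rw [(cosh_mul_eq a τ).1, (cosh_mul_eq a τ).2]
    simp only [id]
    field_simp
  dy τ _ := by
    have hl : lam k = 0 := by rw [lam, hk]; norm_num
    refine ((hasDerivAt_cosh_mul ha.ne' τ).sub_const 1).congr_deriv ?_
    rw [hl, hk, zero_mul, Real.exp_zero, mul_one, hV]
    ring
  R_lim := tendsto_nhdsGT_zero (by fun_prop) (by simp)
  x_lim := tendsto_nhdsGT_zero (by fun_prop) (by simp)
  l_lim := tendsto_nhdsGT_zero (continuous_const.add (continuous_const.mul
    (Continuous.log (by fun_prop) fun τ => (Real.cosh_pos _).ne'))) (by simp)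
  y_lim := tendsto_nhdsGT_zero (by fun_prop) (by simp)

/-- At this value of the potential y' vanishes, so l stays at l₀ and R solves R'' = (2 - k²) / 8 ·
R. -/
theorem core_const {R x : ℝ → ℝ} (hk : k ≠ 0) (hV : V₀ * Real.exp (lam k * l₀) = k ^ 2 / 8)
    (hT : 0 < T) (hR : ∀ τ ∈ openDom T, 0 < R τ) (dR : ∀ τ, HasDerivAt R (x τ) τ)
    (dx : ∀ τ, HasDerivAt x ((2 - k ^ 2) / 8 * R τ) τ) (R0 : R 0 = 0) (x0 : x 0 = 1) :
    Core k V₀ l₀ T R x (fun _ => l₀) (fun _ => 0) where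
  pos := hT
  R_pos := hR
  dR τ _ := dR τ
  dx τ _ := (dx τ).congr_deriv (by rw [hV]; ring)
  dl τ _ := (hasDerivAt_const τ l₀).congr_deriv (by simp)
  dy τ _ := (hasDerivAt_const τ 0).congr_deriv (by
    rw [mul_assoc, hV]; field_simp; ring)
  R_lim := tendsto_nhdsGT_zero (continuous_iff_continuousAt.2 fun τ => (dR τ).continuousAt) R0
  x_lim := tendsto_nhdsGT_zero (continuous_iff_continuousAt.2 fun τ => (dx τ).continuousAt) x0
  l_lim := tendsto_const_nhds
  y_lim := tendsto_const_nhds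

/-- A maximal solution with the data of a solution on `[0, ∞)`. -/
theorem IsMaximalSolution.eq_top {R x l y : ℝ → ℝ} (h : IsMaximalSolution k V₀ l₀ φ₀ c₁ T s)
    (hk : k ≠ 0) (c : Core k V₀ l₀ ⊤ R x l y) :
    T = ⊤ ∧ ∀ τ, 0 < τ → s.R τ = R τ ∧ s.l τ = l τ ∧ deriv s.l τ = y τ / R τ := by
  have hT : T = ⊤ := top_le_iff.1 (h.isMaximalTime hk ⊤ R x l y c)
  subst hT
  refine ⟨rfl, fun τ hτ => ?_⟩
  have hm : τ ∈ openDom ⊤ := ⟨hτ, EReal.coe_lt_top τ⟩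
  obtain ⟨h1, -, h2, h3⟩ := h.1.core.eq c hk hm hm
  refine ⟨h1, h2, ?_⟩
  rw [← h3, ← h1, mul_div_cancel_left₀ _ (h.1.R_pos τ hm).ne']

theorem mem_openDom_top {τ : ℝ} (h : 0 < τ) : τ ∈ openDom ⊤ := ⟨h, EReal.coe_lt_top τ⟩

theorem exp_le_cosh_sq (x : ℝ) : Real.exp x / 4 ≤ Real.cosh (x / 2) ^ 2 := by
  have h1 : Real.exp (x / 2) / 2 ≤ Real.cosh (x / 2) := by
    rw [Real.cosh_eq]; linarith [Real.exp_pos (-(x / 2))]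
  have h2 : Real.exp x = Real.exp (x / 2) ^ 2 := by
    rw [← Real.exp_nat_mul]; congr 1; push_cast; ring
  rw [h2]
  nlinarith [Real.exp_pos (x / 2)]

theorem cosh_sq_le_exp {x : ℝ} (hx : 0 ≤ x) : Real.cosh (x / 2) ^ 2 ≤ Real.exp x := by
  have h1 : Real.cosh (x / 2) ≤ Real.exp (x / 2) := by
    rw [Real.cosh_eq]
    have : Real.exp (-(x / 2)) ≤ Real.exp (x / 2) := Real.exp_le_exp.2 (by linarith)
    linarith
  have h2 : Real.exp x = Real.exp (x / 2) ^ 2 := by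
    rw [← Real.exp_nat_mul]; congr 1; push_cast; ring
  rw [h2]
  exact pow_le_pow_left₀ (Real.cosh_pos _).le h1 2

theorem tendsto_exp_mul_atTop {a : ℝ} (ha : 0 < a) :
    Tendsto (fun τ => Real.exp (a * τ)) atTop atTop :=
  Real.tendsto_exp_atTop.comp (tendsto_id.const_mul_atTop ha)

theorem tendsto_exp_mul_nhds_zero {a : ℝ} (ha : a < 0) :
    Tendsto (fun τ => Real.exp (a * τ)) atTop (𝓝 0) :=
  Real.tendsto_exp_atBot.comp (tendsto_id.const_mul_atTop_of_neg ha)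

theorem exp_l_eq {a τ : ℝ} (l₀ : ℝ) : Real.exp (l₀ + 2 * Real.log (Real.cosh (a * τ / 2))) =
    Real.exp l₀ * Real.cosh (a * τ / 2) ^ 2 := by
  rw [Real.exp_add, mul_comm 2, Real.exp_mul, Real.exp_log (Real.cosh_pos _)]
  norm_cast

theorem l_rate_sq_eq {a τ : ℝ} (ha : 0 < a) (hτ : 0 < τ) :
    ((Real.cosh (a * τ) - 1) / (Real.sinh (a * τ) / a)) ^ 2 =
      a ^ 2 * (1 - 2 / (Real.cosh (a * τ) + 1)) := by
  have hs : 0 < Real.sinh (a * τ) := Real.sinh_pos_iff.2 (mul_pos ha hτ)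
  have hc := Real.cosh_pos (a * τ)
  have e := Real.cosh_sq (a * τ)
  have : Real.sinh (a * τ) ^ 2 ≠ 0 := by positivity
  rw [div_pow, div_pow]
  have e2 : Real.sinh (a * τ) ^ 2 = (Real.cosh (a * τ) - 1) * (Real.cosh (a * τ) + 1) := by
    linear_combination -e
  rw [e2] at this ⊢
  have h1 := left_ne_zero_of_mul this
  field_simp
  ring

/-- V₀ < 0 means a > 1/2 in the explicit solution. The affine rate is then of order e^((a - 1/2) τ),
while the bracket in the Ricci scalar stays bounded. -/
theorem IsMaximalSolution.case_two (h : IsMaximalSolution k V₀ l₀ φ₀ c₁ T s) (hk0 : k ≠ 0)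
    (hk : k ^ 2 = 2) (hV : V₀ < 0) :
    T = ⊤ ∧ IsRadialNullInfinity s T ∧ RicciScalarDecays s T := by
  set a := Real.sqrt (1 / 4 - V₀) with ha_def
  have ha2 : a ^ 2 = 1 / 4 - V₀ := Real.sq_sqrt (by linarith)
  have ha : 1 / 2 < a := Real.lt_sqrt_of_sq_lt (by linarith)
  have ha0 : 0 < a := by linarith
  obtain ⟨rfl, hs⟩ := h.eq_top hk0 (core_sinh_of_sq_eq_two hk ha0 ha2 l₀)
  have hexp : ∀ τ, 0 < τ → Real.exp (k ^ 2 / 2 * s.l τ - τ / 2) =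
      Real.exp l₀ * Real.cosh (a * τ / 2) ^ 2 * Real.exp (-(1 / 2) * τ) := fun τ hτ => by
    rw [hk, div_self two_ne_zero, one_mul, (hs τ hτ).2.1, sub_eq_add_neg, Real.exp_add, exp_l_eq]
    congr 2; ring
  have hlow : ∀ τ, 0 < τ → Real.exp l₀ / 4 * Real.exp ((a - 1 / 2) * τ) ≤
      Real.exp (k ^ 2 / 2 * s.l τ - τ / 2) := fun τ hτ => by
    rw [hexp τ hτ, show (a - 1 / 2) * τ = a * τ + -(1 / 2) * τ by ring, Real.exp_add]
    have := mul_le_mul_of_nonneg_left (exp_le_cosh_sq (a * τ)) (mul_pos (Real.exp_pos l₀)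
      (Real.exp_pos (-(1 / 2) * τ))).le
    linarith
  refine ⟨rfl, ?_, ?_⟩
  -- A positive constant lower bound for the rate already makes affine parameters grow at least
  -- linearly.
  · refine h.1.isRadialNullInfinity (τ₁ := 1) (G := fun t => Real.exp l₀ / 4 * t)
      (G' := fun _ => Real.exp l₀ / 4) (mem_openDom_top one_pos)
      (fun t _ _ => by simpa using (hasDerivAt_id t).const_mul (Real.exp l₀ / 4))
      (fun t ht _ => le_trans ?_ (hlow t ht.1)) ?_
    · refine le_mul_of_one_le_right (by positivity) (Real.one_le_exp ?_)
      exact mul_nonneg (by linarith) ht.1.le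
    · rw [endFilter_top]
      exact tendsto_id.const_mul_atTop (by positivity)
  · refine h.1.ricciScalarDecays hk0 ?_
    rw [endFilter_top]
    have h0 := (tendsto_exp_mul_nhds_zero (a := -(a - 1 / 2)) (by linarith)).mul_const
      (4 * Real.exp (-l₀)) |>.mul_const (2 * |V₀| + k ^ 2 / 4 * (a ^ 2 + 1 / 4))
    rw [zero_mul, zero_mul] at h0
    refine squeeze_zero_norm' ?_ h0
    filter_upwards [eventually_gt_atTop 0] with τ hτ
    rw [norm_mul, Real.norm_eq_abs, Real.norm_eq_abs, abs_of_pos (Real.exp_pos _)]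
    have hl : lam k = 0 := by rw [lam, hk]; norm_num
    refine mul_le_mul ?_ ?_ (abs_nonneg _) (by positivity)
    · rw [show τ / 2 - k ^ 2 / 2 * s.l τ = -(k ^ 2 / 2 * s.l τ - τ / 2) by ring, neg_mul, Real.exp_neg,
        Real.exp_neg, Real.exp_neg]
      have := hlow τ hτ
      have p1 := Real.exp_pos l₀
      have p2 := Real.exp_pos ((a - 1 / 2) * τ)
      have : (Real.exp (k ^ 2 / 2 * s.l τ - τ / 2))⁻¹ ≤
        (Real.exp l₀ / 4 * Real.exp ((a - 1 / 2) * τ))⁻¹ := inv_anti₀ (by positivity) this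
      refine this.trans (le_of_eq ?_)
      field_simp
    · rw [hl, zero_mul, Real.exp_zero, mul_one, (hs τ hτ).2.2, l_rate_sq_eq ha0 hτ]
      have hc := Real.one_le_cosh (a * τ)
      have h1 : 2 / (Real.cosh (a * τ) + 1) ≤ 1 := by rw [div_le_one (by linarith)]; linarith
      have h2 : 0 ≤ 2 / (Real.cosh (a * τ) + 1) := by positivity
      generalize 2 / (Real.cosh (a * τ) + 1) = q at *
      have h3 : a ^ 2 * q ≤ a ^ 2 * 1 := by gcongr
      have h4 : 0 ≤ a ^ 2 * q := by positivity
      refine (abs_add_le _ _).trans (add_le_add ?_ ?_)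
      · rw [abs_mul, abs_two]
      · rw [abs_mul, abs_of_nonneg (by positivity : 0 ≤ k ^ 2 / 4)]
        gcongr
        rw [abs_le]
        constructor <;> nlinarith

theorem tendsto_exp_neg_mul_sinh {a : ℝ} (ha : 0 < a) (ha2 : a < 1 / 2) :
    Tendsto (fun τ => Real.exp (-τ / 2) * (Real.sinh (a * τ) / a)) atTop (𝓝 0) := by
  have h0 := (tendsto_exp_mul_nhds_zero (a := a - 1 / 2) (by linarith)).mul_const (1 / a)
  rw [zero_mul] at h0
  refine squeeze_zero' ?_ ?_ h0
  · filter_upwards [eventually_gt_atTop 0] with τ hτ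
    have := Real.sinh_pos_iff.2 (mul_pos ha hτ)
    positivity
  · filter_upwards [eventually_gt_atTop 0] with τ hτ
    have e : Real.sinh (a * τ) ≤ Real.exp (a * τ) := by
      rw [Real.sinh_eq]; linarith [Real.exp_pos (a * τ), Real.exp_pos (-(a * τ))]
    rw [show (a - 1 / 2) * τ = -τ / 2 + a * τ by ring, Real.exp_add, mul_assoc]
    gcongr
    rw [div_eq_mul_one_div]
    gcongr

/-- With l constant, the rate is a multiple of e^(-τ / 2), and R grows like e^(a τ) with a < 1/2, or
linearly. The bracket in the Ricci scalar is the constant 3 k² / 16 > 0. -/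
theorem IsMaximalSolution.case_five_const (h : IsMaximalSolution k V₀ l₀ φ₀ c₁ T s) (hk0 : k ≠ 0)
    (hk : k ^ 2 ≤ 2) (hV : V₀ * Real.exp (lam k * l₀) = k ^ 2 / 8) :
    T = ⊤ ∧ RadiusVanishes s T ∧ HasCurvatureSingularity s T ∧ ReachedInFiniteAffineTime s T := by
  have hk2 : 0 < k ^ 2 := by positivity
  obtain ⟨R, x, c, hR⟩ : ∃ R x, Core k V₀ l₀ ⊤ R x (fun _ => l₀) (fun _ => 0) ∧
      Tendsto (fun τ => Real.exp (-τ / 2) * R τ) atTop (𝓝 0) := by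
    rcases hk.lt_or_eq with hk | hk
    · set a := Real.sqrt ((2 - k ^ 2) / 8)
      have ha : 0 < a := Real.sqrt_pos.2 (by linarith)
      have ha2 : a ^ 2 = (2 - k ^ 2) / 8 := Real.sq_sqrt (by linarith)
      refine ⟨fun τ => Real.sinh (a * τ) / a, fun τ => Real.cosh (a * τ), core_const hk0 hV EReal.zero_lt_top
        (fun τ hτ => div_pos (Real.sinh_pos_iff.2 (mul_pos ha hτ.1)) ha)
        (hasDerivAt_sinh_mul_div ha.ne') (fun τ => by rw [← ha2]; exact hasDerivAt_cosh_mul ha.ne' τ)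
        (by simp) (by simp), tendsto_exp_neg_mul_sinh ha (by nlinarith)⟩
    -- The degenerate value a = 0, where sinh(a τ) / a becomes τ.
    · refine ⟨fun τ => τ, fun _ => 1, core_const hk0 hV EReal.zero_lt_top (fun τ hτ => hτ.1)
        hasDerivAt_id
        (fun τ => (hasDerivAt_const τ 1).congr_deriv (by rw [hk]; ring)) rfl rfl, ?_⟩
      have := ((Real.tendsto_pow_mul_exp_neg_atTop_nhds_zero 1).comp
        (tendsto_id.atTop_div_const (two_pos (α := ℝ)))).const_mul 2
      rw [mul_zero] at this
      refine this.congr fun τ => ?_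
      simp only [Function.comp, id, pow_one]
      rw [neg_div]; ring
  obtain ⟨rfl, hs⟩ := h.eq_top hk0 c
  refine ⟨rfl, ?_, ?_, ?_⟩
  · refine IsSolution.radiusVanishes ?_
    rw [endFilter_top]
    refine hR.congr' ?_
    filter_upwards [eventually_gt_atTop 0] with τ hτ
    rw [(hs τ hτ).1]
  · refine h.1.hasCurvatureSingularity hk0 ?_
    rw [endFilter_top]
    have h0 := (tendsto_exp_mul_atTop (one_half_pos (α := ℝ))).atTop_mul_const
      (show 0 < Real.exp (-(k ^ 2 / 2 * l₀)) * (3 * k ^ 2 / 16) by positivity)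
    refine h0.congr' ?_
    filter_upwards [eventually_gt_atTop 0] with τ hτ
    rw [(hs τ hτ).2.1, (hs τ hτ).2.2, hV, zero_div, sub_eq_add_neg (τ / 2), Real.exp_add,
      show 1 / 2 * τ = τ / 2 by ring]
    ring
  · refine h.1.reachedInFiniteAffineTime (τ₁ := 1) (B := 0)
      (G := fun t => Real.exp (k ^ 2 / 2 * l₀) * (-2 * Real.exp (-(1 / 2) * t)))
      (G' := fun t => Real.exp (k ^ 2 / 2 * l₀) * Real.exp (-(1 / 2) * t)) (mem_openDom_top one_pos)
      (fun t _ _ => ?_) (fun t ht _ => ?_) (fun t _ _ => ?_)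
    · exact (((((hasDerivAt_id t).const_mul (-(1 / 2))).exp.const_mul (-2)).const_mul
        _).congr_deriv (by simp only [id]; ring))
    · rw [(hs t ht.1).2.1, sub_eq_add_neg, Real.exp_add, show -(1 / 2) * t = -(t / 2) by ring]
    · have := mul_pos (Real.exp_pos (k ^ 2 / 2 * l₀)) (Real.exp_pos (-(1 / 2) * t))
      linarith

/-- Here 0 < a < 1/2, so R e^(-τ / 2) and the affine rate decay exponentially. As l'² → a² = 1/4 -
V₀, the bracket in the Ricci scalar tends to 3 V₀ / 2 > 0. -/
theorem IsMaximalSolution.case_five_sq_eq_two (h : IsMaximalSolution k V₀ l₀ φ₀ c₁ T s)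
    (hk0 : k ≠ 0) (hk : k ^ 2 = 2) (hV : 0 < V₀) (hV' : V₀ < 1 / 4) :
    T = ⊤ ∧ RadiusVanishes s T ∧ HasCurvatureSingularity s T ∧ ReachedInFiniteAffineTime s T := by
  set a := Real.sqrt (1 / 4 - V₀) with ha_def
  have ha2 : a ^ 2 = 1 / 4 - V₀ := Real.sq_sqrt (by linarith)
  have ha0 : 0 < a := Real.sqrt_pos.2 (by linarith)
  have ha : a < 1 / 2 := by nlinarith
  obtain ⟨rfl, hs⟩ := h.eq_top hk0 (core_sinh_of_sq_eq_two hk ha0 ha2 l₀)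
  have hup : ∀ τ, 0 < τ → Real.exp (k ^ 2 / 2 * s.l τ - τ / 2) ≤
      Real.exp l₀ * Real.exp (-(1 / 2 - a) * τ) := fun τ hτ => by
    rw [hk, div_self two_ne_zero, one_mul, (hs τ hτ).2.1, sub_eq_add_neg, Real.exp_add, exp_l_eq,
      show -(1 / 2 - a) * τ = a * τ + -(τ / 2) by ring, Real.exp_add, mul_assoc]
    have := cosh_sq_le_exp (mul_pos ha0 hτ).le
    gcongr
  have hl : lam k = 0 := by rw [lam, hk]; norm_num
  refine ⟨rfl, ?_, ?_, ?_⟩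
  · refine IsSolution.radiusVanishes ?_
    rw [endFilter_top]
    refine (tendsto_exp_neg_mul_sinh ha0 ha).congr' ?_
    filter_upwards [eventually_gt_atTop 0] with τ hτ
    rw [(hs τ hτ).1]
  · refine h.1.hasCurvatureSingularity hk0 ?_
    rw [endFilter_top]
    refine Tendsto.atTop_mul_pos (C := 3 / 2 * V₀) (by positivity) ?_ ?_
    · refine tendsto_atTop_mono' _ ?_ ((tendsto_exp_mul_atTop (a := 1 / 2 - a)
        (by linarith)).const_mul_atTop (Real.exp_pos (-l₀)))
      filter_upwards [eventually_gt_atTop 0] with τ hτ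
      have := inv_anti₀ (Real.exp_pos _) (hup τ hτ)
      rw [mul_inv, ← Real.exp_neg, ← Real.exp_neg, ← Real.exp_neg] at this
      refine le_trans (le_of_eq ?_) (this.trans (le_of_eq ?_))
      · ring_nf
      · ring_nf
    · have hq : Tendsto (fun τ => 2 / (Real.cosh (a * τ) + 1)) atTop (𝓝 0) := by
        refine tendsto_const_nhds.div_atTop (tendsto_atTop_add_const_right _ _ ?_)
        refine tendsto_atTop_mono (fun τ => ?_)
          ((tendsto_exp_mul_atTop ha0).atTop_div_const (two_pos (α := ℝ)))
        rw [Real.cosh_eq]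
        linarith [Real.exp_pos (-(a * τ))]
      have h1 := ((((hq.const_sub 1).const_mul (a ^ 2)).sub_const (1 / 4)).const_mul
        (k ^ 2 / 4)).const_add (2 * V₀)
      rw [hk, sub_zero, mul_one, ha2, show 2 * V₀ + 2 / 4 * (1 / 4 - V₀ - 1 / 4) = 3 / 2 * V₀ by ring]
        at h1
      refine h1.congr' ?_
      filter_upwards [eventually_gt_atTop 0] with τ hτ
      rw [hl, zero_mul, Real.exp_zero, mul_one, (hs τ hτ).2.2, l_rate_sq_eq ha0 hτ, hk, ha2]
  · have hε : 0 < 1 / 2 - a := by linarith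
    refine h.1.reachedInFiniteAffineTime (τ₁ := 1) (B := 0)
      (G := fun t => -(Real.exp l₀ / (1 / 2 - a) * Real.exp (-(1 / 2 - a) * t)))
      (G' := fun t => Real.exp l₀ * Real.exp (-(1 / 2 - a) * t)) (mem_openDom_top one_pos)
      (fun t _ _ => ?_) (fun t ht _ => hup t ht.1) (fun t _ _ => ?_)
    · refine (((((hasDerivAt_id t).const_mul (-(1 / 2 - a))).exp.const_mul
        (Real.exp l₀ / (1 / 2 - a)))).neg).congr_deriv ?_
      simp only [id]
      generalize (1 / 2 - a) = ε at *
      field_simp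
    · have := Real.exp_pos l₀
      have := Real.exp_pos (-(1 / 2 - a) * t)
      rw [neg_nonpos]
      positivity

end SelfSimilarCylinder


namespace SelfSimilarCylinder

/-! ### k² > 2 and V₀ < 0: blow-up of the radius function -/

variable {k V₀ l₀ φ₀ c₁ : ℝ} {T : EReal} {s : Fields} {R x l y : ℝ → ℝ}

namespace Core

theorem Z_lim (c : Core k V₀ l₀ T R x l y) :
    Tendsto (fun t => x t - k ^ 2 / 2 * y t) (𝓝[>] 0) (𝓝 1) := by
  simpa using c.x_lim.sub (c.y_lim.const_mul (k ^ 2 / 2))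

theorem id_lim : Tendsto (fun t : ℝ => t) (𝓝[>] 0) (𝓝 0) :=
  (tendsto_id (α := ℝ)).mono_left nhdsWithin_le_nhds

theorem one_lt_x (c : Core k V₀ l₀ T R x l y) (hV : V₀ < 0) {τ : ℝ} (hτ : τ ∈ openDom T) :
    1 < x τ :=
  lt_of_hasDerivAt_pos c.dx (fun t ht => mul_pos (by
    linarith [mul_neg_of_neg_of_pos hV (Real.exp_pos (lam k * l t))]) (c.R_pos t ht)) c.x_lim hτ

theorem le_R (c : Core k V₀ l₀ T R x l y) (hx : ∀ τ ∈ openDom T, 1 ≤ x τ) {τ : ℝ}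
    (hτ : τ ∈ openDom T) : τ ≤ R τ := by
  have := le_of_hasDerivAt_nonneg (fun t ht => (c.dR t ht).sub (hasDerivAt_id t))
    (fun t ht => sub_nonneg.2 (hx t ht)) (c.R_lim.sub id_lim) hτ
  have h : 0 - 0 ≤ R τ - τ := this
  linarith

theorem strictMonoOn_R (c : Core k V₀ l₀ T R x l y) (hx : ∀ τ ∈ openDom T, 1 ≤ x τ) :
    StrictMonoOn R (openDom T) :=
  strictMonoOn_of_hasDerivAt (ordConnected_openDom T) c.dR fun t ht => one_pos.trans_le (hx t ht)

/-- The upper bound uses Z' = -(λ/4) R and R ≥ τ; the lower one uses (τ R)' ≥ R. -/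
theorem Z_bounds (c : Core k V₀ l₀ T R x l y) (hk : k ≠ 0) (hl : 0 ≤ lam k)
    (hx : ∀ τ ∈ openDom T, 1 ≤ x τ) {τ : ℝ} (hτ : τ ∈ openDom T) :
    x τ - k ^ 2 / 2 * y τ ≤ 1 - lam k / 8 * τ ^ 2 ∧
      1 - lam k / 4 * (τ * R τ) ≤ x τ - k ^ 2 / 2 * y τ := by
  constructor
  · have := ge_of_hasDerivAt_nonpos (fun t ht => (c.dZ hk ht).add
      ((hasDerivAt_sq (hasDerivAt_id t)).const_mul (lam k / 8)))
      (fun t ht => ?_) (c.Z_lim.add ((id_lim.pow 2).const_mul _)) hτ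
    · have h : x τ - k ^ 2 / 2 * y τ + lam k / 8 * τ ^ 2 ≤ 1 + lam k / 8 * 0 ^ 2 := this
      linarith
    · have h := mul_le_mul_of_nonneg_left (c.le_R hx ht) hl
      simp only [id]
      linarith
  · have := le_of_hasDerivAt_nonneg (fun t ht => (c.dZ hk ht).add
      (((hasDerivAt_id t).mul (c.dR t ht)).const_mul (lam k / 4)))
      (fun t ht => ?_) (c.Z_lim.add ((id_lim.mul c.R_lim).const_mul _)) hτ
    · have h : 1 + lam k / 4 * (0 * 0) ≤ x τ - k ^ 2 / 2 * y τ + lam k / 4 * (τ * R τ) := this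
      linarith
    · have h1 := mul_nonneg hl (mul_nonneg ht.1.le (zero_le_one.trans (hx t ht)))
      simp only [id]
      linarith

/-- The classical blow-up argument: multiplying R'' ≥ δ R^(1 + σ) by R' bounds R'² below by a
multiple of R^(2 + σ). Thus R^(-σ/2) decreases at least linearly, yet must stay positive. -/
theorem false_of_superlinear (c : Core k V₀ l₀ ⊤ R x l y) {τ₁ δ σ : ℝ} (h1 : 0 < τ₁) (hδ : 0 < δ)
    (hσ : 0 < σ) (hσ' : σ ≤ 2) (hx : ∀ τ, τ₁ ≤ τ → 0 < x τ)
    (h : ∀ τ, τ₁ ≤ τ → δ * R τ ^ (1 + σ) ≤ (1 / 4 - V₀ * Real.exp (lam k * l τ)) * R τ) : False := by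
  have mem : ∀ τ ∈ Set.Ici τ₁, τ ∈ openDom ⊤ := fun τ hτ => mem_openDom_top (h1.trans_le hτ)
  have Rp : ∀ τ ∈ Set.Ici τ₁, 0 < R τ := fun τ hτ => c.R_pos τ (mem τ hτ)
  have h11 : τ₁ ∈ Set.Ici τ₁ := Set.self_mem_Ici
  -- The first entry makes R'² - ε R^(2 + σ) nondecreasing, as ε (2 + σ) ≤ 2 δ; the second makes it
  -- nonnegative at τ₁.
  set ε := min (δ / 2) (x τ₁ ^ 2 / R τ₁ ^ (2 + σ)) with hε
  have pR : ∀ τ ∈ Set.Ici τ₁, ∀ p : ℝ, 0 < R τ ^ p := fun τ hτ p => Real.rpow_pos_of_pos (Rp τ hτ) p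
  have hε0 : 0 < ε := lt_min (half_pos hδ) (div_pos (pow_pos (hx τ₁ le_rfl) 2) (pR _ h11 _))
  have m1 := monotoneOn_of_hasDerivAt Set.ordConnected_Ici
    (fun τ hτ => (hasDerivAt_sq (c.dx τ (mem τ hτ))).sub
      (((c.dR τ (mem τ hτ)).rpow_const (p := 2 + σ) (Or.inl (Rp τ hτ).ne')).const_mul ε))
    (fun τ hτ => by
      have e1 := h τ hτ
      have e2 := hx τ hτ
      have e3 := pR τ hτ (1 + σ)
      have e4 : ε ≤ δ / 2 := min_le_left _ _
      rw [show 2 + σ - 1 = 1 + σ by ring]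
      have e5 : ε * (2 + σ) ≤ δ / 2 * 4 := by gcongr; linarith
      have e6 := mul_le_mul_of_nonneg_right e5 e3.le
      have e7 := mul_nonneg e2.le (show (0 : ℝ) ≤ 2 * ((1 / 4 - V₀ * Real.exp (lam k * l τ)) * R τ) -
        ε * (2 + σ) * R τ ^ (1 + σ) by linarith)
      linarith)
  have hlow : ∀ τ ∈ Set.Ici τ₁, ε * R τ ^ (2 + σ) ≤ x τ ^ 2 := by
    intro τ hτ
    have e1 : x τ₁ ^ 2 - ε * R τ₁ ^ (2 + σ) ≤ x τ ^ 2 - ε * R τ ^ (2 + σ) := m1 h11 hτ hτ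
    have e2 : ε * R τ₁ ^ (2 + σ) ≤ x τ₁ ^ 2 := by
      rw [← le_div_iff₀ (pR _ h11 _)]
      exact min_le_right _ _
    linarith
  have hlow' : ∀ τ ∈ Set.Ici τ₁, Real.sqrt ε ≤ x τ * R τ ^ (-(σ / 2) - 1) := by
    intro τ hτ
    rw [Real.sqrt_le_left (mul_pos (hx τ hτ) (pR τ hτ _)).le, mul_pow, ← Real.rpow_mul_natCast
      (Rp τ hτ).le, show (-(σ / 2) - 1) * ((2 : ℕ) : ℝ) = -(2 + σ) by push_cast; ring,
      Real.rpow_neg (Rp τ hτ).le, ← div_eq_mul_inv, le_div_iff₀ (pR τ hτ _)]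
    exact hlow τ hτ
  have hs := Real.sqrt_pos.2 hε0
  have m2 := antitoneOn_of_hasDerivAt Set.ordConnected_Ici
    (fun τ hτ => ((c.dR τ (mem τ hτ)).rpow_const (p := -(σ / 2)) (Or.inl (Rp τ hτ).ne')).add
      ((hasDerivAt_id τ).const_mul (σ / 2 * Real.sqrt ε)))
    (fun τ hτ => by
      have := mul_le_mul_of_nonneg_left (hlow' τ hτ) (half_pos hσ).le
      linarith)
  have hpos : 0 < σ / 2 * Real.sqrt ε := by positivity
  set τ₂ := τ₁ + R τ₁ ^ (-(σ / 2)) / (σ / 2 * Real.sqrt ε) with hτ₂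
  have h12 : τ₁ ≤ τ₂ := le_add_of_nonneg_right (div_pos (pR _ h11 _) hpos).le
  have e : R τ₂ ^ (-(σ / 2)) + σ / 2 * Real.sqrt ε * τ₂ ≤
    R τ₁ ^ (-(σ / 2)) + σ / 2 * Real.sqrt ε * τ₁ := m2 h11 h12 h12
  have e' := pR τ₂ h12 (-(σ / 2))
  have e'' : σ / 2 * Real.sqrt ε * τ₂ = σ / 2 * Real.sqrt ε * τ₁ + R τ₁ ^ (-(σ / 2)) := by
    rw [hτ₂, mul_add, mul_div_cancel₀ _ hpos.ne']
  linarith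

/-- `e ^ (λ l)` as a power of `e ^ (k² l / 2)`. -/
theorem exp_lam_mul (hk : k ≠ 0) (r : ℝ) {R : ℝ} (hR : 0 < R) (C : ℝ) :
    Real.exp (lam k * r) = Real.exp ((1 - 2 / k ^ 2) * (k ^ 2 / 2 * r)) ∧
    Real.exp ((1 - 2 / k ^ 2) * (Real.log R + C)) =
      Real.exp ((1 - 2 / k ^ 2) * C) * R ^ (1 - 2 / k ^ 2) := by
  constructor
  · congr 1
    rw [lam]
    field_simp
  · rw [Real.rpow_def_of_pos hR, ← Real.exp_add]
    congr 1
    ring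

/-- Once Z ≤ 0, the function k² l / 2 - log R increases, so e^(λ l) is at least a multiple of R^(1 -
2/k²). The equation for R is then superlinear. -/
theorem lt_top_of_neg (c : Core k V₀ l₀ T R x l y) (hk : 2 < k ^ 2) (hV : V₀ < 0) : T < ⊤ := by
  rw [lt_top_iff_ne_top]
  rintro rfl
  have hk0 : k ≠ 0 := by rintro rfl; norm_num at hk
  have hl : 0 < lam k := by rw [lam]; linarith
  have hx := fun τ hτ => (c.one_lt_x hV (τ := τ) hτ).le
  -- From here on λ τ² / 8 ≥ 1, so `Z_bounds` gives Z ≤ 0.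
  set τ₁ := 1 + 8 / lam k with hτ₁
  have h1 : 0 < τ₁ := by positivity
  have hσ : 2 / k ^ 2 < 1 := (div_lt_one (by linarith)).2 hk
  have hσ0 : 0 < 2 / k ^ 2 := by positivity
  have mem : ∀ τ ∈ Set.Ici τ₁, τ ∈ openDom ⊤ := fun τ hτ => mem_openDom_top (h1.trans_le hτ)
  have m := monotoneOn_of_hasDerivAt Set.ordConnected_Ici (fun τ hτ => c.d_log (mem τ hτ))
    (fun τ hτ => by
      have hz := (c.Z_bounds hk0 hl.le hx (mem τ hτ)).1
      have e1 : 1 ≤ τ := le_trans (by rw [hτ₁]; linarith [div_pos (show (0:ℝ) < 8 by norm_num) hl]) hτ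
      have e2 : 8 / lam k ≤ τ := le_trans (by rw [hτ₁]; linarith) hτ
      have e3 : 1 ≤ lam k / 8 * τ ^ 2 := by
        rw [div_le_iff₀ hl] at e2
        nlinarith
      rw [← neg_div]
      exact div_nonneg (by linarith) (c.R_pos τ (mem τ hτ)).le)
  set C := k ^ 2 / 2 * l τ₁ - Real.log (R τ₁)
  refine c.false_of_superlinear h1 (δ := -V₀ * Real.exp ((1 - 2 / k ^ 2) * C)) (σ := 1 - 2 / k ^ 2)
    (mul_pos (neg_pos.2 hV) (Real.exp_pos _)) (by linarith) (by linarith)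
    (fun τ hτ => one_pos.trans_le (hx τ (mem τ hτ))) fun τ hτ => ?_
  have hR := c.R_pos τ (mem τ hτ)
  have e : C ≤ k ^ 2 / 2 * l τ - Real.log (R τ) := m Set.self_mem_Ici hτ hτ
  have e1 : Real.exp ((1 - 2 / k ^ 2) * C) * R τ ^ (1 - 2 / k ^ 2) ≤ Real.exp (lam k * l τ) := by
    rw [(exp_lam_mul hk0 (l τ) hR C).1, ← (exp_lam_mul hk0 (l τ) hR C).2]
    exact Real.exp_le_exp.2 (mul_le_mul_of_nonneg_left (by linarith) (by linarith))
  have e2 := mul_le_mul_of_nonneg_left e1 (neg_pos.2 hV).le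
  have e3 := mul_le_mul_of_nonneg_right e2 hR.le
  rw [Real.rpow_add hR, Real.rpow_one]
  linarith

/-- R is increasing, and if it were bounded the solution could be continued. -/
theorem tendsto_R_atTop (c : Core k V₀ l₀ T R x l y) (hk : k ≠ 0) (hmax : IsMaximalTime k V₀ l₀ T)
    {t : ℝ} (hT : T = t) (hx : ∀ τ ∈ openDom T, 1 ≤ x τ) : Tendsto R (endFilter T) atTop := by
  have hmono := (c.strictMonoOn_R hx).monotoneOn
  refine tendsto_atTop.2 fun b => ?_
  by_cases hb : ∃ τ ∈ openDom T, b ≤ R τ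
  · obtain ⟨τ, hτ, h⟩ := hb
    filter_upwards [eventually_endFilter hτ] with s hs
    exact h.trans (hmono hτ hs.1 hs.2.le)
  · push Not at hb
    obtain ⟨τ₁, h1⟩ := exists_mem_openDom c.pos
    refine (c.not_bounded hk hmax hT h1 (c.R_pos _ h1) (b := b) fun τ hτ => ?_).elim
    have hm : τ ∈ openDom T := ⟨h1.1.trans_le hτ.1, by rw [hT]; exact_mod_cast hτ.2⟩
    exact ⟨hmono h1 hm hτ.1, (hb τ hm).le⟩

/-- Bounds in terms of powers of `R` near the end, if `k² > 2` and `V₀ < 0`. -/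
theorem exists_power_bounds (c : Core k V₀ l₀ T R x l y) (hk : 2 < k ^ 2) (hV : V₀ < 0)
    (hmax : IsMaximalTime k V₀ l₀ T) : Tendsto R (endFilter T) atTop ∧ ∃ τ₁ ∈ openDom T, ∃ t : ℝ,
      ∃ B, T = t ∧ 0 < B ∧ ∀ τ ∈ openDom T, τ₁ ≤ τ → 1 ≤ R τ ∧ R τ ≤ B * Real.exp (k ^ 2 / 2 * l τ) ∧
        |V₀ * Real.exp (lam k * l τ)| ≤ B * R τ ^ (1 - 2 / k ^ 2) ∧
        x τ ^ 2 ≤ B * R τ ^ (3 - 2 / k ^ 2) ∧ (y τ / R τ) ^ 2 ≤ B * R τ ^ (1 - 2 / k ^ 2) := by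
  obtain rfl | ⟨t, ht, rfl⟩ := eq_top_or_eq_coe c.pos
  · exact absurd rfl (c.lt_top_of_neg hk hV).ne
  have hk0 : k ≠ 0 := by rintro rfl; norm_num at hk
  have hl : 0 < lam k := by rw [lam]; linarith
  have hx := fun τ hτ => (c.one_lt_x hV (τ := τ) hτ).le
  have hlim := c.tendsto_R_atTop hk0 hmax rfl hx
  obtain ⟨τ₁, h1, hR1⟩ := exists_of_eventually c.pos (hlim.eventually_ge_atTop 1)
  have h1t : τ₁ < t := by exact_mod_cast h1.2
  have mem : ∀ τ ∈ Set.Ico τ₁ t, τ ∈ openDom (t : EReal) := fun τ hτ =>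
    ⟨h1.1.trans_le hτ.1, by exact_mod_cast hτ.2⟩
  have mem' : ∀ τ ∈ openDom (t : EReal), τ₁ ≤ τ → τ ∈ Set.Ico τ₁ t := fun τ hτ h =>
    ⟨h, by exact_mod_cast hτ.2⟩
  -- On the finite interval Z / R is bounded, which makes e^(k² l / 2) and R comparable.
  have hZ : ∀ τ ∈ Set.Ico τ₁ t, |(x τ - k ^ 2 / 2 * y τ) / R τ| ≤ 1 + lam k / 4 * t := by
    intro τ hτ
    have hr := hR1 τ (mem τ hτ) hτ.1
    have hr0 := c.R_pos τ (mem τ hτ)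
    obtain ⟨e1, e2⟩ := c.Z_bounds hk0 hl.le hx (mem τ hτ)
    have e3 : lam k / 4 * (τ * R τ) ≤ lam k / 4 * (t * R τ) := by
      have := hτ.2.le
      gcongr
    have e4 : 0 ≤ lam k / 8 * τ ^ 2 := by positivity
    have e5 : 0 ≤ lam k / 4 * (t * R τ) := by positivity
    rw [abs_div, abs_of_pos hr0, div_le_iff₀ hr0, abs_le]
    constructor <;> linarith
  obtain ⟨C, hC⟩ := exists_abs_le_of_hasDerivAt (fun τ hτ => c.d_log (mem τ hτ))
    (fun τ hτ => by rw [abs_neg]; exact hZ τ hτ)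
  have hσ : 2 / k ^ 2 < 1 := (div_lt_one (by linarith)).2 hk
  have hσ0 : 0 < 2 / k ^ 2 := by positivity
  set σ := 1 - 2 / k ^ 2 with hσ_def
  set D := |V₀| * Real.exp (σ * C) with hD
  have hD0 : 0 < D := mul_pos (abs_pos.2 hV.ne) (Real.exp_pos _)
  have hW : ∀ τ ∈ Set.Ico τ₁ t, |V₀ * Real.exp (lam k * l τ)| ≤ D * R τ ^ σ := by
    intro τ hτ
    have hr0 := c.R_pos τ (mem τ hτ)
    have e := (abs_le.1 (hC τ hτ)).2
    rw [abs_mul, abs_of_pos (Real.exp_pos _), hD, mul_assoc]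
    refine mul_le_mul_of_nonneg_left ?_ (abs_nonneg _)
    rw [(exp_lam_mul hk0 (l τ) hr0 C).1, ← hσ_def, ← (exp_lam_mul hk0 (l τ) hr0 C).2]
    exact Real.exp_le_exp.2 (mul_le_mul_of_nonneg_left (by linarith) (by linarith))
  have h11 : τ₁ ∈ Set.Ico τ₁ t := ⟨le_rfl, h1t⟩
  have one_le : ∀ τ ∈ Set.Ico τ₁ t, ∀ p : ℝ, 0 ≤ p → 1 ≤ R τ ^ p := fun τ hτ p hp =>
    Real.one_le_rpow (hR1 τ (mem τ hτ) hτ.1) hp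
  -- The part 1 + D dominates 1/4 - W in units of R^σ, and the part x(τ₁)² secures the inequality at
  -- τ₁, where R ≥ 1.
  set E := x τ₁ ^ 2 + (1 + D) with hE
  have hE0 : 0 < E := by positivity
  have m := antitoneOn_of_hasDerivAt (f := fun τ => x τ ^ 2 - E * R τ ^ (2 + σ)) Set.ordConnected_Ico
    (fun τ hτ => (hasDerivAt_sq (c.dx τ (mem τ hτ))).sub
      (((c.dR τ (mem τ hτ)).rpow_const (p := 2 + σ)
        (Or.inl (c.R_pos τ (mem τ hτ)).ne')).const_mul E))
    (fun τ hτ => by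
      have hr0 := c.R_pos τ (mem τ hτ)
      have e1 := (abs_le.1 (hW τ hτ)).1
      have e2 := one_le τ hτ σ (by linarith)
      have e3 := one_pos.trans_le (hx τ (mem τ hτ))
      rw [show 2 + σ - 1 = σ + 1 by ring, Real.rpow_add hr0, Real.rpow_one]
      have e4 : 1 + D ≤ E := le_add_of_nonneg_left (sq_nonneg _)
      have e5 : 1 / 4 - V₀ * Real.exp (lam k * l τ) ≤ E * R τ ^ σ := by
        have := mul_le_mul_of_nonneg_right e4 (zero_le_one.trans e2)
        linarith
      have e6 : 0 ≤ E * R τ ^ σ := by positivity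
      have e7 : 2 * (1 / 4 - V₀ * Real.exp (lam k * l τ)) ≤ (2 + σ) * (E * R τ ^ σ) := by
        nlinarith
      have e8 := mul_le_mul_of_nonneg_left e7 (mul_pos e3 hr0).le
      linarith)
  have hx2 : ∀ τ ∈ Set.Ico τ₁ t, x τ ^ 2 ≤ E * R τ ^ (2 + σ) := by
    intro τ hτ
    have e : x τ ^ 2 - E * R τ ^ (2 + σ) ≤ x τ₁ ^ 2 - E * R τ₁ ^ (2 + σ) := m h11 hτ hτ.1
    have e1 := one_le τ₁ h11 (2 + σ) (by linarith)
    have e2 : E * 1 ≤ E * R τ₁ ^ (2 + σ) := by gcongr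
    linarith
  set F := 8 * (E + (1 + lam k / 4 * t) ^ 2) with hF
  have hY : ∀ τ ∈ Set.Ico τ₁ t, (y τ / R τ) ^ 2 ≤ F * R τ ^ σ := by
    intro τ hτ
    have hr0 := c.R_pos τ (mem τ hτ)
    have e1 : (x τ / R τ) ^ 2 ≤ E * R τ ^ σ := by
      rw [div_pow, div_le_iff₀ (by positivity), mul_assoc]
      have := hx2 τ hτ
      rwa [add_comm, Real.rpow_add hr0, show R τ ^ (2 : ℝ) = R τ ^ 2 by norm_cast] at this
    have e2 : ((x τ - k ^ 2 / 2 * y τ) / R τ) ^ 2 ≤ (1 + lam k / 4 * t) ^ 2 :=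
      sq_le_sq.2 ((hZ τ hτ).trans (le_abs_self _))
    have e3 := one_le τ hτ σ (by linarith)
    have e4 : y τ / R τ = 2 / k ^ 2 * (x τ / R τ - (x τ - k ^ 2 / 2 * y τ) / R τ) := by
      field_simp; ring
    rw [e4, mul_pow]
    generalize x τ / R τ = X at *
    generalize (x τ - k ^ 2 / 2 * y τ) / R τ = Z at *
    have e5 : (2 / k ^ 2) ^ 2 ≤ 1 := by nlinarith
    have e6 : (X - Z) ^ 2 ≤ 2 * X ^ 2 + 2 * Z ^ 2 := by nlinarith [sq_nonneg (X + Z)]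
    have e7 : (2 / k ^ 2) ^ 2 * (X - Z) ^ 2 ≤ 1 * (X - Z) ^ 2 := by gcongr
    have e8 : (1 + lam k / 4 * t) ^ 2 * 1 ≤ (1 + lam k / 4 * t) ^ 2 * R τ ^ σ := by gcongr
    have e9 : 0 ≤ E * R τ ^ σ := by positivity
    have e10 := sq_nonneg (1 + lam k / 4 * t)
    rw [hF]
    linarith
  have hF0 : 0 < F := by positivity
  refine ⟨hlim, τ₁, h1, t, D + E + F + Real.exp C, rfl, by positivity, fun τ hτ h => ?_⟩
  have hm := mem' τ hτ h
  have hr0 := c.R_pos τ hτ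
  have q1 : 0 < R τ ^ σ := Real.rpow_pos_of_pos hr0 _
  have q2 : 0 < R τ ^ (2 + σ) := Real.rpow_pos_of_pos hr0 _
  have q3 := Real.exp_pos C
  refine ⟨hR1 τ hτ h, ?_, (hW τ hm).trans ?_, ?_, (hY τ hm).trans ?_⟩
  · have e : R τ ≤ Real.exp C * Real.exp (k ^ 2 / 2 * l τ) := by
      rw [← Real.exp_add, ← Real.log_le_iff_le_exp hr0]
      linarith [(abs_le.1 (hC τ hm)).1]
    refine e.trans (mul_le_mul_of_nonneg_right ?_ (Real.exp_pos _).le)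
    linarith
  · exact mul_le_mul_of_nonneg_right (by linarith) q1.le
  · rw [show 3 - 2 / k ^ 2 = 2 + σ by rw [hσ_def]; ring]
    refine (hx2 τ hm).trans (mul_le_mul_of_nonneg_right ?_ q2.le)
    linarith
  · exact mul_le_mul_of_nonneg_right (by linarith) q1.le

end Core

/-- The affine rate is at least a multiple of R. By the power bounds the Ricci scalar is at most a
multiple of R⁻¹ R^(1 - 2/k²) = R^(-2/k²). -/
theorem IsMaximalSolution.case_one (h : IsMaximalSolution k V₀ l₀ φ₀ c₁ T s) (hk : 2 < k ^ 2)
    (hV : V₀ < 0) : T < ⊤ ∧ IsRadialNullInfinity s T ∧ RicciScalarDecays s T := by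
  have hk0 : k ≠ 0 := by rintro rfl; norm_num at hk
  have c := h.1.core
  obtain ⟨hlim, τ₁, h1, t, B, rfl, hB, hb⟩ := c.exists_power_bounds hk hV (h.isMaximalTime hk0)
  have hσ : 2 / k ^ 2 < 1 := (div_lt_one (by linarith)).2 hk
  have hσ0 : 0 < 2 / k ^ 2 := by positivity
  have hle : ∀ τ ∈ openDom (t : EReal), τ ≤ t := fun τ hτ => by
    have : τ < t := by exact_mod_cast hτ.2
    exact this.le
  set σ := 1 - 2 / k ^ 2 with hσ_def
  refine ⟨EReal.coe_lt_top t, ?_, ?_⟩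
  -- As R' ≤ √B R^(1 + σ/2), the derivative of R^p is at most a multiple of R, hence of the rate,
  -- while R^p → ∞ because p > 0.
  · set p := 1 - σ / 2 with hp
    have hp0 : 0 < p := by linarith
    set A := Real.exp (-t / 2) / (B * (p * Real.sqrt B)) with hA
    have hsB := Real.sqrt_pos.2 hB
    have hA0 : 0 < A := by positivity
    refine h.1.isRadialNullInfinity h1 (G := fun τ => A * s.R τ ^ p)
      (fun τ hτ _ => ((c.dR τ hτ).rpow_const (Or.inl (c.R_pos τ hτ).ne')).const_mul A)
      (fun τ hτ h' => ?_)
      (Tendsto.const_mul_atTop hA0 ((tendsto_rpow_atTop hp0).comp hlim))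
    have hr0 := c.R_pos τ hτ
    obtain ⟨b1, b2, -, b4, -⟩ := hb τ hτ h'
    have e1 : deriv s.R τ * s.R τ ^ (p - 1) ≤ Real.sqrt B * s.R τ := by
      refine abs_le_of_sq_le_sq' ?_ (by positivity) |>.2
      rw [mul_pow, mul_pow, Real.sq_sqrt hB.le, ← Real.rpow_mul_natCast hr0.le]
      have q : 0 < s.R τ ^ ((p - 1) * ((2 : ℕ) : ℝ)) := Real.rpow_pos_of_pos hr0 _
      refine (mul_le_mul_of_nonneg_right b4 q.le).trans (le_of_eq ?_)
      rw [mul_assoc, ← Real.rpow_add hr0, ← Real.rpow_natCast (s.R τ) 2]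
      congr 2
      push_cast
      rw [hp, hσ_def]
      ring
    have e2 : Real.exp (-t / 2) * Real.exp (k ^ 2 / 2 * s.l τ) ≤
        Real.exp (k ^ 2 / 2 * s.l τ - τ / 2) := by
      rw [← Real.exp_add]
      exact Real.exp_le_exp.2 (by linarith [hle τ hτ])
    refine le_trans ?_ e2
    calc A * (deriv s.R τ * p * s.R τ ^ (p - 1)) =
        A * p * (deriv s.R τ * s.R τ ^ (p - 1)) := by ring
      _ ≤ A * p * (Real.sqrt B * s.R τ) := by gcongr
      _ = Real.exp (-t / 2) * (s.R τ / B) := by rw [hA]; field_simp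
      _ ≤ Real.exp (-t / 2) * Real.exp (k ^ 2 / 2 * s.l τ) := by
        gcongr
        rw [div_le_iff₀' hB]
        exact b2
  · refine h.1.ricciScalarDecays hk0 ?_
    have h0 := ((tendsto_rpow_neg_atTop hσ0).comp hlim).const_mul
      (Real.exp (t / 2) * B * (2 * B + k ^ 2 / 4 * (B + 1)))
    rw [mul_zero] at h0
    refine squeeze_zero_norm' ?_ h0
    filter_upwards [eventually_endFilter h1] with τ hτ
    have hr0 := c.R_pos τ hτ.1
    obtain ⟨b1, b2, b3, -, b5⟩ := hb τ hτ.1 hτ.2.le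
    rw [mul_div_cancel_left₀ _ hr0.ne'] at b5
    have e1 : 1 ≤ s.R τ ^ σ := Real.one_le_rpow b1 (by linarith)
    have e2 : Real.exp (τ / 2 - k ^ 2 / 2 * s.l τ) ≤ Real.exp (t / 2) * (B / s.R τ) := by
      rw [sub_eq_add_neg, Real.exp_add, Real.exp_neg]
      have := hle τ hτ.1
      gcongr
      rw [inv_le_comm₀ (Real.exp_pos _) (by positivity), inv_div, div_le_iff₀' hB]
      exact b2
    have e3 : |2 * (V₀ * Real.exp (lam k * s.l τ)) + k ^ 2 / 4 * (deriv s.l τ ^ 2 - 1 / 4)| ≤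
        (2 * B + k ^ 2 / 4 * (B + 1)) * s.R τ ^ σ := by
      refine (abs_add_le _ _).trans ?_
      rw [abs_mul 2, abs_two, abs_mul (k ^ 2 / 4), abs_of_nonneg (show 0 ≤ k ^ 2 / 4 by positivity), add_mul,
        mul_assoc 2, mul_assoc (k ^ 2 / 4)]
      gcongr
      rw [abs_le]
      have := sq_nonneg (deriv s.l τ)
      constructor <;> nlinarith
    rw [norm_mul, Real.norm_eq_abs, Real.norm_eq_abs, abs_of_pos (Real.exp_pos _)]
    refine (mul_le_mul e2 e3 (abs_nonneg _) (by positivity)).trans (le_of_eq ?_)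
    have e4 : s.R τ ^ σ = s.R τ * s.R τ ^ (-(2 / k ^ 2)) := by
      rw [hσ_def, sub_eq_add_neg, Real.rpow_add hr0, Real.rpow_one]
    simp only [Function.comp]
    rw [e4]
    field_simp

end SelfSimilarCylinder


namespace SelfSimilarCylinder

/-! ### Barriers and integrable rates -/

/-- A continuous function that is positive near `0` and cannot become nonpositive for the first
time is positive. -/
theorem pos_of_barrier {T : EReal} {g : ℝ → ℝ} (hc : ContinuousOn g (openDom T))
    (h0 : ∀ᶠ t in 𝓝[>] (0 : ℝ), 0 < g t)
    (h : ∀ τ ∈ openDom T, (∀ s, 0 < s → s < τ → 0 < g s) → 0 < g τ) {τ : ℝ} (hτ : τ ∈ openDom T) :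
    0 < g τ := by
  by_contra! hneg
  set B := {t | t ∈ openDom T ∧ g t ≤ 0}
  have hB : B.Nonempty := ⟨τ, hτ, hneg⟩
  obtain ⟨ε, hε, he⟩ := (mem_nhdsGT_iff_exists_Ioo_subset).1 h0
  have hε0 : (0 : ℝ) < ε := hε
  have hlow : ∀ t ∈ B, ε ≤ t := fun t ht => by
    by_contra! hlt
    exact absurd (he ⟨ht.1.1, hlt⟩ : 0 < g t) (not_lt.2 ht.2)
  have hbdd : BddBelow B := ⟨ε, hlow⟩
  set b := sInf B with hb
  have hb0 : 0 < b := hε0.trans_le (le_csInf hB hlow)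
  have hbT : b ∈ openDom T := mem_openDom_of_le hτ hb0 (csInf_le hbdd ⟨hτ, hneg⟩)
  have hgb := h b hbT fun s hs hsb => by
    by_contra! hle
    exact absurd (csInf_le hbdd ⟨mem_openDom_of_le hbT hs hsb.le, hle⟩) (not_le.2 hsb)
  have hev : ∀ᶠ t in 𝓝 b, 0 < g t :=
    (hc.continuousAt (openDom_mem_nhds hbT)).eventually_const_lt hgb
  obtain ⟨δ, hδ, hd⟩ := Metric.eventually_nhds_iff.1 hev
  obtain ⟨t, htB, ht⟩ := exists_lt_of_csInf_lt hB (show sInf B < b + δ by linarith)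
  refine absurd (hd (y := t) ?_) (not_lt.2 htB.2)
  rw [Real.dist_eq, abs_of_nonneg (sub_nonneg.2 (csInf_le hbdd htB))]
  linarith

theorem hasDerivAt_exp_mul (a τ : ℝ) :
    HasDerivAt (fun τ => Real.exp (a * τ)) (a * Real.exp (a * τ)) τ :=
  (((hasDerivAt_id τ).const_mul a).exp).congr_deriv (by simp only [id]; ring)

/-- f - (C/ε) e^(-ε τ) is nondecreasing and f + (C/ε) e^(-ε τ) nonincreasing, so the former is
bounded and converges. -/
theorem exists_tendsto_of_hasDerivAt_le_exp {f f' : ℝ → ℝ} {C ε : ℝ} (hε : 0 < ε)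
    (hf : ∀ τ, 1 ≤ τ → HasDerivAt f (f' τ) τ) (hb : ∀ τ, 1 ≤ τ → |f' τ| ≤ C * Real.exp (-ε * τ)) :
    ∃ a, Tendsto f atTop (𝓝 a) := by
  have hC : 0 ≤ C := by
    have := (abs_nonneg _).trans (hb 1 le_rfl)
    exact nonneg_of_mul_nonneg_left this (Real.exp_pos _)
  have d := fun (q : ℝ) τ (hτ : τ ∈ Set.Ici (1 : ℝ)) => (hf τ hτ).add ((hasDerivAt_exp_mul (-ε) τ).const_mul q)
  have e : ∀ τ : ℝ, -(C / ε) * (-ε * Real.exp (-ε * τ)) = C * Real.exp (-ε * τ) := fun τ => by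
    field_simp
  have e' : ∀ τ : ℝ, C / ε * (-ε * Real.exp (-ε * τ)) = -(C * Real.exp (-ε * τ)) := fun τ => by
    field_simp
  have m1 := monotoneOn_of_hasDerivAt Set.ordConnected_Ici (d (-(C / ε))) fun τ hτ => by
    rw [e]; linarith [(abs_le.1 (hb τ hτ)).1]
  have m2 := antitoneOn_of_hasDerivAt Set.ordConnected_Ici (d (C / ε)) fun τ hτ => by
    rw [e']; linarith [(abs_le.1 (hb τ hτ)).2]
  obtain ⟨a, ha, -⟩ := exists_tendsto_endFilter_of_monotoneOn (T := ⊤) (τ₁ := 1)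
    (f := fun τ => f τ + -(C / ε) * Real.exp (-ε * τ))
    (B := f 1 + C / ε * Real.exp (-ε * 1)) (mem_openDom_top one_pos)
    (fun a ha b hb hab => m1 ha.2 hb.2 hab) fun τ _ hτ => by
      have e1 : f τ + C / ε * Real.exp (-ε * τ) ≤ f 1 + C / ε * Real.exp (-ε * 1) :=
        m2 Set.self_mem_Ici hτ hτ
      have e2 : 0 ≤ C / ε * Real.exp (-ε * τ) := by positivity
      linarith
  rw [endFilter_top] at ha
  refine ⟨a, ?_⟩
  have h2 := ha.add ((tendsto_exp_mul_nhds_zero (a := -ε) (by linarith)).const_mul (C / ε))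
  rw [mul_zero, add_zero] at h2
  exact h2.congr fun τ => by ring

theorem exists_abs_le_exp_of_hasDerivAt {f f' : ℝ → ℝ} {C β : ℝ} (hβ : 0 < β)
    (hf : ∀ τ, 1 ≤ τ → HasDerivAt f (f' τ) τ) (hb : ∀ τ, 1 ≤ τ → |f' τ| ≤ C * Real.exp (β * τ)) :
    ∃ D, ∀ τ, 1 ≤ τ → |f τ| ≤ D * Real.exp (β * τ) := by
  have hC : 0 ≤ C := by
    have := (abs_nonneg _).trans (hb 1 le_rfl)
    exact nonneg_of_mul_nonneg_left this (Real.exp_pos _)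
  have d := fun (q : ℝ) τ (hτ : τ ∈ Set.Ici (1 : ℝ)) => (hf τ hτ).add ((hasDerivAt_exp_mul β τ).const_mul q)
  have e : ∀ τ : ℝ, C / β * (β * Real.exp (β * τ)) = C * Real.exp (β * τ) := fun τ => by
    field_simp
  have e' : ∀ τ : ℝ, -(C / β) * (β * Real.exp (β * τ)) = -(C * Real.exp (β * τ)) := fun τ => by
    field_simp
  have m1 := monotoneOn_of_hasDerivAt Set.ordConnected_Ici (d (C / β)) fun τ hτ => by
    rw [e]; linarith [(abs_le.1 (hb τ hτ)).1]
  have m2 := antitoneOn_of_hasDerivAt Set.ordConnected_Ici (d (-(C / β))) fun τ hτ => by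
    rw [e']; linarith [(abs_le.1 (hb τ hτ)).2]
  refine ⟨|f 1| + C / β, fun τ hτ => ?_⟩
  have e1 : f 1 + C / β * Real.exp (β * 1) ≤ f τ + C / β * Real.exp (β * τ) :=
    m1 Set.self_mem_Ici hτ hτ
  have e2 : f τ + -(C / β) * Real.exp (β * τ) ≤ f 1 + -(C / β) * Real.exp (β * 1) :=
    m2 Set.self_mem_Ici hτ hτ
  have e3 : 0 ≤ C / β * Real.exp (β * 1) := by positivity
  have e4 : |f 1| * 1 ≤ |f 1| * Real.exp (β * τ) := by
    gcongr
    exact Real.one_le_exp (mul_nonneg hβ.le (zero_le_one.trans hτ))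
  have e5 := abs_le.1 (le_refl |f 1|)
  rw [abs_le]
  constructor <;> linarith [e5.1, e5.2]

/-! ### k² < 2 and V₀ e^(λ l₀) < k² / 8: expansion for all times -/

variable {k V₀ l₀ φ₀ c₁ : ℝ} {T : EReal} {s : Fields} {R x l y : ℝ → ℝ}

namespace Core

theorem continuousOn_y (c : Core k V₀ l₀ T R x l y) : ContinuousOn y (openDom T) := fun t ht =>
  (c.dy t ht).continuousAt.continuousWithinAt

theorem le_l_of_y_nonneg (c : Core k V₀ l₀ T R x l y) {τ : ℝ} (hτ : τ ∈ openDom T)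
    (h : ∀ s, 0 < s → s < τ → 0 ≤ y s) : l₀ ≤ l τ := by
  have m := monotoneOn_of_hasDerivAt (Set.ordConnected_Ioo (a := 0) (b := τ))
    (fun t ht => c.dl t (mem_openDom_of_le hτ ht.1 ht.2.le))
    fun t ht => div_nonneg (h t ht.1 ht.2) (c.R_pos t (mem_openDom_of_le hτ ht.1 ht.2.le)).le
  have h1 : ∀ t ∈ Set.Ioo 0 τ, l₀ ≤ l t := fun t ht => le_of_tendsto c.l_lim (by
    filter_upwards [Ioo_mem_nhdsGT ht.1] with r hr
    exact m ⟨hr.1, hr.2.trans ht.2⟩ ht hr.2.le)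
  have h2 : Tendsto l (𝓝[<] τ) (𝓝 (l τ)) := (c.dl τ hτ).continuousAt.mono_left nhdsWithin_le_nhds
  exact ge_of_tendsto h2 (by
    filter_upwards [Ioo_mem_nhdsLT hτ.1] with r hr using h1 r hr)

/-- If `k² < 2` and `V₀ e ^ (λ l₀) < k² / 8`, then `l` increases and the potential is small. -/
theorem expanding (c : Core k V₀ l₀ T R x l y) (hk0 : k ≠ 0) (hk : k ^ 2 < 2)
    (hV : V₀ * Real.exp (lam k * l₀) < k ^ 2 / 8) {τ : ℝ} (hτ : τ ∈ openDom T) :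
    0 < y τ ∧ |V₀ * Real.exp (lam k * l τ)| ≤ |V₀ * Real.exp (lam k * l₀)| ∧
      V₀ * Real.exp (lam k * l τ) ≤ max (V₀ * Real.exp (lam k * l₀)) 0 := by
  have hl : lam k < 0 := by rw [lam]; linarith
  have hk2 : 0 < k ^ 2 := by positivity
  have hW : ∀ r, l₀ ≤ r → |V₀ * Real.exp (lam k * r)| ≤ |V₀ * Real.exp (lam k * l₀)| ∧
      V₀ * Real.exp (lam k * r) ≤ max (V₀ * Real.exp (lam k * l₀)) 0 := by
    intro r hr
    have e : Real.exp (lam k * r) ≤ Real.exp (lam k * l₀) :=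
      Real.exp_le_exp.2 (mul_le_mul_of_nonpos_left hr hl.le)
    constructor
    · rw [abs_mul, abs_mul, abs_of_pos (Real.exp_pos _), abs_of_pos (Real.exp_pos _)]
      gcongr
    · rcases le_total V₀ 0 with h | h
      · exact le_max_of_le_right (mul_nonpos_of_nonpos_of_nonneg h (Real.exp_pos _).le)
      · exact le_max_of_le_left (mul_le_mul_of_nonneg_left e h)
  have hδ : ∀ w, w ≤ max (V₀ * Real.exp (lam k * l₀)) 0 → 0 < 1 / 4 - 2 / k ^ 2 * w := by
    intro w hw
    have h1 : w < k ^ 2 / 8 := hw.trans_lt (max_lt hV (by positivity))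
    have h2 : 2 / k ^ 2 * w < 2 / k ^ 2 * (k ^ 2 / 8) := by gcongr
    have h3 : 2 / k ^ 2 * (k ^ 2 / 8) = 1 / 4 := by field_simp; norm_num
    linarith
  have hy : ∀ τ ∈ openDom T, 0 < y τ := by
    intro τ hτ
    refine pos_of_barrier c.continuousOn_y ?_ (fun τ hτ h => ?_) hτ
    · have h1 := c.y_div_sq_lim.eventually_const_lt (half_pos (hδ _ (le_max_left _ _)) |>.trans_le
        (by rw [mul_assoc]))
      filter_upwards [h1, c.eventually_mem] with t ht hm
      exact (div_pos_iff_of_pos_right (pow_pos (c.R_pos t hm) 2)).1 ht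
    -- As long as y > 0, l stays above l₀ and the potential below its barrier value, so y keeps
    -- increasing and cannot return to zero.
    · have m : StrictMonoOn y (Set.Ioc 0 τ) := strictMonoOn_of_hasDerivAt Set.ordConnected_Ioc
        (fun t ht => c.dy t (mem_openDom_of_le hτ ht.1 ht.2)) fun t ht => by
          have hm := mem_openDom_of_le hτ ht.1 ht.2
          have := hδ _ (hW _ (c.le_l_of_y_nonneg hm fun s hs hst => (h s hs (hst.trans_le ht.2)).le)).2
          rw [mul_assoc]
          exact mul_pos this (c.R_pos t hm)
      have h2 : 0 < τ / 2 := half_pos hτ.1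
      exact (h _ h2 (half_lt_self hτ.1)).trans
        (m ⟨h2, half_le_self hτ.1.le⟩ ⟨hτ.1, le_rfl⟩ (half_lt_self hτ.1))
  exact ⟨hy τ hτ, hW _ (c.le_l_of_y_nonneg hτ fun s hs hst =>
    (hy s (mem_openDom_of_le hτ hs hst.le)).le)⟩

/-- Bounded potentials have exponentially bounded radius. -/
theorem add_le_exp (c : Core k V₀ l₀ T R x l y) {M : ℝ} (hM : 1 ≤ M)
    (hx : ∀ τ ∈ openDom T, 0 ≤ x τ)
    (h : ∀ τ ∈ openDom T, 1 / 4 - V₀ * Real.exp (lam k * l τ) ≤ M) {τ : ℝ} (hτ : τ ∈ openDom T) :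
    x τ + R τ ≤ Real.exp (M * τ) := by
  have := ge_of_hasDerivAt_nonpos
    (fun t ht => ((c.dx t ht).add (c.dR t ht)).mul (hasDerivAt_exp_mul (-M) t))
    (fun t ht => ?_) ((c.x_lim.add c.R_lim).mul (tendsto_nhdsGT_zero
      (show Continuous fun t => Real.exp (-M * t) by fun_prop) rfl)) hτ
  · have e : (x τ + R τ) * Real.exp (-M * τ) ≤ (1 + 0) * Real.exp (-M * 0) := this
    rw [mul_zero, Real.exp_zero, add_zero, mul_one, neg_mul, Real.exp_neg, ← div_eq_mul_inv,
      div_le_one (Real.exp_pos _)] at e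
    exact e
  · have h1 := mul_le_mul_of_nonneg_right (h t ht) (c.R_pos t ht).le
    have h2 := mul_le_mul_of_nonneg_right hM (hx t ht)
    have h3 := mul_nonneg (Real.exp_pos (-M * t)).le (show 0 ≤ M * R t + M * x t -
      ((1 / 4 - V₀ * Real.exp (lam k * l t)) * R t + x t) by linarith)
    change _ * Real.exp (-M * t) + (x t + R t) * _ ≤ 0
    linarith

theorem one_le_x_of_le (c : Core k V₀ l₀ T R x l y)
    (h : ∀ τ ∈ openDom T, V₀ * Real.exp (lam k * l τ) ≤ 1 / 4) {τ : ℝ} (hτ : τ ∈ openDom T) :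
    1 ≤ x τ :=
  le_of_hasDerivAt_nonneg c.dx (fun t ht => mul_nonneg (sub_nonneg.2 (h t ht)) (c.R_pos t ht).le)
    c.x_lim hτ

/-- R increases, as W < 1/4, and grows at most exponentially, so a finite end is excluded by
continuation. -/
theorem eq_top_of_expanding (c : Core k V₀ l₀ T R x l y) (hk0 : k ≠ 0) (hk : k ^ 2 < 2)
    (hV : V₀ * Real.exp (lam k * l₀) < k ^ 2 / 8) (hmax : IsMaximalTime k V₀ l₀ T) : T = ⊤ := by
  obtain h | ⟨t, ht, hT⟩ := eq_top_or_eq_coe c.pos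
  · exact h
  have hx : ∀ τ ∈ openDom T, 1 ≤ x τ := fun τ hτ => c.one_le_x_of_le (fun τ hτ =>
    (c.expanding hk0 hk hV hτ).2.2.trans (max_le (by linarith) (by norm_num))) hτ
  obtain ⟨τ₁, h1⟩ := exists_mem_openDom c.pos
  set M := 1 + |V₀ * Real.exp (lam k * l₀)|
  refine (c.not_bounded hk0 hmax hT h1 (c.R_pos _ h1) (b := Real.exp (M * t)) fun τ hτ => ?_).elim
  have hm : τ ∈ openDom T := ⟨h1.1.trans_le hτ.1, by rw [hT]; exact_mod_cast hτ.2⟩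
  refine ⟨(c.strictMonoOn_R hx).monotoneOn h1 hm hτ.1, ?_⟩
  have h2 := c.add_le_exp (M := M) (le_add_of_nonneg_right (abs_nonneg _))
    (fun τ hτ => zero_le_one.trans (hx τ hτ)) (fun τ hτ => by
      have := (abs_le.1 (c.expanding hk0 hk hV hτ).2.1).1
      linarith) hm
  have h3 : Real.exp (M * τ) ≤ Real.exp (M * t) := Real.exp_le_exp.2
    (mul_le_mul_of_nonneg_left hτ.2.le (by positivity))
  linarith [hx τ hm]

/-- In the expanding case `l' = y / R` is bounded away from zero. -/
theorem exists_rate_lower_bound (c : Core k V₀ l₀ ⊤ R x l y) (hk0 : k ≠ 0) (hk : k ^ 2 < 2)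
    (hV : V₀ * Real.exp (lam k * l₀) < k ^ 2 / 8) : ∃ κ, 0 < κ ∧ ∀ τ, 1 ≤ τ → κ ≤ y τ / R τ := by
  have hk2 : 0 < k ^ 2 := by positivity
  set w := max (V₀ * Real.exp (lam k * l₀)) 0 with hw
  set M := 1 + |V₀ * Real.exp (lam k * l₀)| with hM
  have hM1 : 1 ≤ M := le_add_of_nonneg_right (abs_nonneg _)
  have hw8 : w < k ^ 2 / 8 := max_lt hV (by positivity)
  have hx : ∀ τ ∈ openDom ⊤, 1 ≤ x τ := fun τ hτ => c.one_le_x_of_le (fun τ hτ =>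
    (c.expanding hk0 hk hV hτ).2.2.trans (by linarith)) hτ
  set δ := 1 / 4 - 2 / k ^ 2 * w with hδ
  have hδ0 : 0 < δ := by
    have h2 : 2 / k ^ 2 * w < 2 / k ^ 2 * (k ^ 2 / 8) := by gcongr
    have h3 : 2 / k ^ 2 * (k ^ 2 / 8) = 1 / 4 := by field_simp; norm_num
    linarith
  set m := 1 / 4 - w with hm
  have hm0 : 0 < m := by linarith
  have hb : ∀ τ ∈ openDom ⊤, m ≤ 1 / 4 - V₀ * Real.exp (lam k * l τ) ∧
      1 / 4 - V₀ * Real.exp (lam k * l τ) ≤ M ∧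
      δ ≤ 1 / 4 - 2 / k ^ 2 * V₀ * Real.exp (lam k * l τ) := by
    intro τ hτ
    obtain ⟨-, h1, h2⟩ := c.expanding hk0 hk hV hτ
    have h3 := (abs_le.1 h1).1
    have h4 : 2 / k ^ 2 * (V₀ * Real.exp (lam k * l τ)) ≤ 2 / k ^ 2 * w :=
      mul_le_mul_of_nonneg_left h2 (by positivity)
    rw [mul_assoc]
    exact ⟨by linarith, by linarith, by linarith⟩
  -- Energy comparison of R'' with m R and M R, from the bounds on 1/4 - W.
  have hxlow : ∀ τ ∈ openDom ⊤, m * R τ ^ 2 ≤ x τ ^ 2 - 1 ∧ x τ ^ 2 - 1 ≤ M * R τ ^ 2 := by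
    intro τ hτ
    have dd := fun (q : ℝ) t (ht : t ∈ openDom ⊤) => (hasDerivAt_sq (c.dx t ht)).sub
      ((hasDerivAt_sq (c.dR t ht)).const_mul q)
    have ll := fun q : ℝ => (c.x_lim.pow 2).sub ((c.R_lim.pow 2).const_mul q)
    have e1 : 1 ^ 2 - m * 0 ^ 2 ≤ x τ ^ 2 - m * R τ ^ 2 :=
      le_of_hasDerivAt_nonneg (dd m) (fun t ht => by
        have := mul_le_mul_of_nonneg_right (hb t ht).1
          (mul_nonneg (c.R_pos t ht).le (zero_le_one.trans (hx t ht)))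
        linarith) (ll m) hτ
    have e2 : x τ ^ 2 - M * R τ ^ 2 ≤ 1 ^ 2 - M * 0 ^ 2 :=
      ge_of_hasDerivAt_nonpos (dd M) (fun t ht => by
        have := mul_le_mul_of_nonneg_right (hb t ht).2.1
          (mul_nonneg (c.R_pos t ht).le (zero_le_one.trans (hx t ht)))
        linarith) (ll M) hτ
    constructor <;> linarith
  -- y' ≥ δ R and x' ≤ M R, with y = 0 and x = 1 at the axis.
  have hylow : ∀ τ ∈ openDom ⊤, δ / M * (x τ - 1) ≤ y τ := by
    intro τ hτ
    have e1 : 0 - δ / M * 1 ≤ y τ - δ / M * x τ :=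
      le_of_hasDerivAt_nonneg (fun t ht => (c.dy t ht).sub ((c.dx t ht).const_mul (δ / M)))
        (fun t ht => by
          have h1 := mul_le_mul_of_nonneg_right (hb t ht).2.2 (c.R_pos t ht).le
          have h2 := mul_le_mul_of_nonneg_left (mul_le_mul_of_nonneg_right (hb t ht).2.1
            (c.R_pos t ht).le) (show 0 ≤ δ / M by positivity)
          have h3 : δ / M * (M * R t) = δ * R t := by field_simp
          linarith) (c.y_lim.sub (c.x_lim.const_mul (δ / M))) hτ
    linarith
  -- For τ ≥ 1 one has R ≥ 1, so x ≤ (1 + M) R; then m R² ≤ x² - 1 ≤ 2 x (x - 1) yields x - 1 ≥ m R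
  -- / (2 (1 + M)).
  refine ⟨δ / M * (m / (2 * (1 + M))), by positivity, fun τ hτ => ?_⟩
  have hmem : τ ∈ openDom ⊤ := mem_openDom_top (one_pos.trans_le hτ)
  have hR := hτ.trans (c.le_R hx hmem)
  have hR0 := c.R_pos τ hmem
  have hx1 := hx τ hmem
  obtain ⟨e1, e2⟩ := hxlow τ hmem
  have e3 : x τ ≤ (1 + M) * R τ := by
    refine abs_le_of_sq_le_sq' ?_ (by positivity) |>.2
    have h1 : 1 ≤ R τ ^ 2 := one_le_pow₀ hR
    have h2 : (1 + M) * R τ ^ 2 ≤ (1 + M) * ((1 + M) * R τ ^ 2) := by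
      refine mul_le_mul_of_nonneg_left (le_mul_of_one_le_left (sq_nonneg _) ?_) ?_ <;> linarith
    linarith
  have e4 : m / (2 * (1 + M)) * R τ ≤ x τ - 1 := by
    rw [div_mul_eq_mul_div, div_le_iff₀ (by positivity)]
    have h1 : m * R τ ^ 2 ≤ (x τ - 1) * (2 * x τ) := by nlinarith
    have h2 : (x τ - 1) * (2 * x τ) ≤ (x τ - 1) * (2 * ((1 + M) * R τ)) :=
      mul_le_mul_of_nonneg_left (by linarith) (by linarith)
    refine le_of_mul_le_mul_right ?_ hR0
    linarith
  rw [le_div_iff₀ hR0, mul_assoc]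
  exact (mul_le_mul_of_nonneg_left e4 (by positivity)).trans (hylow τ hmem)

/-- Since λ < 0 and l grows linearly, W decays exponentially and R'' = R/4 - W R is asymptotically
free. The combinations x + R/2, x - R/2 and y - x diagonalize the free equation, and W enters them
as an integrable error. -/
theorem exists_asymptotics (c : Core k V₀ l₀ ⊤ R x l y) (hk0 : k ≠ 0) (hk : k ^ 2 < 2)
    (hV : V₀ * Real.exp (lam k * l₀) < k ^ 2 / 8) :
    (∃ p, 0 < p ∧ Tendsto (fun τ => Real.exp (-τ / 2) * R τ) atTop (𝓝 p)) ∧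
      (∃ a, Tendsto (fun τ => l τ - τ / 2) atTop (𝓝 a)) ∧
      ∃ C ε, 0 < ε ∧ ∀ τ, 1 ≤ τ → |1 / 4 + (1 - x τ) / (2 * R τ)| ≤ C * Real.exp (-ε * τ) := by
  obtain ⟨κ, hκ, hY⟩ := c.exists_rate_lower_bound hk0 hk hV
  have hl : lam k < 0 := by rw [lam]; linarith
  have mem : ∀ {τ : ℝ}, 1 ≤ τ → τ ∈ openDom ⊤ := fun hτ => mem_openDom_top (one_pos.trans_le hτ)
  have hx : ∀ τ ∈ openDom ⊤, 1 ≤ x τ := fun τ hτ => c.one_le_x_of_le (fun τ hτ =>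
    (c.expanding hk0 hk hV hτ).2.2.trans (max_le (by linarith) (by norm_num))) hτ
  -- The rate is capped at 1/4 so that the exponents 1/2 - ε below stay positive and e^(-τ / 2) ≤
  -- e^(-ε τ).
  obtain ⟨ε, C, hε, hε4, hC0, hW⟩ : ∃ ε C, 0 < ε ∧ ε ≤ 1 / 4 ∧ 0 ≤ C ∧
      ∀ τ, 1 ≤ τ → |V₀ * Real.exp (lam k * l τ)| ≤ C * Real.exp (-ε * τ) := by
    have m := monotoneOn_of_hasDerivAt Set.ordConnected_Ici
      (fun τ (hτ : τ ∈ Set.Ici (1 : ℝ)) => (c.dl τ (mem hτ)).sub ((hasDerivAt_id τ).const_mul κ))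
      fun τ hτ => by linarith [hY τ hτ]
    refine ⟨min (-lam k * κ) (1 / 4), |V₀| * Real.exp (lam k * (l 1 - κ)),
      lt_min (mul_pos (neg_pos.2 hl) hκ) (by norm_num), min_le_right _ _, by positivity,
      fun τ hτ => ?_⟩
    have e : l 1 - κ * 1 ≤ l τ - κ * τ := m Set.self_mem_Ici hτ hτ
    rw [abs_mul, abs_of_pos (Real.exp_pos _), mul_assoc, ← Real.exp_add]
    refine mul_le_mul_of_nonneg_left (Real.exp_le_exp.2 ?_) (abs_nonneg _)
    have e1 := mul_le_mul_of_nonpos_left (show l 1 - κ + κ * τ ≤ l τ by linarith) hl.le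
    have e2 := mul_le_mul_of_nonneg_right (min_le_left (-lam k * κ) (1 / 4))
      (zero_le_one.trans hτ)
    linarith
  -- The growing mode. Working with log P gives an integrable derivative without prior knowledge
  -- that P is bounded, and makes the limit of P positive.
  set P : ℝ → ℝ := fun τ => Real.exp (-(1 / 2) * τ) * (x τ + R τ / 2) with hP
  have hPpos : ∀ τ, 1 ≤ τ → 0 < P τ := fun τ hτ => by
    have h1 := hx τ (mem hτ)
    have h2 := c.R_pos τ (mem hτ)
    have h3 := Real.exp_pos (-(1 / 2) * τ)
    simp only [hP]
    positivity
  have hS : ∀ τ, 1 ≤ τ → Real.exp (-(1 / 2) * τ) * R τ ≤ 2 * P τ := fun τ hτ => by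
    have h1 := hx τ (mem hτ)
    have h3 := Real.exp_pos (-(1 / 2) * τ)
    simp only [hP]
    nlinarith
  have dP : ∀ τ, 1 ≤ τ → HasDerivAt P
      (-(V₀ * Real.exp (lam k * l τ) * (Real.exp (-(1 / 2) * τ) * R τ))) τ := fun τ hτ =>
    ((hasDerivAt_exp_mul (-(1 / 2)) τ).mul ((c.dx τ (mem hτ)).add
      ((c.dR τ (mem hτ)).div_const 2))).congr_deriv (by
        change _ * (x τ + R τ / 2) + _ = _
        ring)
  obtain ⟨q, hq⟩ := exists_tendsto_of_hasDerivAt_le_exp (C := 2 * C) hε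
    (fun τ hτ => (dP τ hτ).log (hPpos τ hτ).ne') (fun τ hτ => by
      have h1 := hPpos τ hτ
      have h2 := hW τ hτ
      have h3 := hS τ hτ
      have h4 := mul_pos (Real.exp_pos (-(1 / 2) * τ)) (c.R_pos τ (mem hτ))
      rw [abs_div, abs_neg, abs_mul, abs_of_pos h1, abs_of_pos h4, div_le_iff₀ h1]
      calc _ ≤ C * Real.exp (-ε * τ) * (2 * P τ) := by gcongr
        _ = _ := by ring)
  have hPlim : Tendsto P atTop (𝓝 (Real.exp q)) := by
    refine ((Real.continuous_exp.tendsto q).comp hq).congr' ?_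
    filter_upwards [eventually_ge_atTop 1] with τ hτ using Real.exp_log (hPpos τ hτ)
  obtain ⟨B, hB⟩ : ∃ B, ∀ τ, 1 ≤ τ → P τ ≤ B := by
    obtain ⟨a, ha⟩ := eventually_atTop.1 (hPlim.eventually_le_const (lt_add_one (Real.exp q)))
    obtain ⟨b, hb⟩ := isCompact_Icc.exists_bound_of_continuousOn (s := Set.Icc 1 a) (f := P)
      fun τ hτ => (dP τ hτ.1).continuousAt.continuousWithinAt
    refine ⟨max b (Real.exp q + 1), fun τ hτ => ?_⟩
    rcases le_total a τ with h | h
    · exact (ha τ h).trans (le_max_right _ _)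
    · exact ((le_abs_self _).trans (hb τ ⟨hτ, h⟩)).trans (le_max_left _ _)
  have hB0 : 0 ≤ B := (hPpos 1 le_rfl).le.trans (hB 1 le_rfl)
  have hWS : ∀ τ, 1 ≤ τ → ∀ a b : ℝ, |b * Real.exp ((a + 1 / 2) * τ) *
      (V₀ * Real.exp (lam k * l τ) * (Real.exp (-(1 / 2) * τ) * R τ))| ≤
      |b| * (C * (2 * B)) * Real.exp ((a + 1 / 2 - ε) * τ) := by
    intro τ hτ a b
    have h1 := hW τ hτ
    have h3 := (hS τ hτ).trans (mul_le_mul_of_nonneg_left (hB τ hτ) zero_le_two)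
    have h4 := mul_pos (Real.exp_pos (-(1 / 2) * τ)) (c.R_pos τ (mem hτ))
    rw [abs_mul, abs_mul, abs_mul _ (Real.exp (-(1 / 2) * τ) * R τ), abs_of_pos h4,
      abs_of_pos (Real.exp_pos _)]
    calc _ ≤ |b| * Real.exp ((a + 1 / 2) * τ) * (C * Real.exp (-ε * τ) * (2 * B)) := by gcongr
      _ = |b| * (C * (2 * B)) * (Real.exp ((a + 1 / 2) * τ) * Real.exp (-ε * τ)) := by ring
      _ = _ := by rw [← Real.exp_add]; ring_nf
  have hone : ∀ τ : ℝ, Real.exp (1 / 2 * τ) * Real.exp (-(1 / 2) * τ) = 1 := fun τ => by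
    rw [← Real.exp_add, ← add_mul, add_neg_cancel, zero_mul, Real.exp_zero]
  -- The decaying mode e^(τ / 2) (x - R/2): it grows strictly slower than e^τ, which forces x / R →
  -- 1/2 exponentially.
  obtain ⟨D₁, hD₁⟩ := exists_abs_le_exp_of_hasDerivAt (C := |-1| * (C * (2 * B)))
    (β := 1 / 2 + 1 / 2 - ε)
    (f := fun τ => Real.exp (1 / 2 * τ) * (x τ - R τ / 2))
    (f' := fun τ => -1 * Real.exp ((1 / 2 + 1 / 2) * τ) *
      (V₀ * Real.exp (lam k * l τ) * (Real.exp (-(1 / 2) * τ) * R τ)))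
    (by linarith) (fun τ hτ => ((hasDerivAt_exp_mul (1 / 2) τ).mul ((c.dx τ (mem hτ)).sub
      ((c.dR τ (mem hτ)).div_const 2))).congr_deriv (by
        change _ * (x τ - R τ / 2) + _ = _
        rw [add_mul, Real.exp_add]
        linear_combination (V₀ * Real.exp (lam k * l τ) * R τ * Real.exp (1 / 2 * τ)) * hone τ))
    (fun τ hτ => hWS τ hτ (1 / 2) (-1))
  -- The free parts of x' and y' agree, so y - x grows slower than R and l' - x / R decays
  -- exponentially.
  obtain ⟨D₂, hD₂⟩ := exists_abs_le_exp_of_hasDerivAt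
    (C := |1 - 2 / k ^ 2| * (C * (2 * B))) (β := 0 + 1 / 2 - ε)
    (f := fun τ => y τ - x τ)
    (f' := fun τ => (1 - 2 / k ^ 2) * Real.exp ((0 + 1 / 2) * τ) *
      (V₀ * Real.exp (lam k * l τ) * (Real.exp (-(1 / 2) * τ) * R τ)))
    (by linarith) (fun τ hτ => ((c.dy τ (mem hτ)).sub (c.dx τ (mem hτ))).congr_deriv (by
        rw [zero_add]
        linear_combination (-(1 - 2 / k ^ 2) * V₀ * Real.exp (lam k * l τ) * R τ) * hone τ))
    (fun τ hτ => hWS τ hτ 0 (1 - 2 / k ^ 2))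
  have hSlim : Tendsto (fun τ => Real.exp (-(1 / 2) * τ) * R τ) atTop (𝓝 (Real.exp q)) := by
    have h1 : Tendsto (fun τ => Real.exp (-(1 / 2) * τ) * (x τ - R τ / 2)) atTop (𝓝 0) := by
      have h0 := (tendsto_exp_mul_nhds_zero (a := -ε) (by linarith)).const_mul D₁
      rw [mul_zero] at h0
      refine squeeze_zero_norm' ?_ h0
      filter_upwards [eventually_ge_atTop 1] with τ hτ
      have h2 := mul_le_mul_of_nonneg_left (hD₁ τ hτ) (Real.exp_pos (-1 * τ)).le
      rw [show (1 / 2 + 1 / 2 - ε) * τ = -ε * τ + 1 * τ by ring, Real.exp_add] at h2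
      have h3 : Real.exp (-1 * τ) * Real.exp (1 * τ) = 1 := by
        rw [← Real.exp_add, ← add_mul, neg_add_cancel, zero_mul, Real.exp_zero]
      have h4 : Real.exp (-1 * τ) * Real.exp (1 / 2 * τ) = Real.exp (-(1 / 2) * τ) := by
        rw [← Real.exp_add]; ring_nf
      rw [Real.norm_eq_abs, ← h4, mul_assoc, abs_mul, abs_of_pos (Real.exp_pos (-1 * τ))]
      refine h2.trans (le_of_eq ?_)
      linear_combination D₁ * Real.exp (-ε * τ) * h3
    have h2 := hPlim.sub h1
    rw [sub_zero] at h2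
    refine h2.congr fun τ => ?_
    simp only [hP]
    ring
  obtain ⟨A, hA0, hA⟩ : ∃ A, 0 < A ∧ ∀ τ, 1 ≤ τ → 1 / R τ ≤ A * Real.exp (-(1 / 2) * τ) := by
    obtain ⟨a, ha⟩ := eventually_atTop.1 (hSlim.eventually_const_le
      (half_lt_self (Real.exp_pos q)))
    have hcont : ContinuousOn (fun τ => Real.exp (1 / 2 * τ) / R τ) (Set.Icc 1 a) := fun τ hτ =>
      (((hasDerivAt_exp_mul (1 / 2) τ).continuousAt).div (c.dR τ (mem hτ.1)).continuousAt
        (c.R_pos τ (mem hτ.1)).ne').continuousWithinAt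
    obtain ⟨b, hb⟩ := isCompact_Icc.exists_bound_of_continuousOn hcont
    have key : ∀ τ, 1 ≤ τ → Real.exp (1 / 2 * τ) / R τ ≤ max b (2 / Real.exp q) := by
      intro τ hτ
      have hR := c.R_pos τ (mem hτ)
      rcases le_total a τ with h | h
      · refine le_trans ?_ (le_max_right _ _)
        have h1 := ha τ h
        rw [div_le_div_iff₀ hR (Real.exp_pos q)]
        have h2 := mul_le_mul_of_nonneg_left h1 (Real.exp_pos (1 / 2 * τ)).le
        have h3 : Real.exp (1 / 2 * τ) * (Real.exp (-(1 / 2) * τ) * R τ) = R τ := by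
          rw [← mul_assoc, hone, one_mul]
        linarith
      · exact ((le_abs_self _).trans (hb τ ⟨hτ, h⟩)).trans (le_max_left _ _)
    refine ⟨max b (2 / Real.exp q), lt_max_of_lt_right (by positivity), fun τ hτ => ?_⟩
    have h1 := mul_le_mul_of_nonneg_right (key τ hτ) (Real.exp_pos (-(1 / 2) * τ)).le
    refine le_trans (le_of_eq ?_) h1
    rw [div_mul_eq_mul_div, hone]
  have hX : ∀ τ, 1 ≤ τ → |x τ / R τ - 1 / 2| ≤ D₁ * A * Real.exp (-ε * τ) := by
    intro τ hτ
    have hR := c.R_pos τ (mem hτ)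
    have h1 := hD₁ τ hτ
    rw [abs_mul, abs_of_pos (Real.exp_pos _)] at h1
    have h2 := mul_le_mul_of_nonneg_left h1 (Real.exp_pos (-(1 / 2) * τ)).le
    have h3 : |x τ - R τ / 2| ≤ D₁ * Real.exp ((1 / 2 - ε) * τ) := by
      rw [show (1 / 2 - ε) * τ = (1 / 2 + 1 / 2 - ε) * τ + -(1 / 2) * τ by ring, Real.exp_add]
      linear_combination h2 - |x τ - R τ / 2| * hone τ
    have h4 : x τ / R τ - 1 / 2 = (x τ - R τ / 2) * (1 / R τ) := by field_simp
    rw [h4, abs_mul, abs_of_pos (by positivity : 0 < 1 / R τ)]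
    refine (mul_le_mul h3 (hA τ hτ) (by positivity) ((abs_nonneg _).trans h3)).trans (le_of_eq ?_)
    rw [show -ε * τ = (1 / 2 - ε) * τ + -(1 / 2) * τ by ring, Real.exp_add]
    ring
  have hYX : ∀ τ, 1 ≤ τ → |y τ / R τ - x τ / R τ| ≤ D₂ * A * Real.exp (-ε * τ) := by
    intro τ hτ
    have hR := c.R_pos τ (mem hτ)
    have h3 := hD₂ τ hτ
    have h4 : y τ / R τ - x τ / R τ = (y τ - x τ) * (1 / R τ) := by field_simp
    rw [h4, abs_mul, abs_of_pos (by positivity : 0 < 1 / R τ)]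
    refine (mul_le_mul h3 (hA τ hτ) (by positivity) ((abs_nonneg _).trans h3)).trans (le_of_eq ?_)
    rw [show -ε * τ = (0 + 1 / 2 - ε) * τ + -(1 / 2) * τ by ring, Real.exp_add]
    ring
  refine ⟨⟨Real.exp q, Real.exp_pos q, hSlim.congr fun τ => by ring_nf⟩, ?_,
    D₁ * A + A, ε, hε, fun τ hτ => ?_⟩
  · refine exists_tendsto_of_hasDerivAt_le_exp (C := D₁ * A + D₂ * A) hε
      (fun τ hτ => (c.dl τ (mem hτ)).sub ((hasDerivAt_id τ).div_const 2)) fun τ hτ => ?_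
    have h1 := hX τ hτ
    have h2 := hYX τ hτ
    rw [show y τ / R τ - 1 / 2 = (y τ / R τ - x τ / R τ) + (x τ / R τ - 1 / 2) by ring]
    refine (abs_add_le _ _).trans ?_
    linarith
  · have hR := c.R_pos τ (mem hτ)
    have h1 := hX τ hτ
    have h2 := hA τ hτ
    have h3 : Real.exp (-(1 / 2) * τ) ≤ Real.exp (-ε * τ) := Real.exp_le_exp.2
      (mul_le_mul_of_nonneg_right (by linarith) (zero_le_one.trans hτ))
    have h4 := h2.trans (mul_le_mul_of_nonneg_left h3 hA0.le)
    have h5 : 0 < 1 / R τ := by positivity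
    rw [show 1 / 4 + (1 - x τ) / (2 * R τ) = -(1 / 2) * (x τ / R τ - 1 / 2) + 1 / 2 * (1 / R τ) by
      field_simp; ring]
    generalize x τ / R τ - 1 / 2 = X at *
    rw [abs_le] at h1 ⊢
    have h6 : 0 ≤ A * Real.exp (-ε * τ) := by positivity
    have h7 : 0 ≤ D₁ * A * Real.exp (-ε * τ) := by linarith [h1.1, h1.2]
    constructor <;> linarith [h1.1, h1.2]

end Core

end SelfSimilarCylinder


namespace SelfSimilarCylinder

variable {k V₀ l₀ φ₀ c₁ : ℝ} {T : EReal} {s : Fields}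

/-! ### Extension through the past null cone -/

/-- A function of `τ ∈ (0, ∞)` with a limit at infinity is a continuous function of
`ρ = e ^ (-τ) ∈ [0, 1)`. -/
theorem continuousOn_of_tendsto_atTop {f : ℝ → ℝ} {a : ℝ} (hf : ContinuousOn f (openDom ⊤))
    (ha : Tendsto f atTop (𝓝 a)) :
    ContinuousOn (fun ρ => if ρ = 0 then a else f (-Real.log ρ)) (Set.Ico 0 1) := by
  intro ρ hρ
  rcases eq_or_ne ρ 0 with rfl | hne
  · have h1 : Tendsto (fun ρ => f (-Real.log ρ)) (𝓝[>] 0) (𝓝 a) :=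
      ha.comp (tendsto_neg_atBot_atTop.comp Real.tendsto_log_nhdsGT_zero)
    rw [ContinuousWithinAt, if_pos rfl]
    have h2 : Tendsto (fun ρ => if ρ = 0 then a else f (-Real.log ρ)) (𝓝[>] 0) (𝓝 a) := by
      refine h1.congr' ?_
      filter_upwards [self_mem_nhdsWithin] with r hr
      exact (if_neg (ne_of_gt hr)).symm
    have h3 : Tendsto (fun ρ => if ρ = 0 then a else f (-Real.log ρ)) (𝓝[≥] 0) (𝓝 a) := by
      rw [← Set.Ioi_insert, nhdsWithin_insert]
      refine Tendsto.sup ?_ h2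
      rw [tendsto_pure_left]
      intro U hU
      rw [if_pos rfl]
      exact mem_of_mem_nhds hU
    exact h3.mono_left (nhdsWithin_mono _ fun r hr => hr.1)
  · have hρ0 : 0 < ρ := hρ.1.lt_of_ne' hne
    have h1 : -Real.log ρ ∈ openDom ⊤ := mem_openDom_top (neg_pos.2 (Real.log_neg hρ0 hρ.2))
    have h2 : ContinuousAt (fun ρ => f (-Real.log ρ)) ρ :=
      ContinuousAt.comp (f := fun ρ => -Real.log ρ) (hf.continuousAt (openDom_mem_nhds h1))
        (Real.continuousAt_log hne).neg
    refine (h2.congr ?_).continuousWithinAt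
    filter_upwards [Ioi_mem_nhds hρ0] with r hr
    exact (if_neg (ne_of_gt hr)).symm

theorem continuous_blockMetric : Continuous fun p : ℝ × ℝ × ℝ => blockMetric p.1 p.2.1 p.2.2 := by
  refine continuous_pi fun i => continuous_pi fun j => ?_
  fin_cases i <;> fin_cases j <;> simp [blockMetric] <;> fun_prop

theorem diagonal_mul_blockMetric_mul_diagonal (a b c d : ℝ) :
    Matrix.diagonal ![1, d, 1, 1] * blockMetric a b c * Matrix.diagonal ![1, d, 1, 1] =
      blockMetric (a * d) b c := by
  ext i j
  rw [Matrix.mul_diagonal, Matrix.diagonal_mul]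
  fin_cases i <;> fin_cases j <;> simp [blockMetric, mul_comm]

/-- If `R e ^ (-τ / 2)`, `l - τ / 2` and `φ` converge, the past null cone is part of the
spacetime. -/
theorem IsSolution.pastNullConeIsRegular (h : IsSolution k V₀ l₀ φ₀ c₁ ⊤ s) (hk : k ^ 2 < 2)
    {p a b : ℝ} (hp : 0 < p) (hS : Tendsto s.S atTop (𝓝 p))
    (hl : Tendsto (fun τ => s.l τ - τ / 2) atTop (𝓝 a)) (hφ : Tendsto s.φ atTop (𝓝 b)) :
    PastNullConeIsRegular s := by
  have cR := h.smooth_R.continuousOn.mono (openDom_subset_dom ⊤)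
  have cl := h.smooth_l.continuousOn.mono (openDom_subset_dom ⊤)
  have cφ := h.smooth_φ.continuousOn.mono (openDom_subset_dom ⊤)
  have cS : ContinuousOn s.S (openDom ⊤) :=
    (Continuous.continuousOn (by fun_prop)).mul cR
  have e1 := continuousOn_of_tendsto_atTop cS hS
  have e2 := continuousOn_of_tendsto_atTop
    (cl.sub (Continuous.continuousOn (by fun_prop : Continuous fun τ : ℝ => τ / 2))) hl
  have e3 := continuousOn_of_tendsto_atTop cφ hφ
  set F₁ : ℝ → ℝ := fun ρ => if ρ = 0 then p else s.S (-Real.log ρ) with hF₁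
  set F₂ : ℝ → ℝ := fun ρ => if ρ = 0 then a else s.l (-Real.log ρ) - -Real.log ρ / 2 with hF₂
  set F₃ : ℝ → ℝ := fun ρ => if ρ = 0 then b else s.φ (-Real.log ρ) with hF₃
  -- With l ≈ τ / 2 the coefficient of du dv behaves like |v|^(-(2 + k²)/4). For v = -(-w)^m the
  -- factor dv/dw cancels this exactly when m (2 - k²) = 4.
  set m := 4 / (2 - k ^ 2) with hm
  have hm0 : 0 < m := div_pos (by norm_num) (by linarith)
  have hm1 : 1 ≤ m := by rw [hm, le_div_iff₀ (by linarith)]; nlinarith [sq_nonneg k]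
  set H : ℝ → ℝ := fun w => -(-w) ^ m with hH
  have dH : ∀ w : ℝ, w < 0 → HasDerivAt H (m * (-w) ^ (m - 1)) w := fun w hw =>
    (((hasDerivAt_neg w).rpow_const (p := m) (Or.inr hm1)).neg).congr_deriv (by ring)
  have cH : Continuous H := ((continuous_neg.rpow_const fun _ => Or.inr hm0.le).neg)
  -- The extended du dw coefficient. The power of -u combines |u|⁻¹ with the factor |u|^((2 + k²)/4)
  -- left over from e^((2 + k²) τ / 4).
  set A : Event → ℝ := fun x => -(m * (-x 0) ^ ((2 + k ^ 2) / 4 - 1) *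
    Real.exp (k ^ 2 / 2 * F₂ (H (x 1) / x 0) + c₁)) with hA
  set B : Event → ℝ := fun x => -x 0 * Real.exp (2 * F₃ (H (x 1) / x 0)) *
    F₁ (H (x 1) / x 0) ^ 2 with hB
  set C : Event → ℝ := fun x => -x 0 * Real.exp (-2 * F₃ (H (x 1) / x 0)) with hC
  refine ⟨H, fun x => blockMetric (A x) (B x) (C x), cH.continuousOn, ?_, ?_, ?_, ?_, ?_, ?_⟩
  · simp [hH, hm0.ne']
  · intro w hw
    have hw' : w < 0 := hw
    refine ContDiffAt.contDiffWithinAt (ContDiffAt.neg (ContDiffAt.rpow_const_of_ne contDiff_neg.contDiffAt ?_))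
    exact (neg_pos.2 hw').ne'
  · intro w hw
    rw [(dH w hw).deriv]
    exact mul_pos hm0 (Real.rpow_pos_of_pos (neg_pos.2 hw) _)
  · intro x hx hx1
    have hw : 0 < -x 1 := neg_pos.2 hx1
    have hHneg : H (x 1) < 0 := neg_neg_of_pos (Real.rpow_pos_of_pos hw m)
    have hu : x 0 < 0 := hx.trans hHneg
    have hρ0 : 0 < H (x 1) / x 0 := div_pos_of_neg_of_neg hHneg hu
    have hρ1 : H (x 1) / x 0 < 1 := by rw [div_lt_one_of_neg hu]; exact hx
    set τ := -Real.log (H (x 1) / x 0) with hτ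
    have hτm : τ ∈ openDom ⊤ := mem_openDom_top (neg_pos.2 (Real.log_neg hρ0 hρ1))
    have hmet : s.metric ![x 0, H (x 1), x 2, x 3] = blockMetric
        (-((-x 0)⁻¹ * Real.exp (2 * s.γ τ + 2 * s.φ τ)))
        (-x 0 * Real.exp (2 * s.φ τ) * s.S τ ^ 2) (-x 0 * Real.exp (-2 * s.φ τ)) := by
      simp only [Fields.metric, blockMetric, Matrix.cons_val_zero, Matrix.cons_val_one, ← hτ,
        abs_of_neg hu]
    rw [hmet, diagonal_mul_blockMetric_mul_diagonal, (dH _ hx1).deriv, h.eq_a τ hτm]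
    have hA' : A x = -((-x 0)⁻¹ * Real.exp (k ^ 2 * s.l τ / 2 + τ / 2 + c₁)) *
        (m * (-x 1) ^ (m - 1)) := by
      simp only [hA, hF₂, if_neg hρ0.ne', ← hτ]
      have hlogτ : τ = Real.log (-x 0) - m * Real.log (-x 1) := by
        rw [hτ, Real.log_div hHneg.ne hu.ne, hH]
        simp only [Real.log_neg_eq_log]
        rw [Real.log_rpow hw]
        rw [Real.log_neg_eq_log (x 1)]
        ring
      rw [Real.rpow_def_of_pos (neg_pos.2 hu), Real.rpow_def_of_pos hw,
        show (-x 0)⁻¹ = Real.exp (-Real.log (-x 0)) by rw [Real.exp_neg, Real.exp_log (neg_pos.2 hu)],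
        mul_assoc, ← Real.exp_add, ← Real.exp_add, neg_mul, mul_left_comm, ← Real.exp_add]
      congr 3
      have h2k : 2 - k ^ 2 ≠ 0 := by linarith
      have hmk : m * (2 - k ^ 2) = 4 := by rw [hm]; field_simp
      linear_combination (-1 / 2 - k ^ 2 / 4) * hlogτ - Real.log (-x 1) / 4 * hmk
    have hB' : B x = -x 0 * Real.exp (2 * s.φ τ) * s.S τ ^ 2 := by
      simp only [hB, hF₁, hF₃, if_neg hρ0.ne', ← hτ]
    have hC' : C x = -x 0 * Real.exp (-2 * s.φ τ) := by
      simp only [hC, hF₃, if_neg hρ0.ne', ← hτ]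
    change blockMetric (A x) (B x) (C x) = _
    rw [hA', hB', hC']
  · set D : Set Event := {x | x 0 < H (x 1) ∧ x 1 ≤ 0} with hD
    have hHle : ∀ x ∈ D, H (x 1) ≤ 0 := fun x hx =>
      neg_nonpos.2 (Real.rpow_nonneg (neg_nonneg.2 hx.2) m)
    have hu : ∀ x ∈ D, x 0 < 0 := fun x hx => hx.1.trans_le (hHle x hx)
    have c0 : ContinuousOn (fun x : Event => x 0) D := (continuous_apply 0).continuousOn
    have cρ : ContinuousOn (fun x : Event => H (x 1) / x 0) D :=
      (cH.comp (continuous_apply 1)).continuousOn.div c0 fun x hx => (hu x hx).ne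
    have hmaps : Set.MapsTo (fun x : Event => H (x 1) / x 0) D (Set.Ico 0 1) := fun x hx =>
      ⟨div_nonneg_of_nonpos (hHle x hx) (hu x hx).le, by
        show H (x 1) / x 0 < 1
        rw [div_lt_one_of_neg (hu x hx)]; exact hx.1⟩
    have k1 : ContinuousOn (fun x : Event => F₁ (H (x 1) / x 0)) D := e1.comp cρ hmaps
    have k2 : ContinuousOn (fun x : Event => F₂ (H (x 1) / x 0)) D := e2.comp cρ hmaps
    have k3 : ContinuousOn (fun x : Event => F₃ (H (x 1) / x 0)) D := e3.comp cρ hmaps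
    have hAc : ContinuousOn A D := ((continuousOn_const.mul (c0.neg.rpow_const fun x hx =>
      Or.inl (neg_pos.2 (hu x hx)).ne')).mul ((continuousOn_const.mul k2).add
        continuousOn_const).rexp).neg
    have hBc : ContinuousOn B D := (c0.neg.mul (continuousOn_const.mul k3).rexp).mul (k1.pow 2)
    have hCc : ContinuousOn C D := c0.neg.mul (continuousOn_const.mul k3).rexp
    exact continuous_blockMetric.comp_continuousOn (hAc.prodMk (hBc.prodMk hCc))
  · intro x hu hw
    have hu' : 0 < -x 0 := neg_pos.2 hu
    have hρ : H (x 1) / x 0 = 0 := by simp [hH, hw, hm0.ne']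
    have q1 : A x ≠ 0 := neg_ne_zero.2 (mul_pos (mul_pos hm0 (Real.rpow_pos_of_pos hu' _))
      (Real.exp_pos _)).ne'
    have q2 : B x ≠ 0 := by
      simp only [hB, hρ, hF₁, if_pos]
      positivity
    have q3 : C x ≠ 0 := by
      simp only [hC]
      positivity
    rw [blockMetric_det]
    exact neg_ne_zero.2 (mul_ne_zero (mul_ne_zero (pow_ne_zero 2 q1) q2) q3)

/-- The limits of R e^(-τ / 2), l - τ / 2 and φ give the radius and the extension. The affine rate
is bounded by a multiple of e^(-(1/2 - k²/4) τ), which is integrable as k² < 2. -/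
theorem IsMaximalSolution.case_three (h : IsMaximalSolution k V₀ l₀ φ₀ c₁ T s) (hk0 : k ≠ 0)
    (hk : k ^ 2 < 2) (hV : V₀ * Real.exp (lam k * l₀) < k ^ 2 / 8) :
    T = ⊤ ∧ RadiusFiniteNonzero s T ∧ PastNullConeIsRegular s ∧ ReachedInFiniteAffineTime s T := by
  have c := h.1.core
  obtain rfl := c.eq_top_of_expanding hk0 hk hV (h.isMaximalTime hk0)
  obtain ⟨⟨p, hp, hS⟩, ⟨a, ha⟩, C, ε, hε, hC⟩ := c.exists_asymptotics hk0 hk hV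
  have hS' : Tendsto s.S atTop (𝓝 p) := hS
  obtain ⟨b, hb⟩ := exists_tendsto_of_hasDerivAt_le_exp hε
    (fun τ hτ => h.1.deriv_φ (mem_openDom_top (one_pos.trans_le hτ))) hC
  refine ⟨rfl, fun u hu => ⟨|u| * p, mul_pos (abs_pos.2 hu.ne) hp, ?_⟩,
    h.1.pastNullConeIsRegular hk hp hS' ha hb, ?_⟩
  · rw [endFilter_top]
    exact hS'.const_mul |u|
  · obtain ⟨τ₁, h1, hle⟩ := exists_of_eventually h.1.pos
      (by rw [endFilter_top]; exact ha.eventually_le_const (lt_add_one a))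
    have hε : 0 < 1 / 2 - k ^ 2 / 4 := by linarith
    refine h.1.reachedInFiniteAffineTime h1 (B := 0)
      (G := fun t => -(Real.exp (k ^ 2 / 2 * (a + 1)) / (1 / 2 - k ^ 2 / 4) *
        Real.exp (-(1 / 2 - k ^ 2 / 4) * t)))
      (G' := fun t => Real.exp (k ^ 2 / 2 * (a + 1)) * Real.exp (-(1 / 2 - k ^ 2 / 4) * t))
      (fun t _ _ => ?_) (fun t ht h' => ?_) (fun t _ _ => ?_)
    · refine (((hasDerivAt_exp_mul (-(1 / 2 - k ^ 2 / 4)) t).const_mul _).neg).congr_deriv ?_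
      generalize (1 / 2 - k ^ 2 / 4) = ε at *
      field_simp
    · rw [← Real.exp_add]
      have := mul_le_mul_of_nonneg_left (hle t ht h') (show 0 ≤ k ^ 2 / 2 by positivity)
      exact Real.exp_le_exp.2 (by linarith)
    · have := Real.exp_pos (k ^ 2 / 2 * (a + 1))
      have := Real.exp_pos (-(1 / 2 - k ^ 2 / 4) * t)
      rw [neg_nonpos]
      positivity

end SelfSimilarCylinder


namespace SelfSimilarCylinder

/-! ### Sign conditions from the derivative at zeros -/

theorem nonpos_of_hasDerivAt_of_left {g : ℝ → ℝ} {d τ : ℝ} (h : HasDerivAt g d τ) (h0 : g τ = 0)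
    (hpos : ∀ᶠ s in 𝓝[<] τ, 0 ≤ g s) : d ≤ 0 := by
  have h1 : Tendsto (slope g τ) (𝓝[<] τ) (𝓝 d) := (hasDerivAt_iff_tendsto_slope.1 h).mono_left
    (nhdsWithin_mono τ fun s hs => ne_of_lt hs)
  refine le_of_tendsto h1 ?_
  filter_upwards [hpos, self_mem_nhdsWithin] with s hs hlt
  rw [slope_def_field, h0, sub_zero]
  exact div_nonpos_of_nonneg_of_nonpos hs (sub_nonpos.2 (le_of_lt hlt))

/-- A function that is positive near `0` and has positive derivative at its zeros is positive. -/
theorem pos_of_deriv_barrier {T : EReal} {g g' : ℝ → ℝ}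
    (hd : ∀ τ ∈ openDom T, HasDerivAt g (g' τ) τ) (h0 : ∀ᶠ t in 𝓝[>] (0 : ℝ), 0 < g t)
    (h : ∀ τ ∈ openDom T, (∀ s, 0 < s → s < τ → 0 < g s) → g τ = 0 → 0 < g' τ) {τ : ℝ}
    (hτ : τ ∈ openDom T) : 0 < g τ := by
  refine pos_of_barrier (fun t ht => (hd t ht).continuousAt.continuousWithinAt) h0
    (fun t ht hs => ?_) hτ
  have hev : ∀ᶠ s in 𝓝[<] t, 0 ≤ g s := by
    filter_upwards [Ioo_mem_nhdsLT ht.1] with s hs' using (hs s hs'.1 hs'.2).le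
  have hge : 0 ≤ g t :=
    ge_of_tendsto ((hd t ht).continuousAt.mono_left nhdsWithin_le_nhds) hev
  refine hge.lt_of_ne fun heq => ?_
  exact absurd (nonpos_of_hasDerivAt_of_left (hd t ht) heq.symm hev) (not_le.2 (h t ht hs heq.symm))

theorem pos_of_deriv_barrier_tail {T : EReal} {g g' : ℝ → ℝ} {τ₁ : ℝ} (h1 : τ₁ ∈ openDom T)
    (hd : ∀ τ ∈ openDom T, HasDerivAt g (g' τ) τ) (h0 : 0 < g τ₁)
    (h : ∀ τ ∈ openDom T, τ₁ ≤ τ → (∀ s, τ₁ ≤ s → s < τ → 0 < g s) → g τ = 0 → 0 < g' τ) {τ : ℝ}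
    (hτ : τ ∈ openDom T) (hle : τ₁ ≤ τ) : 0 < g τ := by
  have hc : ContinuousOn g (openDom T) := fun t ht => (hd t ht).continuousAt.continuousWithinAt
  have hm : ∀ t ∈ openDom T, max t τ₁ ∈ openDom T := fun t ht => by
    rcases le_total t τ₁ with h | h
    · rwa [max_eq_right h]
    · rwa [max_eq_left h]
  -- Freezing g to the left of τ₁ at its value g(τ₁) > 0 reduces the statement to a barrier starting
  -- at the axis.
  have key := pos_of_barrier (T := T) (g := fun t => g (max t τ₁)) (τ := τ)
    (hc.comp (Continuous.continuousOn (by fun_prop)) hm) (by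
      filter_upwards [Ioo_mem_nhdsGT h1.1] with t ht
      rwa [max_eq_right ht.2.le]) (fun t ht hs => ?_) hτ
  · simpa [max_eq_left hle] using key
  · rcases le_or_gt t τ₁ with h' | h'
    · rwa [max_eq_right h']
    rw [max_eq_left h'.le]
    have hs' : ∀ s, τ₁ ≤ s → s < t → 0 < g s := fun s h2 h3 => by
      simpa [max_eq_left h2] using hs s (h1.1.trans_le h2) h3
    have hev : ∀ᶠ s in 𝓝[<] t, 0 ≤ g s := by
      filter_upwards [Ioo_mem_nhdsLT h'] with s hs using (hs' s hs.1.le hs.2).le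
    have hge : 0 ≤ g t :=
      ge_of_tendsto ((hd t ht).continuousAt.mono_left nhdsWithin_le_nhds) hev
    refine hge.lt_of_ne fun heq => ?_
    exact absurd (nonpos_of_hasDerivAt_of_left (hd t ht) heq.symm hev)
      (not_le.2 (h t ht h'.le hs' heq.symm))

variable {k V₀ l₀ φ₀ c₁ : ℝ} {T : EReal} {s : Fields} {R x l y : ℝ → ℝ}

namespace Core

/-! ### Collapse -/

theorem exp_pos_W (hV : 0 < V₀) (r : ℝ) : 0 < V₀ * Real.exp (lam k * r) :=
  mul_pos hV (Real.exp_pos _)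

/-- The function `(R' + R / 2) e ^ (-τ / 2)` decreases if the potential is positive. -/
theorem antitoneOn_add_half (c : Core k V₀ l₀ T R x l y) (hV : 0 < V₀) :
    AntitoneOn (fun τ => (x τ + R τ / 2) * Real.exp (-(1 / 2) * τ)) (openDom T) :=
  antitoneOn_of_hasDerivAt (ordConnected_openDom T)
    (fun t ht => ((c.dx t ht).add ((c.dR t ht).div_const 2)).mul (hasDerivAt_exp_mul (-(1 / 2)) t))
    fun t ht => by
      have h1 := mul_pos (mul_pos (exp_pos_W (k := k) hV (l t)) (c.R_pos t ht))
        (Real.exp_pos (-(1 / 2) * t))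
      change _ * Real.exp (-(1 / 2) * t) + (x t + R t / 2) * _ ≤ 0
      linarith

/-- By the monotonicity above x + R/2 ≤ e^(τ / 2), and R e^(τ / 2) has derivative (x + R/2) e^(τ /
2) ≤ e^τ. -/
theorem R_le_exp (c : Core k V₀ l₀ T R x l y) (hV : 0 < V₀) {τ : ℝ} (hτ : τ ∈ openDom T) :
    R τ ≤ Real.exp τ := by
  have h1 : ∀ t ∈ openDom T, (x t + R t / 2) * Real.exp (-(1 / 2) * t) ≤ 1 := fun t ht => by
    have h2 : Tendsto (fun t => (x t + R t / 2) * Real.exp (-(1 / 2) * t)) (𝓝[>] 0) (𝓝 1) := by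
      simpa using (c.x_lim.add (c.R_lim.div_const 2)).mul (tendsto_nhdsGT_zero
        (show Continuous fun t => Real.exp (-(1 / 2) * t) by fun_prop) rfl)
    refine ge_of_tendsto h2 ?_
    filter_upwards [Ioo_mem_nhdsGT ht.1] with s hs
    exact c.antitoneOn_add_half hV (mem_openDom_of_le ht hs.1 hs.2.le) ht hs.2.le
  have h2 : R τ * Real.exp (1 / 2 * τ) - Real.exp (1 * τ) ≤ 0 * Real.exp (1 / 2 * 0) -
      Real.exp (1 * 0) :=
    ge_of_hasDerivAt_nonpos (fun t ht => ((c.dR t ht).mul (hasDerivAt_exp_mul (1 / 2) t)).sub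
      (hasDerivAt_exp_mul 1 t)) (fun t ht => by
        have e1 := mul_le_mul_of_nonneg_left (h1 t ht) (Real.exp_pos (1 * t)).le
        have e2 : Real.exp (1 * t) * Real.exp (-(1 / 2) * t) = Real.exp (1 / 2 * t) := by
          rw [← Real.exp_add]; ring_nf
        have e3 : Real.exp (1 * t) * ((x t + R t / 2) * Real.exp (-(1 / 2) * t)) =
          (x t + R t / 2) * Real.exp (1 / 2 * t) := by rw [← e2]; ring
        linarith) ((c.R_lim.mul (tendsto_nhdsGT_zero
          (show Continuous fun t => Real.exp (1 / 2 * t) by fun_prop) rfl)).sub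
          (tendsto_nhdsGT_zero (show Continuous fun t => Real.exp (1 * t) by fun_prop) rfl)) hτ
  have h3 := Real.one_le_exp (show 0 ≤ 1 / 2 * τ by linarith [hτ.1])
  have h4 := c.R_pos τ hτ
  rw [zero_mul, mul_zero, Real.exp_zero, one_mul] at h2
  nlinarith

/-- A solution with `R' + R / 2 < 0` at some time ends in finite time. -/
theorem false_of_add_half_neg (c : Core k V₀ l₀ ⊤ R x l y) (hV : 0 < V₀) {τ₁ : ℝ} (h1 : 0 < τ₁)
    (h : x τ₁ + R τ₁ / 2 < 0) : False := by
  have mem : ∀ τ ∈ Set.Ici τ₁, τ ∈ openDom ⊤ := fun τ hτ => mem_openDom_top (h1.trans_le hτ)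
  set δ := -((x τ₁ + R τ₁ / 2) * Real.exp (-(1 / 2) * τ₁)) with hδ
  have hδ0 : 0 < δ := neg_pos.2 (mul_neg_of_neg_of_pos h (Real.exp_pos _))
  have m := antitoneOn_of_hasDerivAt Set.ordConnected_Ici
    (fun τ hτ => ((c.dR τ (mem τ hτ)).mul (hasDerivAt_exp_mul (1 / 2) τ)).add
      ((hasDerivAt_id τ).const_mul δ)) (fun τ hτ => by
        have e0 : (x τ + R τ / 2) * Real.exp (-(1 / 2) * τ) ≤ -δ := by
          rw [hδ, neg_neg]
          exact c.antitoneOn_add_half hV (mem_openDom_top h1) (mem τ hτ) hτ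
        have e2 : Real.exp (1 * τ) * Real.exp (-(1 / 2) * τ) = Real.exp (1 / 2 * τ) := by
          rw [← Real.exp_add]; ring_nf
        have e1 := mul_le_mul_of_nonneg_left e0 (Real.exp_pos (1 * τ)).le
        have e3 : Real.exp (1 * τ) * ((x τ + R τ / 2) * Real.exp (-(1 / 2) * τ)) =
          (x τ + R τ / 2) * Real.exp (1 / 2 * τ) := by rw [← e2]; ring
        have e4 := mul_le_mul_of_nonneg_right (Real.one_le_exp (show 0 ≤ 1 * τ by
          linarith [(mem τ hτ).1])) hδ0.le
        linarith)
  set τ₂ := τ₁ + R τ₁ * Real.exp (1 / 2 * τ₁) / δ with hτ₂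
  have hR := c.R_pos τ₁ (mem_openDom_top h1)
  have h12 : τ₁ ≤ τ₂ := le_add_of_nonneg_right (by positivity)
  have e : R τ₂ * Real.exp (1 / 2 * τ₂) + δ * τ₂ ≤ R τ₁ * Real.exp (1 / 2 * τ₁) + δ * τ₁ :=
    m Set.self_mem_Ici h12 h12
  have e1 : δ * τ₂ = δ * τ₁ + R τ₁ * Real.exp (1 / 2 * τ₁) := by
    rw [hτ₂]; field_simp
  have e2 := mul_pos (c.R_pos τ₂ (mem τ₂ h12)) (Real.exp_pos (1 / 2 * τ₂))
  linarith

/-- A positive function on a half line with a uniformly negative derivative. -/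
theorem false_of_deriv_le {f f' : ℝ → ℝ} {τ₁ δ : ℝ} (hδ : 0 < δ)
    (hd : ∀ τ, τ₁ ≤ τ → HasDerivAt f (f' τ) τ) (hle : ∀ τ, τ₁ ≤ τ → f' τ ≤ -δ) {b : ℝ}
    (hb : ∀ τ, τ₁ ≤ τ → b ≤ f τ) : False := by
  have m := antitoneOn_of_hasDerivAt (D := Set.Ici τ₁) Set.ordConnected_Ici
    (fun τ hτ => (hd τ hτ).add ((hasDerivAt_id τ).const_mul δ)) (fun τ hτ => by
      have := hle τ hτ; linarith)
  set τ₂ := τ₁ + (f τ₁ - b + 1) / δ with hτ₂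
  have h0 := hb τ₁ le_rfl
  have h12 : τ₁ ≤ τ₂ := le_add_of_nonneg_right (div_nonneg (by linarith) hδ.le)
  have e : f τ₂ + δ * τ₂ ≤ f τ₁ + δ * τ₁ := m Set.self_mem_Ici h12 h12
  have e1 : δ * τ₂ = δ * τ₁ + (f τ₁ - b + 1) := by rw [hτ₂]; field_simp
  linarith [hb τ₂ h12]

theorem monotoneOn_R_of_nonneg (c : Core k V₀ l₀ T R x l y) {τ₁ : ℝ} (h1 : τ₁ ∈ openDom T)
    (hx : ∀ τ ∈ openDom T, τ₁ ≤ τ → 0 ≤ x τ) {τ : ℝ} (hτ : τ ∈ openDom T) (h : τ₁ ≤ τ) :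
    R τ₁ ≤ R τ :=
  monotoneOn_of_hasDerivAt (ordConnected_tail T τ₁) (fun t ht => c.dR t ht.1)
    (fun t ht => hx t ht.1 ht.2) ⟨h1, le_rfl⟩ ⟨hτ, h⟩ h

/-- On a bounded maximal interval the radius cannot be nondecreasing, if the potential is
positive. -/
theorem exists_x_neg_of_lt_top (c : Core k V₀ l₀ T R x l y) (hk : k ≠ 0) (hV : 0 < V₀)
    (hmax : IsMaximalTime k V₀ l₀ T) (hT : T < ⊤) : ∃ τ ∈ openDom T, x τ < 0 := by
  obtain rfl | ⟨t, ht, rfl⟩ := eq_top_or_eq_coe c.pos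
  · exact absurd hT (lt_irrefl _)
  by_contra! hx
  obtain ⟨τ₁, h1⟩ := exists_mem_openDom c.pos
  refine c.not_bounded hk hmax rfl h1 (c.R_pos _ h1) (b := Real.exp t) fun τ hτ => ?_
  have hm : τ ∈ openDom (t : EReal) := ⟨h1.1.trans_le hτ.1, by exact_mod_cast hτ.2⟩
  exact ⟨c.monotoneOn_R_of_nonneg h1 (fun τ hτ _ => hx τ hτ) hm hτ.1,
    (c.R_le_exp hV hm).trans (Real.exp_le_exp.2 hτ.2.le)⟩

/-- R decreases, and a positive limit at a finite end would permit continuation. -/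
theorem tendsto_R_zero (c : Core k V₀ l₀ T R x l y) (hk : k ≠ 0)
    (hmax : IsMaximalTime k V₀ l₀ T) (hT : T < ⊤) {τ₁ : ℝ} (h1 : τ₁ ∈ openDom T)
    (hx : ∀ τ ∈ openDom T, τ₁ ≤ τ → x τ < 0) : Tendsto R (endFilter T) (𝓝 0) := by
  have m := antitoneOn_of_hasDerivAt (ordConnected_tail T τ₁) (fun t ht => c.dR t ht.1)
    fun t ht => (hx t ht.1 ht.2).le
  obtain ⟨a, ha, hle⟩ := exists_tendsto_endFilter_of_antitoneOn (B := 0) h1 m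
    fun τ hτ _ => (c.R_pos τ hτ).le
  rcases le_or_gt a 0 with h | h
  · have hne := endFilter_neBot c.pos
    have : 0 ≤ a := ge_of_tendsto ha ((eventually_mem_openDom c.pos).mono fun τ hτ =>
      (c.R_pos τ hτ).le)
    rwa [le_antisymm h this] at ha
  · obtain rfl | ⟨t, ht, rfl⟩ := eq_top_or_eq_coe c.pos
    · exact absurd hT (lt_irrefl _)
    refine (c.not_bounded hk hmax rfl h1 h (b := R τ₁) fun τ hτ => ?_).elim
    have hm : τ ∈ openDom (t : EReal) := ⟨h1.1.trans_le hτ.1, by exact_mod_cast hτ.2⟩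
    exact ⟨hle τ hm hτ.1, m ⟨h1, le_rfl⟩ ⟨hm, hτ.1⟩ hτ.1⟩

/-! ### Collapse for `λ ≤ 0` -/

theorem l_le_of_y_nonpos (c : Core k V₀ l₀ T R x l y) {τ : ℝ} (hτ : τ ∈ openDom T)
    (h : ∀ s, 0 < s → s < τ → y s ≤ 0) : l τ ≤ l₀ := by
  have m := antitoneOn_of_hasDerivAt (Set.ordConnected_Ioo (a := 0) (b := τ))
    (fun t ht => c.dl t (mem_openDom_of_le hτ ht.1 ht.2.le))
    fun t ht => div_nonpos_of_nonpos_of_nonneg (h t ht.1 ht.2)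
      (c.R_pos t (mem_openDom_of_le hτ ht.1 ht.2.le)).le
  have h1 : ∀ t ∈ Set.Ioo 0 τ, l t ≤ l₀ := fun t ht => ge_of_tendsto c.l_lim (by
    filter_upwards [Ioo_mem_nhdsGT ht.1] with r hr
    exact m ⟨hr.1, hr.2.trans ht.2⟩ ht hr.2.le)
  have h2 : Tendsto l (𝓝[<] τ) (𝓝 (l τ)) := (c.dl τ hτ).continuousAt.mono_left nhdsWithin_le_nhds
  exact le_of_tendsto h2 (by
    filter_upwards [Ioo_mem_nhdsLT hτ.1] with r hr using h1 r hr)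

/-- The sign of `y` near the axis. -/
theorem eventually_sign_y (c : Core k V₀ l₀ T R x l y) (hk0 : k ≠ 0) {σ : ℝ}
    (hσ : 0 < σ * (k ^ 2 / 8 - V₀ * Real.exp (lam k * l₀))) : ∀ᶠ t in 𝓝[>] (0 : ℝ), 0 < σ * y t := by
  have hk2 : 0 < k ^ 2 := by positivity
  have h0 : 0 < σ * ((1 / 4 - 2 / k ^ 2 * V₀ * Real.exp (lam k * l₀)) / 2) := by
    have : σ * ((1 / 4 - 2 / k ^ 2 * V₀ * Real.exp (lam k * l₀)) / 2) =
      1 / k ^ 2 * (σ * (k ^ 2 / 8 - V₀ * Real.exp (lam k * l₀))) := by field_simp; ring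
    rw [this]
    positivity
  filter_upwards [(c.y_div_sq_lim.const_mul σ).eventually_const_lt h0, c.eventually_mem] with t ht hm
  rw [← mul_div_assoc] at ht
  exact (div_pos_iff_of_pos_right (pow_pos (c.R_pos t hm) 2)).1 ht

/-- If `k² ≤ 2` and `V₀ e ^ (λ l₀) > k² / 8`, then `l` decreases and the potential increases. -/
theorem contracting (c : Core k V₀ l₀ T R x l y) (hk0 : k ≠ 0) (hk : k ^ 2 ≤ 2) (hV0 : 0 < V₀)
    (hV : k ^ 2 / 8 < V₀ * Real.exp (lam k * l₀)) :
    ∃ δ, 0 < δ ∧ ∀ τ ∈ openDom T, y τ < 0 ∧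
      1 / 4 - 2 / k ^ 2 * V₀ * Real.exp (lam k * l τ) ≤ -δ := by
  have hl : lam k ≤ 0 := by rw [lam]; linarith
  have hk2 : 0 < k ^ 2 := by positivity
  set δ := 2 / k ^ 2 * (V₀ * Real.exp (lam k * l₀) - k ^ 2 / 8) with hδ
  have hδ0 : 0 < δ := mul_pos (by positivity) (by linarith)
  have hW : ∀ r, r ≤ l₀ → 1 / 4 - 2 / k ^ 2 * V₀ * Real.exp (lam k * r) ≤ -δ := fun r hr => by
    have e : Real.exp (lam k * l₀) ≤ Real.exp (lam k * r) :=
      Real.exp_le_exp.2 (mul_le_mul_of_nonpos_left hr hl)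
    have e1 : 2 / k ^ 2 * (V₀ * Real.exp (lam k * l₀)) ≤ 2 / k ^ 2 * (V₀ * Real.exp (lam k * r)) := by
      gcongr
    have e2 : 2 / k ^ 2 * (k ^ 2 / 8) = 1 / 4 := by field_simp; norm_num
    rw [hδ, mul_sub, e2, mul_assoc]
    linarith
  have hy : ∀ τ ∈ openDom T, 0 < -1 * y τ := by
    intro τ hτ
    refine pos_of_barrier (g := fun τ => -1 * y τ) (continuousOn_const.mul c.continuousOn_y)
      (c.eventually_sign_y hk0 (by linarith)) (fun τ hτ h => ?_) hτ
    have m : StrictAntiOn y (Set.Ioc 0 τ) := strictAntiOn_of_hasDerivAt Set.ordConnected_Ioc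
      (fun t ht => c.dy t (mem_openDom_of_le hτ ht.1 ht.2)) fun t ht => by
        have hm := mem_openDom_of_le hτ ht.1 ht.2
        have := hW _ (c.l_le_of_y_nonpos hm fun s hs hst => by linarith [h s hs (hst.trans_le ht.2)])
        exact mul_neg_of_neg_of_pos (by linarith) (c.R_pos t hm)
    have h2 : 0 < τ / 2 := half_pos hτ.1
    have h3 := h _ h2 (half_lt_self hτ.1)
    have h4 := m ⟨h2, half_le_self hτ.1.le⟩ ⟨hτ.1, le_rfl⟩ (half_lt_self hτ.1)
    linarith
  refine ⟨δ, hδ0, fun τ hτ => ⟨by linarith [hy τ hτ], hW _ (c.l_le_of_y_nonpos hτ fun s hs hst => ?_)⟩⟩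
  linarith [hy s (mem_openDom_of_le hτ hs hst.le)]

theorem monotoneOn_W (c : Core k V₀ l₀ T R x l y) (hV : 0 < V₀)
    (h : ∀ τ ∈ openDom T, 0 ≤ lam k * y τ) :
    MonotoneOn (fun τ => V₀ * Real.exp (lam k * l τ)) (openDom T) :=
  monotoneOn_of_hasDerivAt (ordConnected_openDom T) (fun _ ht => c.dW ht) fun t ht => by
    have := mul_nonneg (exp_pos_W (k := k) hV (l t)).le (div_nonneg (h t ht) (c.R_pos t ht).le)
    refine this.trans (le_of_eq ?_)
    ring

/-- If W ever exceeds 1/4, then R is concave from then on and cannot stay positive. Otherwise R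
keeps growing, y' ≤ -δ R pushes l down at a linear rate, and for λ < 0 this makes W unbounded. For λ
= 0 the hypothesis itself is W > 1/4. -/
theorem lt_top_of_contracting (c : Core k V₀ l₀ T R x l y) (hk0 : k ≠ 0) (hk : k ^ 2 ≤ 2)
    (hV0 : 0 < V₀) (hV : k ^ 2 / 8 < V₀ * Real.exp (lam k * l₀)) : T < ⊤ := by
  rw [lt_top_iff_ne_top]
  rintro rfl
  obtain ⟨δ, hδ, hy⟩ := c.contracting hk0 hk hV0 hV
  have hl : lam k ≤ 0 := by rw [lam]; linarith
  have mW := c.monotoneOn_W hV0 fun τ hτ => mul_nonneg_of_nonpos_of_nonpos hl (hy τ hτ).1.le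
  by_cases hbig : ∃ τ ∈ openDom ⊤, 1 / 4 < V₀ * Real.exp (lam k * l τ)
  · obtain ⟨τ₀, h0, hw⟩ := hbig
    have mem : ∀ τ, τ₀ ≤ τ → τ ∈ openDom ⊤ := fun τ hτ => mem_openDom_top (h0.1.trans_le hτ)
    have hmono : ∀ τ, τ₀ ≤ τ → V₀ * Real.exp (lam k * l τ₀) ≤ V₀ * Real.exp (lam k * l τ) :=
      fun τ hτ => mW h0 (mem τ hτ) hτ
    have ax : AntitoneOn x (Set.Ici τ₀) := antitoneOn_of_hasDerivAt Set.ordConnected_Ici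
      (fun t ht => c.dx t (mem t ht)) fun t ht => mul_nonpos_of_nonpos_of_nonneg
        (by linarith [hmono t ht]) (c.R_pos t (mem t ht)).le
    have hx : ∀ τ, τ₀ ≤ τ → 0 ≤ x τ := by
      intro τ hτ
      by_contra! hneg
      exact false_of_deriv_le (neg_pos.2 hneg)
        (fun t (ht : τ ≤ t) => c.dR t (mem t (hτ.trans ht))) (fun t ht => by
          rw [neg_neg]; exact ax hτ (hτ.trans ht) ht) fun t ht => (c.R_pos t (mem t (hτ.trans ht))).le
    refine false_of_deriv_le (mul_pos (sub_pos.2 hw) (c.R_pos τ₀ h0)) (fun t ht => c.dx t (mem t ht))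
      (fun t ht => ?_) hx
    have h1 := c.monotoneOn_R_of_nonneg h0 (fun τ _ => hx τ) (mem t ht) ht
    have h2 := mul_le_mul_of_nonneg_left h1 (sub_pos.2 hw).le
    have h3 := mul_le_mul_of_nonneg_right (hmono t ht) (c.R_pos t (mem t ht)).le
    linarith
  · push Not at hbig
    have hx : ∀ τ ∈ openDom ⊤, 1 ≤ x τ := fun τ hτ => c.one_le_x_of_le hbig hτ
    have hX : ∀ τ ∈ openDom ⊤, x τ ^ 2 - 1 / 4 * R τ ^ 2 ≤ 1 := by
      intro τ hτ
      have : x τ ^ 2 - 1 / 4 * R τ ^ 2 ≤ 1 ^ 2 - 1 / 4 * 0 ^ 2 :=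
        ge_of_hasDerivAt_nonpos (fun t ht => (hasDerivAt_sq (c.dx t ht)).sub
          ((hasDerivAt_sq (c.dR t ht)).const_mul (1 / 4))) (fun t ht => by
            have := mul_pos (mul_pos (exp_pos_W (k := k) hV0 (l t)) (c.R_pos t ht))
              (one_pos.trans_le (hx t ht))
            linarith) ((c.x_lim.pow 2).sub ((c.R_lim.pow 2).const_mul (1 / 4))) hτ
      linarith
    have mem : ∀ τ, 1 ≤ τ → τ ∈ openDom ⊤ := fun τ hτ => mem_openDom_top (one_pos.trans_le hτ)
    -- Here x ≤ 2 R while y' ≤ -δ R, so y + (δ/4) R decreases. Thus l' = y / R is eventually at most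
    -- -δ/8.
    have m := antitoneOn_of_hasDerivAt Set.ordConnected_Ici
      (fun τ (hτ : τ ∈ Set.Ici 1) => (c.dy τ (mem τ hτ)).add ((c.dR τ (mem τ hτ)).const_mul (δ / 4)))
      fun τ hτ => by
        have h1 := c.le_R hx (mem τ hτ)
        have h2 : 1 ≤ R τ := le_trans hτ h1
        have h3 := hX τ (mem τ hτ)
        have h4 : x τ ≤ 2 * R τ := abs_le_of_sq_le_sq' (by nlinarith) (by linarith) |>.2
        have h5 := mul_le_mul_of_nonneg_left h4 hδ.le
        have h6 := mul_le_mul_of_nonneg_right (hy τ (mem τ hτ)).2 (c.R_pos τ (mem τ hτ)).le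
        have h7 := mul_pos hδ (c.R_pos τ (mem τ hτ))
        linarith
    set C := y 1 + δ / 4 * R 1 with hC
    set τ₁ := max 1 (8 * |C| / δ) with hτ₁
    have h1 : ∀ τ, τ₁ ≤ τ → 1 ≤ τ := fun τ hτ => (le_max_left _ _).trans hτ
    have hrate : ∀ τ, τ₁ ≤ τ → y τ / R τ ≤ -(δ / 8) := by
      intro τ hτ
      have hm := mem τ (h1 τ hτ)
      have e1 : y τ + δ / 4 * R τ ≤ C := m Set.self_mem_Ici (h1 τ hτ) (h1 τ hτ)
      have e2 : 8 * |C| / δ ≤ R τ := ((le_max_right _ _).trans hτ).trans (c.le_R hx hm)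
      rw [div_le_iff₀ hδ] at e2
      rw [div_le_iff₀ (c.R_pos τ hm)]
      linarith [le_abs_self C]
    rcases hl.lt_or_eq with hl | hl
    -- The lower bound for l is W ≤ 1/4 solved for l, with λ < 0 reversing the inequality.
    · refine false_of_deriv_le (b := Real.log (1 / (4 * V₀)) / lam k) (half_pos (half_pos (half_pos hδ)))
        (fun τ hτ => c.dl τ (mem τ (h1 τ hτ))) (fun τ hτ => by linarith [hrate τ hτ])
        fun τ hτ => ?_
      rw [div_le_iff_of_neg hl, mul_comm, Real.le_log_iff_exp_le (by positivity), le_div_iff₀ (by positivity)]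
      linarith [hbig τ (mem τ (h1 τ hτ))]
    · have hk2 : k ^ 2 = 2 := by rw [lam] at hl; linarith
      have := hbig 1 (mem 1 le_rfl)
      rw [hl, zero_mul] at this
      rw [hl, zero_mul, hk2] at hV
      linarith

/-- The finite lifetime forces x < 0 at some time. From then on W ≥ 1/4, so x decreases further, and
y decreases throughout, which keeps it below its negative value at that time. -/
theorem exists_collapse_of_contracting (c : Core k V₀ l₀ T R x l y) (hk0 : k ≠ 0) (hk : k ^ 2 ≤ 2)
    (hV0 : 0 < V₀) (hV : k ^ 2 / 8 < V₀ * Real.exp (lam k * l₀))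
    (hmax : IsMaximalTime k V₀ l₀ T) : ∃ τ₁ ∈ openDom T, ∃ η, 0 < η ∧
      ∀ τ ∈ openDom T, τ₁ ≤ τ → x τ < 0 ∧ l τ ≤ l₀ ∧ y τ ≤ -η := by
  obtain ⟨δ, hδ, hy⟩ := c.contracting hk0 hk hV0 hV
  have hl : lam k ≤ 0 := by rw [lam]; linarith
  have mW := c.monotoneOn_W hV0 fun τ hτ => mul_nonneg_of_nonpos_of_nonpos hl (hy τ hτ).1.le
  obtain ⟨τ₁, h1, hx⟩ := c.exists_x_neg_of_lt_top hk0 hV0 hmax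
    (c.lt_top_of_contracting hk0 hk hV0 hV)
  -- Otherwise W, being monotone, was below 1/4 all the way from the axis, and x would have
  -- increased from 1.
  have hw : 1 / 4 ≤ V₀ * Real.exp (lam k * l τ₁) := by
    by_contra! hlt
    have m : MonotoneOn x (Set.Ioc 0 τ₁) := monotoneOn_of_hasDerivAt Set.ordConnected_Ioc
      (fun t ht => c.dx t (mem_openDom_of_le h1 ht.1 ht.2)) fun t ht => by
        have hm := mem_openDom_of_le h1 ht.1 ht.2
        have h2 : V₀ * Real.exp (lam k * l t) ≤ V₀ * Real.exp (lam k * l τ₁) := mW hm h1 ht.2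
        exact mul_nonneg (by linarith) (c.R_pos t hm).le
    have : 1 ≤ x τ₁ := le_of_tendsto c.x_lim (by
      filter_upwards [Ioo_mem_nhdsGT h1.1] with t ht using m ⟨ht.1, ht.2.le⟩ ⟨h1.1, le_rfl⟩ ht.2.le)
    linarith
  refine ⟨τ₁, h1, -y τ₁, neg_pos.2 (hy τ₁ h1).1, fun τ hτ h => ⟨?_, ?_, ?_⟩⟩
  · refine lt_of_le_of_lt ?_ hx
    exact antitoneOn_of_hasDerivAt (ordConnected_tail T τ₁) (fun t ht => c.dx t ht.1)
      (fun t ht => by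
        have h2 : V₀ * Real.exp (lam k * l τ₁) ≤ V₀ * Real.exp (lam k * l t) := mW h1 ht.1 ht.2
        exact mul_nonpos_of_nonpos_of_nonneg (by linarith) (c.R_pos t ht.1).le)
      ⟨h1, le_rfl⟩ ⟨hτ, h⟩ h
  · exact c.l_le_of_y_nonpos hτ fun s hs hst => (hy s (mem_openDom_of_le hτ hs hst.le)).1.le
  · rw [neg_neg]
    exact antitoneOn_of_hasDerivAt (ordConnected_tail T τ₁) (fun t ht => c.dy t ht.1)
      (fun t ht => mul_nonpos_of_nonpos_of_nonneg (by linarith [(hy t ht.1).2]) (c.R_pos t ht.1).le)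
      ⟨h1, le_rfl⟩ ⟨hτ, h⟩ h

end Core

end SelfSimilarCylinder


namespace SelfSimilarCylinder

variable {k V₀ l₀ φ₀ c₁ : ℝ} {T : EReal} {s : Fields} {R x l y : ℝ → ℝ}

namespace Core

/-! ### Collapse for `λ > 0` -/

/-- If `k² ≥ 2`, the radius keeps decreasing once it decreases. -/
theorem x_neg_of_x_neg (c : Core k V₀ l₀ T R x l y) (hk : 2 ≤ k ^ 2) {τ₁ : ℝ}
    (h1 : τ₁ ∈ openDom T) (hx : x τ₁ < 0) {τ : ℝ} (hτ : τ ∈ openDom T) (h : τ₁ ≤ τ) : x τ < 0 := by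
  have hk0 : k ≠ 0 := by rintro rfl; norm_num at hk
  refine neg_pos.1 (pos_of_deriv_barrier_tail h1 (fun t ht => (c.dx t ht).neg) (neg_pos.2 hx)
    (fun t ht _ _ h0 => ?_) hτ h)
  have h0' : x t = 0 := neg_eq_zero.1 h0
  have e := c.constraint hk0 ht
  rw [h0'] at e
  have hR := c.R_pos t ht
  -- At x = 0 the constraint reads 2 W R² = 1 + k² y² / 2 + (2 + k²) R² / 8, and k² ≥ 2 gives W >
  -- 1/4.
  have h2 : 0 < (V₀ * Real.exp (lam k * l t) - 1 / 4) * R t ^ 2 := by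
    have h3 : 0 ≤ k ^ 2 / 2 * y t ^ 2 := by positivity
    have h4 : 4 / 8 * R t ^ 2 ≤ (2 + k ^ 2) / 8 * R t ^ 2 := by gcongr; linarith
    linarith
  have h3 := (pos_iff_pos_of_mul_pos h2).2 (pow_pos hR 2)
  rw [neg_pos]
  exact mul_neg_of_neg_of_pos (by linarith) hR

/-- While R' ≥ 0, the energy l'²/2 - l/4 + 2 W / (k² λ) decreases by friction, which bounds l above.
R does not decrease, so Z falls below -1. Then R e^(-k² l / 2), whose derivative is Z e^(-k² l / 2),
would become negative. -/
theorem false_of_nonneg (c : Core k V₀ l₀ ⊤ R x l y) (hk : 2 < k ^ 2) (hV : 0 < V₀)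
    (hx : ∀ τ ∈ openDom ⊤, 0 ≤ x τ) : False := by
  have hk0 : k ≠ 0 := by rintro rfl; norm_num at hk
  have hl : 0 < lam k := by rw [lam]; linarith
  have mem : ∀ τ, 1 ≤ τ → τ ∈ openDom ⊤ := fun τ hτ => mem_openDom_top (one_pos.trans_le hτ)
  have m : AntitoneOn (fun t => (y t / R t) ^ 2 / 2 - l t / 4 +
      2 / (k ^ 2 * lam k) * (V₀ * Real.exp (lam k * l t))) (openDom ⊤) :=
    antitoneOn_of_hasDerivAt (ordConnected_openDom ⊤)
      (fun t ht => (((hasDerivAt_sq (c.dY ht)).div_const 2).sub ((c.dl t ht).div_const 4)).add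
        ((c.dW ht).const_mul (2 / (k ^ 2 * lam k)))) fun t ht => by
      have h1 := mul_nonneg (div_nonneg (hx t ht) (c.R_pos t ht).le) (sq_nonneg (y t / R t))
      have e1 : 2 / (k ^ 2 * lam k) * (lam k * (V₀ * Real.exp (lam k * l t)) * (y t / R t)) =
          2 / k ^ 2 * V₀ * Real.exp (lam k * l t) * (y t / R t) := by
        field_simp
      rw [e1]
      linarith
  set C := (y 1 / R 1) ^ 2 / 2 - l 1 / 4 + 2 / (k ^ 2 * lam k) * (V₀ * Real.exp (lam k * l 1))
  set q := V₀ * lam k / k ^ 2 with hq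
  have hq0 : 0 < q := by positivity
  -- Beyond L the bound e^s ≥ s²/2 makes the potential energy at least q l², which exceeds l/4 + C.
  set L := 1 + (1 / 4 + |C|) / q with hL
  have hle : ∀ τ, 1 ≤ τ → l τ ≤ L := by
    intro τ hτ
    by_contra! hlt
    have e1 : (y τ / R τ) ^ 2 / 2 - l τ / 4 +
      2 / (k ^ 2 * lam k) * (V₀ * Real.exp (lam k * l τ)) ≤ C := m (mem 1 le_rfl) (mem τ hτ) hτ
    have h0 : 0 ≤ (1 / 4 + |C|) / q := by positivity
    have h1 : 1 < l τ := by linarith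
    have h2 : (1 / 4 + |C|) / q < l τ := by linarith
    rw [div_lt_iff₀ hq0] at h2
    have h3 := Real.quadratic_le_exp_of_nonneg (show 0 ≤ lam k * l τ by positivity)
    have h4 : 2 / (k ^ 2 * lam k) * (V₀ * ((lam k * l τ) ^ 2 / 2)) ≤
        2 / (k ^ 2 * lam k) * (V₀ * Real.exp (lam k * l τ)) := by
      gcongr
      have : 0 ≤ lam k * l τ := by positivity
      linarith
    have h5 : 2 / (k ^ 2 * lam k) * (V₀ * ((lam k * l τ) ^ 2 / 2)) = l τ * q * l τ := by
      rw [hq]; field_simp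
    have h6 : (1 / 4 + |C|) * l τ ≤ l τ * q * l τ := by gcongr
    have h7 : |C| * 1 < |C| * l τ + 1 := by nlinarith [abs_nonneg C]
    have h8 : |C| * 1 ≤ |C| * l τ := by gcongr
    have h9 : (1 / 4 + |C|) * l τ < l τ * q * l τ := by gcongr
    linarith [sq_nonneg (y τ / R τ), le_abs_self C]
  have hRmono := fun τ hτ => c.monotoneOn_R_of_nonneg (mem 1 le_rfl) (fun τ hτ _ => hx τ hτ)
    (mem τ hτ) hτ
  set δ := lam k / 4 * R 1 with hδ
  have hδ0 : 0 < δ := by have := c.R_pos 1 (mem 1 le_rfl); positivity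
  obtain ⟨τ₂, h2, hZ⟩ : ∃ τ₂, 1 ≤ τ₂ ∧ x τ₂ - k ^ 2 / 2 * y τ₂ < -1 := by
    by_contra! hcon
    refine false_of_deriv_le hδ0 (fun τ hτ => c.dZ hk0 (mem τ hτ)) (fun τ hτ => ?_) hcon
    have := mul_le_mul_of_nonneg_left (hRmono τ hτ) (show 0 ≤ lam k / 4 by positivity)
    linarith
  have mZ := antitoneOn_of_hasDerivAt (ordConnected_openDom ⊤) (fun τ hτ => c.dZ hk0 hτ)
    fun τ hτ => by
      have := mul_pos hl (c.R_pos τ hτ)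
      linarith
  refine false_of_deriv_le (τ₁ := τ₂) (b := 0) (δ := Real.exp (-(k ^ 2 / 2) * L)) (Real.exp_pos _)
    (fun τ hτ => (c.dR τ (mem τ (h2.trans hτ))).mul
      ((c.dl τ (mem τ (h2.trans hτ))).const_mul (-(k ^ 2 / 2))).exp) (fun τ hτ => ?_)
    fun τ hτ => (mul_pos (c.R_pos τ (mem τ (h2.trans hτ))) (Real.exp_pos _)).le
  have hm := mem τ (h2.trans hτ)
  have e1 : x τ - k ^ 2 / 2 * y τ ≤ x τ₂ - k ^ 2 / 2 * y τ₂ := mZ (mem τ₂ h2) hm hτ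
  have e2 : Real.exp (-(k ^ 2 / 2) * L) ≤ Real.exp (-(k ^ 2 / 2) * l τ) := by
    refine Real.exp_le_exp.2 ?_
    have := mul_le_mul_of_nonneg_left (hle τ (h2.trans hτ)) (show 0 ≤ k ^ 2 / 2 by positivity)
    linarith
  have e3 : x τ * Real.exp (-(k ^ 2 / 2) * l τ) +
      R τ * (Real.exp (-(k ^ 2 / 2) * l τ) * (-(k ^ 2 / 2) * (y τ / R τ))) =
      (x τ - k ^ 2 / 2 * y τ) * Real.exp (-(k ^ 2 / 2) * l τ) := by
    have := (c.R_pos τ hm).ne'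
    field_simp
    ring
  rw [e3]
  have e4 := mul_le_mul_of_nonneg_right (show x τ - k ^ 2 / 2 * y τ ≤ -1 by linarith)
    (Real.exp_pos (-(k ^ 2 / 2) * l τ)).le
  linarith

/-- If x ≥ 0 throughout, `false_of_nonneg` applies. Otherwise R decreases, -1/2 ≤ R'/R by
`false_of_add_half_neg`, and the Riccati equation drives R'/R down at a uniform rate. -/
theorem lt_top_of_lam_pos (c : Core k V₀ l₀ T R x l y) (hk : 2 < k ^ 2) (hV : 0 < V₀) : T < ⊤ := by
  rw [lt_top_iff_ne_top]
  rintro rfl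
  have hk0 : k ≠ 0 := by rintro rfl; norm_num at hk
  have hl : 0 < lam k := by rw [lam]; linarith
  by_cases hx : ∀ τ ∈ openDom ⊤, 0 ≤ x τ
  · exact c.false_of_nonneg hk hV hx
  push Not at hx
  obtain ⟨τ₁, h1, hneg⟩ := hx
  have mem : ∀ τ, τ₁ ≤ τ → τ ∈ openDom ⊤ := fun τ hτ => mem_openDom_top (h1.1.trans_le hτ)
  have hx := fun τ hτ => c.x_neg_of_x_neg hk.le h1 hneg (mem τ hτ) hτ
  have hhalf : ∀ τ, τ₁ ≤ τ → -(1 / 2) ≤ x τ / R τ := fun τ hτ => by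
    by_contra! hlt
    rw [div_lt_iff₀ (c.R_pos τ (mem τ hτ))] at hlt
    exact c.false_of_add_half_neg hV (mem τ hτ).1 (by linarith)
  have hR1 := c.R_pos τ₁ h1
  have mR := antitoneOn_of_hasDerivAt (D := Set.Ici τ₁) Set.ordConnected_Ici
    (fun τ hτ => c.dR τ (mem τ hτ)) fun τ hτ => (hx τ hτ).le
  refine false_of_deriv_le (δ := 1 / (2 * R τ₁ ^ 2)) (by positivity) (fun τ hτ => c.dX (mem τ hτ))
    (fun τ hτ => ?_) hhalf
  have hR := c.R_pos τ (mem τ hτ)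
  have hRle : R τ ≤ R τ₁ := mR Set.self_mem_Ici hτ hτ
  have e1 : 1 / (2 * R τ₁ ^ 2) ≤ 1 / (2 * R τ ^ 2) := by gcongr
  have e := c.constraint hk0 (mem τ hτ)
  have h2 := hhalf τ hτ
  have h3 : x τ / R τ ≤ 0 := div_nonpos_of_nonpos_of_nonneg (hx τ hτ).le hR.le
  -- Eliminating W with this form of the constraint gives X' = (λ/2)(X² - 1/4) - 1/(2 R²) - (k²/4)(X
  -- - Y)², and X² ≤ 1/4.
  have e' : (x τ / R τ) ^ 2 - 2 * (1 / (2 * R τ ^ 2)) + k ^ 2 * (x τ / R τ) * (y τ / R τ) -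
      k ^ 2 / 2 * (y τ / R τ) ^ 2 + (2 * (V₀ * Real.exp (lam k * l τ)) - (2 + k ^ 2) / 8) = 0 := by
    field_simp
    linear_combination 16 * e
  generalize x τ / R τ = X at *
  generalize y τ / R τ = Y at *
  generalize V₀ * Real.exp (lam k * l τ) = W at *
  have h4 : lam k / 2 * X ^ 2 ≤ lam k / 2 * (1 / 4) := by gcongr; nlinarith
  have h5 : 0 ≤ k ^ 2 / 4 * (X - Y) ^ 2 := by positivity
  rw [lam] at h4
  linarith

/-- The derivative of `P = (R' - k² R l' / 2)² + λ R² / 4`. -/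
theorem dP (c : Core k V₀ l₀ T R x l y) (hk0 : k ≠ 0) {τ : ℝ} (hτ : τ ∈ openDom T) :
    HasDerivAt (fun t => (x t - k ^ 2 / 2 * y t) ^ 2 + lam k / 4 * R t ^ 2)
      (lam k * k ^ 2 / 4 * (R τ * y τ)) τ :=
  ((hasDerivAt_sq (c.dZ hk0 hτ)).add ((hasDerivAt_sq (c.dR τ hτ)).const_mul
    (lam k / 4))).congr_deriv (by ring)

theorem P_lim (c : Core k V₀ l₀ T R x l y) :
    Tendsto (fun t => (x t - k ^ 2 / 2 * y t) ^ 2 + lam k / 4 * R t ^ 2) (𝓝[>] 0) (𝓝 1) := by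
  simpa using (c.Z_lim.pow 2).add ((c.R_lim.pow 2).const_mul (lam k / 4))

/-- The constraint solved for y'. At y = 0 the sign of y' is the sign of P - 1. -/
theorem P_eq (c : Core k V₀ l₀ T R x l y) (hk0 : k ≠ 0) {τ : ℝ} (hτ : τ ∈ openDom T) :
    k ^ 2 * R τ * ((1 / 4 - 2 / k ^ 2 * V₀ * Real.exp (lam k * l τ)) * R τ) =
      (x τ - k ^ 2 / 2 * y τ) ^ 2 + lam k / 4 * R τ ^ 2 - 1 +
        2 * k ^ 2 * (x τ - k ^ 2 / 2 * y τ) * y τ + k ^ 2 * (3 * k ^ 2 / 4 - 1 / 2) * y τ ^ 2 := by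
  have e := c.constraint hk0 hτ
  have e1 : k ^ 2 * R τ * ((1 / 4 - 2 / k ^ 2 * V₀ * Real.exp (lam k * l τ)) * R τ) =
      (k ^ 2 / 4 - 2 * (V₀ * Real.exp (lam k * l τ))) * R τ ^ 2 := by
    field_simp
  rw [e1, lam]
  rw [lam] at e
  linear_combination -e

/-- While σ y > 0, P moves strictly away from its axis value 1 in the direction of σ. At a first
zero of y, `P_eq` then gives σ y' > 0, which is impossible. -/
theorem sign_y (c : Core k V₀ l₀ T R x l y) (hk0 : k ≠ 0) (hl : 0 < lam k) {σ : ℝ}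
    (hσ : 0 < σ * (k ^ 2 / 8 - V₀ * Real.exp (lam k * l₀))) {τ : ℝ} (hτ : τ ∈ openDom T) :
    0 < σ * y τ := by
  refine pos_of_deriv_barrier (g := fun t => σ * y t) (fun t ht => (c.dy t ht).const_mul σ)
    (c.eventually_sign_y hk0 hσ) (fun t ht h h0 => ?_) hτ
  have hσ0 : σ ≠ 0 := by rintro rfl; simp at hσ
  have hy : y t = 0 := (mul_eq_zero.1 h0).resolve_left hσ0
  have hk2 : 0 < k ^ 2 := by positivity
  have hR := c.R_pos t ht
  have hP : StrictMonoOn (fun t => σ * ((x t - k ^ 2 / 2 * y t) ^ 2 + lam k / 4 * R t ^ 2))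
      (Set.Ioo 0 t) := strictMonoOn_of_hasDerivAt Set.ordConnected_Ioo
    (fun r hr => (c.dP hk0 (mem_openDom_of_le ht hr.1 hr.2.le)).const_mul σ) fun r hr => by
      have h1 := c.R_pos r (mem_openDom_of_le ht hr.1 hr.2.le)
      have h2 := h r hr.1 hr.2
      have : σ * (lam k * k ^ 2 / 4 * (R r * y r)) = lam k * k ^ 2 / 4 * (R r * (σ * y r)) := by ring
      rw [this]
      positivity
  -- Two interior points turn strict monotonicity on the open interval into a strict gap between the
  -- limit at 0 and the value at t.
  have h3 : t / 3 ∈ Set.Ioo 0 t := ⟨by linarith [ht.1], by linarith [ht.1]⟩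
  have h4 : 2 * t / 3 ∈ Set.Ioo 0 t := ⟨by linarith [ht.1], by linarith [ht.1]⟩
  have e1 := le_of_tendsto (b := σ * ((x (t / 3) - k ^ 2 / 2 * y (t / 3)) ^ 2 +
    lam k / 4 * R (t / 3) ^ 2)) (c.P_lim.const_mul σ) (by
      filter_upwards [Ioo_mem_nhdsGT h3.1] with r hr
      exact (hP ⟨hr.1, hr.2.trans h3.2⟩ h3 hr.2).le)
  have e2 := hP h3 h4 (by linarith [ht.1])
  have e3 := ge_of_tendsto ((((c.dP hk0 ht).const_mul σ).continuousAt).mono_left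
    (nhdsWithin_le_nhds (s := Set.Iio t))) (by
      filter_upwards [Ioo_mem_nhdsLT h4.2] with r hr
      exact (hP h4 ⟨h4.1.trans hr.1, hr.2⟩ hr.1).le)
  have e4 := c.P_eq hk0 ht
  simp only [hy] at e2 e3 e4
  have e5 : 0 < σ * (k ^ 2 * R t * ((1 / 4 - 2 / k ^ 2 * V₀ * Real.exp (lam k * l t)) * R t)) := by
    rw [e4]
    linarith
  refine (pos_iff_pos_of_mul_pos (a := k ^ 2 * R t) ?_).1 (by positivity)
  refine lt_of_lt_of_eq e5 ?_
  ring

theorem exists_abs_Z_le (c : Core k V₀ l₀ T R x l y) (hk0 : k ≠ 0) (hV : 0 < V₀) (hT : T < ⊤)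
    {τ₁ : ℝ} (h1 : τ₁ ∈ openDom T) :
    ∃ M, ∀ τ ∈ openDom T, τ₁ ≤ τ → |x τ - k ^ 2 / 2 * y τ| ≤ M ∧ R τ ≤ M := by
  obtain rfl | ⟨t, ht, rfl⟩ := eq_top_or_eq_coe c.pos
  · exact absurd hT (lt_irrefl _)
  have hR : ∀ τ ∈ openDom (t : EReal), R τ ≤ Real.exp t := fun τ hτ =>
    (c.R_le_exp hV hτ).trans (Real.exp_le_exp.2 (by
      have : τ < t := by exact_mod_cast hτ.2
      exact this.le))
  have mem : ∀ τ ∈ Set.Ico τ₁ t, τ ∈ openDom (t : EReal) := fun τ hτ =>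
    ⟨h1.1.trans_le hτ.1, by exact_mod_cast hτ.2⟩
  obtain ⟨C, hC⟩ := exists_abs_le_of_hasDerivAt (B := |lam k / 4| * Real.exp t)
    (fun τ hτ => c.dZ hk0 (mem τ hτ)) fun τ hτ => by
      rw [abs_mul, abs_neg, abs_of_pos (c.R_pos τ (mem τ hτ))]
      have := hR τ (mem τ hτ)
      gcongr
  exact ⟨max C (Real.exp t), fun τ hτ h => ⟨(hC τ ⟨h, by exact_mod_cast hτ.2⟩).trans
    (le_max_left _ _), (hR τ hτ).trans (le_max_right _ _)⟩⟩

/-- The quantitative form of `sign_y`: after τ₁ the gap σ (P - 1) is at least some δ > 0 and Z is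
bounded, so σ y' > 0 persists wherever σ y equals a small η. -/
theorem exists_lt_sign_y (c : Core k V₀ l₀ T R x l y) (hk0 : k ≠ 0) (hl : 0 < lam k) (hV : 0 < V₀)
    (hT : T < ⊤) {σ : ℝ} (hσ1 : σ = 1 ∨ σ = -1)
    (hσ : 0 < σ * (k ^ 2 / 8 - V₀ * Real.exp (lam k * l₀))) {τ₁ : ℝ} (h1 : τ₁ ∈ openDom T) :
    ∃ η, 0 < η ∧ ∀ τ ∈ openDom T, τ₁ ≤ τ → η ≤ σ * y τ := by
  have hk2 : 0 < k ^ 2 := by positivity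
  have hs2 : σ ^ 2 = 1 := by rcases hσ1 with rfl | rfl <;> norm_num
  obtain ⟨M, hM⟩ := c.exists_abs_Z_le hk0 hV hT h1
  have hM0 : 0 ≤ M := (abs_nonneg _).trans (hM τ₁ h1 le_rfl).1
  set P : ℝ → ℝ := fun t => (x t - k ^ 2 / 2 * y t) ^ 2 + lam k / 4 * R t ^ 2 with hP
  have hPpos : ∀ r ∈ openDom T, 0 < σ * (lam k * k ^ 2 / 4 * (R r * y r)) := fun r hr => by
    have h1 := c.R_pos r hr
    have h2 := c.sign_y hk0 hl hσ hr
    have : σ * (lam k * k ^ 2 / 4 * (R r * y r)) = lam k * k ^ 2 / 4 * (R r * (σ * y r)) := by ring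
    rw [this]
    positivity
  have hPm : StrictMonoOn (fun t => σ * P t) (openDom T) :=
    strictMonoOn_of_hasDerivAt (ordConnected_openDom T) (fun r hr => (c.dP hk0 hr).const_mul σ) hPpos
  set δ := σ * P τ₁ - σ * 1 with hδ
  have hδ0 : 0 < δ := sub_pos.2 (tendsto_lt_of_strictMonoOn hPm (c.P_lim.const_mul σ) h1)
  set K := 2 * k ^ 2 * M + k ^ 2 * |3 * k ^ 2 / 4 - 1 / 2| with hK
  have hK0 : 0 ≤ K := by positivity
  have hg1 := c.sign_y hk0 hl hσ h1
  -- η ≤ 1 gives η² ≤ η, the second entry puts the start above η, and the third makes the error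
  -- terms K η smaller than δ.
  set η := min (min 1 (σ * y τ₁ / 2)) (δ / (2 * (K + 1))) with hη
  have hη0 : 0 < η := lt_min (lt_min one_pos (half_pos hg1)) (by positivity)
  have hη1 : η ≤ 1 := (min_le_left _ _).trans (min_le_left _ _)
  have hη2 : η ≤ σ * y τ₁ / 2 := (min_le_left _ _).trans (min_le_right _ _)
  have hη3 : η * (2 * (K + 1)) ≤ δ := by
    rw [← le_div_iff₀ (by positivity)]
    exact min_le_right _ _
  refine ⟨η, hη0, fun τ hτ hle => (sub_pos.1 (pos_of_deriv_barrier_tail (g := fun t => σ * y t - η)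
    h1 (fun t ht => ((c.dy t ht).const_mul σ).sub_const η) (by linarith) (fun t ht ht1 _ h0 => ?_)
    hτ hle)).le⟩
  have hy : σ * y t = η := sub_eq_zero.1 h0
  have hR := c.R_pos t ht
  have e4 := c.P_eq hk0 ht
  have e1 : σ * P τ₁ ≤ σ * P t := hPm.monotoneOn h1 ht ht1
  obtain ⟨hZ, -⟩ := hM t ht ht1
  have hy2 : y t ^ 2 = η ^ 2 := by rw [← hy, mul_pow, hs2, one_mul]
  have e5 : 0 < σ * (k ^ 2 * R t * ((1 / 4 - 2 / k ^ 2 * V₀ * Real.exp (lam k * l t)) * R t)) := by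
    rw [e4, hy2]
    have q1 : -(M * η) ≤ (x t - k ^ 2 / 2 * y t) * (σ * y t) := by
      rw [hy]
      have := mul_le_mul_of_nonneg_right (abs_le.1 hZ).1 hη0.le
      linarith
    have q2 : -|3 * k ^ 2 / 4 - 1 / 2| ≤ σ * (3 * k ^ 2 / 4 - 1 / 2) := by
      rcases hσ1 with rfl | rfl
      · rw [one_mul]; exact neg_abs_le _
      · rw [neg_one_mul]; exact neg_le_neg (le_abs_self _)
    have q3 := mul_le_mul_of_nonneg_right q2 (sq_nonneg η)
    have q4 : η ^ 2 ≤ η := by nlinarith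
    have q5 := mul_le_mul_of_nonneg_left q4 (abs_nonneg (3 * k ^ 2 / 4 - 1 / 2))
    have q6 : -(|3 * k ^ 2 / 4 - 1 / 2| * η) ≤ σ * (3 * k ^ 2 / 4 - 1 / 2) * η ^ 2 := by linarith
    have q7 := mul_le_mul_of_nonneg_left q6 hk2.le
    have q8 := mul_le_mul_of_nonneg_left q1 (show 0 ≤ 2 * k ^ 2 by positivity)
    have q9 : σ * P t = σ * ((x t - k ^ 2 / 2 * y t) ^ 2 + lam k / 4 * R t ^ 2) := rfl
    have q10 : K * η = 2 * k ^ 2 * (M * η) + k ^ 2 * (|3 * k ^ 2 / 4 - 1 / 2| * η) := by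
      rw [hK]; ring
    have q11 : 0 ≤ K * η := by positivity
    linarith
  refine (pos_iff_pos_of_mul_pos (a := k ^ 2 * R t) ?_).1 (by positivity)
  refine lt_of_lt_of_eq e5 ?_
  ring

/-- Collapse with `λ > 0` and `V₀ e ^ (λ l₀) < k² / 8`. -/
theorem exists_bound_of_increasing (c : Core k V₀ l₀ T R x l y) (hk : 2 < k ^ 2) (hV : 0 < V₀)
    (hT : T < ⊤) (hW0 : V₀ * Real.exp (lam k * l₀) < k ^ 2 / 8) {τ₁ : ℝ} (h1 : τ₁ ∈ openDom T)
    (hx : ∀ τ ∈ openDom T, τ₁ ≤ τ → x τ < 0) (hR0 : Tendsto R (endFilter T) (𝓝 0)) :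
    (∃ L, ∀ τ ∈ openDom T, l τ ≤ L) ∨ ∃ τ₂ ∈ openDom T, ∃ δ B, 0 < δ ∧
      ∀ τ ∈ openDom T, τ₂ ≤ τ → x τ ≤ -δ ∧ R τ * Real.exp (k ^ 2 * l τ) ≤ B := by
  have hk0 : k ≠ 0 := by rintro rfl; norm_num at hk
  have hl : 0 < lam k := by rw [lam]; linarith
  have hk2 : 0 < k ^ 2 := by positivity
  have hy : ∀ τ ∈ openDom T, 0 < y τ := fun τ hτ => by
    have := c.sign_y hk0 hl (σ := 1) (by linarith) hτ
    linarith
  have mW := c.monotoneOn_W hV fun τ hτ => mul_nonneg hl.le (hy τ hτ).le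
  -- As l increases, either W never passes k² / 8, which bounds l, or it stays above. In the latter
  -- case x and x + k² y both decrease, because k² > 2.
  by_cases hbig : ∃ τ ∈ openDom T, k ^ 2 / 8 < V₀ * Real.exp (lam k * l τ)
  swap
  · push Not at hbig
    refine Or.inl ⟨Real.log (k ^ 2 / 8 / V₀) / lam k, fun τ hτ => ?_⟩
    rw [le_div_iff₀ hl, mul_comm, Real.le_log_iff_exp_le (by positivity), le_div_iff₀' hV]
    exact hbig τ hτ
  obtain ⟨τ₀, h0, hw⟩ := hbig
  right
  obtain ⟨τ₃, h3, h13, h03⟩ : ∃ τ₃ ∈ openDom T, τ₁ ≤ τ₃ ∧ τ₀ ≤ τ₃ := by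
    rcases le_total τ₁ τ₀ with h | h
    · exact ⟨τ₀, h0, h, le_rfl⟩
    · exact ⟨τ₁, h1, le_rfl, h⟩
  have hW : ∀ τ ∈ openDom T, τ₃ ≤ τ → k ^ 2 / 8 ≤ V₀ * Real.exp (lam k * l τ) := fun τ hτ h => by
    have : V₀ * Real.exp (lam k * l τ₀) ≤ V₀ * Real.exp (lam k * l τ) := mW h0 hτ (h03.trans h)
    linarith
  have mx := antitoneOn_of_hasDerivAt (ordConnected_tail T τ₃) (fun t ht => c.dx t ht.1)
    fun t ht => mul_nonpos_of_nonpos_of_nonneg (by linarith [hW t ht.1 ht.2]) (c.R_pos t ht.1).le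
  have mxy := antitoneOn_of_hasDerivAt (ordConnected_tail T τ₃)
    (fun t ht => (c.dx t ht.1).add ((c.dy t ht.1).const_mul (k ^ 2)))
    fun t ht => by
      have e1 := hW t ht.1 ht.2
      have e2 : (1 / 4 - V₀ * Real.exp (lam k * l t)) * R t +
          k ^ 2 * ((1 / 4 - 2 / k ^ 2 * V₀ * Real.exp (lam k * l t)) * R t) =
          (1 / 4 + k ^ 2 / 4 - 3 * (V₀ * Real.exp (lam k * l t))) * R t := by
        field_simp; ring
      rw [e2]
      exact mul_nonpos_of_nonpos_of_nonneg (by linarith) (c.R_pos t ht.1).le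
  -- The sign of x + k² y decides, since (R e^(k² l))' = (x + k² y) e^(k² l). A negative value
  -- persists and bounds R e^(k² l).
  by_cases hneg : ∃ τ ∈ openDom T, τ₃ ≤ τ ∧ x τ + k ^ 2 * y τ < 0
  · obtain ⟨τ₄, h4, h34, hneg⟩ := hneg
    refine ⟨τ₄, h4, -x τ₄, R τ₄ * Real.exp (k ^ 2 * l τ₄), neg_pos.2 (hx τ₄ h4 (h13.trans h34)),
      fun τ hτ h => ⟨?_, ?_⟩⟩
    · rw [neg_neg]
      exact mx ⟨h4, h34⟩ ⟨hτ, h34.trans h⟩ h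
    · refine antitoneOn_of_hasDerivAt (ordConnected_tail T τ₄) (fun t ht => (c.dR t ht.1).mul
        ((c.dl t ht.1).const_mul (k ^ 2)).exp) (fun t ht => ?_) ⟨h4, le_rfl⟩ ⟨hτ, h⟩ h
      have e1 : x t + k ^ 2 * y t ≤ x τ₄ + k ^ 2 * y τ₄ := mxy ⟨h4, h34⟩ ⟨ht.1, h34.trans ht.2⟩ ht.2
      have e3 : x t * Real.exp (k ^ 2 * l t) +
          R t * (Real.exp (k ^ 2 * l t) * (k ^ 2 * (y t / R t))) =
          (x t + k ^ 2 * y t) * Real.exp (k ^ 2 * l t) := by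
        have := (c.R_pos t ht.1).ne'
        field_simp
      rw [e3]
      exact mul_nonpos_of_nonpos_of_nonneg (by linarith) (Real.exp_pos _).le
  exfalso
  push Not at hneg
  obtain ⟨M, hM⟩ := c.exists_abs_Z_le hk0 hV hT h3
  have hM0 : 0 ≤ M := (abs_nonneg _).trans (hM τ₃ h3 le_rfl).1
  obtain rfl | ⟨t, ht, rfl⟩ := eq_top_or_eq_coe c.pos
  · exact absurd hT (lt_irrefl _)
  -- If x + k² y ≥ 0, the constraint gives 2 W R² ≥ 1, hence y' ≤ R/4 - 1/(k² R). As x ≥ -M, the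
  -- term q log R compensates, so y - q log R - M τ / 4 decreases. Positivity of y then keeps R away
  -- from 0.
  set q := 1 / (k ^ 2 * (M + 1)) with hq
  have hq0 : 0 < q := by positivity
  have m := antitoneOn_of_hasDerivAt (ordConnected_tail (t : EReal) τ₃)
    (fun τ hτ => ((c.dy τ hτ.1).sub (((c.dR τ hτ.1).log (c.R_pos τ hτ.1).ne').const_mul q)).sub
      ((hasDerivAt_id τ).const_mul (M / 4))) fun τ hτ => by
      have hR := c.R_pos τ hτ.1
      have hZ := hM τ hτ.1 hτ.2
      have hyτ := hy τ hτ.1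
      have e := c.constraint hk0 hτ.1
      have e1 : x τ * (x τ + k ^ 2 * y τ) ≤ 0 := mul_nonpos_of_nonpos_of_nonneg
        (hx τ hτ.1 (h13.trans hτ.2)).le (hneg τ hτ.1 hτ.2)
      have e2 : 1 ≤ 2 * (V₀ * Real.exp (lam k * l τ)) * R τ ^ 2 := by
        have : 0 ≤ k ^ 2 / 2 * y τ ^ 2 := by positivity
        have : 0 ≤ (2 + k ^ 2) / 8 * R τ ^ 2 := by positivity
        linarith
      have e3 : 1 / k ^ 2 * (1 / R τ) ≤ 2 / k ^ 2 * V₀ * Real.exp (lam k * l τ) * R τ := by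
        have h5 := mul_le_mul_of_nonneg_left e2 (show 0 ≤ 1 / k ^ 2 * (1 / R τ) by positivity)
        rw [mul_one] at h5
        refine h5.trans (le_of_eq ?_)
        field_simp
      have e4 : -M ≤ x τ := by
        have : 0 ≤ k ^ 2 / 2 * y τ := by positivity
        linarith [(abs_le.1 hZ.1).1]
      have e5 : -(1 / k ^ 2 * (1 / R τ)) ≤ q * (x τ / R τ) := by
        have h6 : 1 / k ^ 2 * (1 / R τ) = q * ((M + 1) / R τ) := by rw [hq]; field_simp
        rw [h6, ← mul_neg, ← neg_div]
        have : -(M + 1) ≤ x τ := by linarith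
        gcongr
      linarith [hZ.2]
  set C := y τ₃ - q * Real.log (R τ₃) - M / 4 * τ₃ with hC
  have hlow : ∀ τ ∈ openDom (t : EReal), τ₃ ≤ τ → Real.exp (-(C + M / 4 * t) / q) ≤ R τ := by
    intro τ hτ h
    have e1 : y τ - q * Real.log (R τ) - M / 4 * τ ≤ C := m ⟨h3, le_rfl⟩ ⟨hτ, h⟩ h
    rw [← Real.le_log_iff_exp_le (c.R_pos τ hτ), div_le_iff₀ hq0]
    have e2 : τ < t := by exact_mod_cast hτ.2
    have e3 : M / 4 * τ ≤ M / 4 * t := by gcongr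
    linarith [hy τ hτ]
  have hne := endFilter_neBot c.pos
  have := ge_of_tendsto hR0 ((eventually_endFilter h3).mono fun τ hτ => hlow τ hτ.1 hτ.2.le)
  exact absurd this (not_le.2 (Real.exp_pos _))

end Core

end SelfSimilarCylinder


namespace SelfSimilarCylinder

/-! ### V₀ > 0: the geometry at a collapse -/

variable {k V₀ l₀ φ₀ c₁ : ℝ} {T : EReal} {s : Fields} {R x l y : ℝ → ℝ}

/-- If `V₀ e ^ (λ l₀) = k² / 8` and `k² > 2`, then `l` is constant. -/
theorem Core.l_eq_of_static (c : Core k V₀ l₀ T R x l y) (hk : 2 < k ^ 2)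
    (hV : V₀ * Real.exp (lam k * l₀) = k ^ 2 / 8) {τ : ℝ} (hτ : τ ∈ openDom T) : l τ = l₀ := by
  have hk0 : k ≠ 0 := by rintro rfl; norm_num at hk
  set a := Real.sqrt ((k ^ 2 - 2) / 8)
  have ha : 0 < a := Real.sqrt_pos.2 (by linarith)
  have ha2 : a ^ 2 = (k ^ 2 - 2) / 8 := Real.sq_sqrt (by linarith)
  have hπ : 0 < Real.pi / a := div_pos Real.pi_pos ha
  have dR : ∀ τ, HasDerivAt (fun τ => Real.sin (a * τ) / a) (Real.cos (a * τ)) τ := fun τ =>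
    ((((hasDerivAt_id τ).const_mul a).sin).div_const a).congr_deriv (by simp only [id]; field_simp)
  have c' : Core k V₀ l₀ ((Real.pi / a : ℝ) : EReal) (fun τ => Real.sin (a * τ) / a)
      (fun τ => Real.cos (a * τ)) (fun _ => l₀) (fun _ => 0) := by
    refine core_const hk0 hV (by exact_mod_cast hπ) (fun τ hτ => ?_) dR (fun τ => ?_)
      (by simp) (by simp)
    · have h : τ < Real.pi / a := by exact_mod_cast hτ.2
      rw [lt_div_iff₀' ha] at h
      exact div_pos (Real.sin_pos_of_pos_of_lt_pi (mul_pos ha hτ.1) h) ha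
    · refine (((hasDerivAt_id τ).const_mul a).cos).congr_deriv ?_
      rw [show (2 - k ^ 2) / 8 = -a ^ 2 by rw [ha2]; ring]
      simp only [id]
      field_simp
  -- The explicit R = sin(a τ) / a vanishes at π / a, so no solution with these data can be alive
  -- there.
  have hπT : (Real.pi / a : ℝ) ∉ openDom T := fun hm => by
    have h1 : Tendsto R (𝓝[<] (Real.pi / a)) (𝓝 (R (Real.pi / a))) :=
      (c.dR _ hm).continuousAt.mono_left nhdsWithin_le_nhds
    have h2 : Tendsto (fun τ => Real.sin (a * τ) / a) (𝓝[<] (Real.pi / a)) (𝓝 0) := by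
      have := (dR (Real.pi / a)).continuousAt.tendsto
      rw [mul_div_cancel₀ _ ha.ne', Real.sin_pi, zero_div] at this
      exact this.mono_left nhdsWithin_le_nhds
    have h3 := tendsto_nhds_unique_of_eventuallyEq h1 h2 (by
      filter_upwards [Ioo_mem_nhdsLT hπ] with t ht
      exact (c.eq c' hk0 (mem_openDom_of_le hm ht.1 ht.2.le) ⟨ht.1, by exact_mod_cast ht.2⟩).1)
    exact absurd h3 (c.R_pos _ hm).ne'
  have hlt : τ < Real.pi / a := by
    by_contra! hle
    exact hπT (mem_openDom_of_le hτ hπ hle)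
  exact (c.eq c' hk0 hτ ⟨hτ.1, by exact_mod_cast hlt⟩).2.2.1

namespace IsSolution

theorem reachedInFiniteAffineTime_of_le (h : IsSolution k V₀ l₀ φ₀ c₁ T s) (hT : T < ⊤) {τ₁ L : ℝ}
    (h1 : τ₁ ∈ openDom T) (hl : ∀ τ ∈ openDom T, τ₁ ≤ τ → s.l τ ≤ L) :
    ReachedInFiniteAffineTime s T := by
  obtain rfl | ⟨t, ht, rfl⟩ := eq_top_or_eq_coe h.pos
  · exact absurd hT (lt_irrefl _)
  refine h.reachedInFiniteAffineTime h1 (G := fun τ => Real.exp (k ^ 2 / 2 * L) * τ)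
    (G' := fun _ => Real.exp (k ^ 2 / 2 * L)) (B := Real.exp (k ^ 2 / 2 * L) * t)
    (fun τ _ _ => by simpa using (hasDerivAt_id τ).const_mul (Real.exp (k ^ 2 / 2 * L)))
    (fun τ hτ h' => Real.exp_le_exp.2 ?_) (fun τ hτ _ => ?_)
  · have := mul_le_mul_of_nonneg_left (hl τ hτ h') (show 0 ≤ k ^ 2 / 2 by positivity)
    linarith [hτ.1]
  · have : τ < t := by exact_mod_cast hτ.2
    gcongr

/-- The rate is at most √(B / R), and with R' ≤ -δ this is dominated by the derivative of -(2 √B /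
δ) √R, a bounded function. This covers the case in which no bound on l is available. -/
theorem reachedInFiniteAffineTime_of_mul_le (h : IsSolution k V₀ l₀ φ₀ c₁ T s) {τ₁ δ B : ℝ}
    (h1 : τ₁ ∈ openDom T) (hδ : 0 < δ) (hx : ∀ τ ∈ openDom T, τ₁ ≤ τ → deriv s.R τ ≤ -δ)
    (hB : ∀ τ ∈ openDom T, τ₁ ≤ τ → s.R τ * Real.exp (k ^ 2 * s.l τ) ≤ B) :
    ReachedInFiniteAffineTime s T := by
  have c := h.core
  have hB0 : 0 ≤ B := (mul_pos (c.R_pos _ h1) (Real.exp_pos _)).le.trans (hB τ₁ h1 le_rfl)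
  refine h.reachedInFiniteAffineTime h1
    (G := fun τ => -(2 * Real.sqrt B / δ) * Real.sqrt (s.R τ)) (B := 0)
    (fun τ hτ _ => ((c.dR τ hτ).sqrt (c.R_pos τ hτ).ne').const_mul _)
    (fun τ hτ h' => ?_) (fun τ hτ _ => ?_)
  · have hR := c.R_pos τ hτ
    have hsR := Real.sqrt_pos.2 hR
    have e1 : Real.exp (k ^ 2 / 2 * s.l τ - τ / 2) ≤ Real.exp (k ^ 2 / 2 * s.l τ) :=
      Real.exp_le_exp.2 (by linarith [hτ.1])
    have e2 : Real.exp (k ^ 2 / 2 * s.l τ) * Real.sqrt (s.R τ) ≤ Real.sqrt B := by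
      refine Real.le_sqrt_of_sq_le ?_
      rw [mul_pow, Real.sq_sqrt hR.le, ← Real.exp_nat_mul]
      refine le_trans (le_of_eq ?_) (hB τ hτ h')
      rw [mul_comm]
      congr 2
      push_cast
      ring
    have e3 : Real.exp (k ^ 2 / 2 * s.l τ) ≤ Real.sqrt B / Real.sqrt (s.R τ) := by
      rwa [le_div_iff₀ hsR]
    refine e1.trans (e3.trans ?_)
    have e4 : -(2 * Real.sqrt B / δ) * (deriv s.R τ / (2 * Real.sqrt (s.R τ))) =
        Real.sqrt B / Real.sqrt (s.R τ) * (-deriv s.R τ / δ) := by field_simp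
    rw [e4]
    refine le_mul_of_one_le_right (by positivity) ?_
    rw [le_div_iff₀ hδ]
    linarith [hx τ hτ h']
  · have : 0 ≤ 2 * Real.sqrt B / δ * Real.sqrt (s.R τ) := by positivity
    linarith

/-- φ + (1/2) log R has derivative 1/4 + 1/(2 R) > 0, so e^(-φ) is at most a multiple of √R. -/
theorem specificLengthVanishes (h : IsSolution k V₀ l₀ φ₀ c₁ T s)
    (hR0 : Tendsto s.R (endFilter T) (𝓝 0)) : SpecificLengthVanishes s T := fun u _ => by
  have c := h.core
  obtain ⟨τ₁, h1⟩ := exists_mem_openDom h.pos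
  have m := monotoneOn_of_hasDerivAt (ordConnected_openDom T) (fun τ hτ =>
    (h.deriv_φ hτ).add (((c.dR τ hτ).log (c.R_pos τ hτ).ne').const_mul (1 / 2))) fun τ hτ => by
      have hR := c.R_pos τ hτ
      have : 1 / 4 + (1 - deriv s.R τ) / (2 * s.R τ) + 1 / 2 * (deriv s.R τ / s.R τ) =
        1 / 4 + 1 / (2 * s.R τ) := by field_simp; ring
      rw [this]
      positivity
  set C := s.φ τ₁ + 1 / 2 * Real.log (s.R τ₁)
  have h0 := ((Real.continuous_sqrt.tendsto 0).comp hR0).const_mul (Real.sqrt |u| * Real.exp (-C))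
  rw [Real.sqrt_zero, mul_zero] at h0
  refine squeeze_zero' (Eventually.of_forall fun τ => by unfold Fields.specificLength; positivity) ?_ h0
  filter_upwards [eventually_endFilter h1] with τ hτ
  have hR := c.R_pos τ hτ.1
  have e : C ≤ s.φ τ + 1 / 2 * Real.log (s.R τ) := m h1 hτ.1 hτ.2.le
  simp only [Fields.specificLength, Function.comp]
  rw [mul_assoc]
  refine mul_le_mul_of_nonneg_left ?_ (Real.sqrt_nonneg _)
  have e2 : Real.sqrt (s.R τ) = Real.exp (1 / 2 * Real.log (s.R τ)) := by
    rw [Real.sqrt_eq_rpow, Real.rpow_def_of_pos hR, mul_comm]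
  rw [e2, ← Real.exp_add]
  exact Real.exp_le_exp.2 (by linarith)

theorem radiusVanishes_of_tendsto (h : IsSolution k V₀ l₀ φ₀ c₁ T s)
    (hR0 : Tendsto s.R (endFilter T) (𝓝 0)) : RadiusVanishes s T := by
  refine radiusVanishes (squeeze_zero' ?_ ?_ hR0)
  · filter_upwards [eventually_mem_openDom h.pos] with τ hτ
    have := h.R_pos τ hτ
    positivity
  · filter_upwards [eventually_mem_openDom h.pos] with τ hτ
    refine mul_le_of_le_one_left (h.R_pos τ hτ).le (Real.exp_le_one_iff.2 ?_)
    linarith [hτ.1]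

/-- Since |R l'| ≥ η, the bracket in the Ricci scalar grows at least like R⁻². The bound on R e^(k²
l) makes e^(-k² l / 2) at least a multiple of R once R ≤ 1. The product is at least a multiple of
R⁻¹. -/
theorem hasCurvatureSingularity_of_collapse (h : IsSolution k V₀ l₀ φ₀ c₁ T s) (hk : k ≠ 0)
    (hV : 0 < V₀) (hR0 : Tendsto s.R (endFilter T) (𝓝 0)) {τ₁ η B : ℝ} (h1 : τ₁ ∈ openDom T)
    (hη : 0 < η) (hy : ∀ τ ∈ openDom T, τ₁ ≤ τ → η ≤ |s.R τ * deriv s.l τ|)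
    (hB : ∀ τ ∈ openDom T, τ₁ ≤ τ → s.R τ * Real.exp (k ^ 2 * s.l τ) ≤ B) :
    HasCurvatureSingularity s T := by
  refine h.hasCurvatureSingularity hk ?_
  have hk2 : 0 < k ^ 2 := by positivity
  have hB0 : 0 ≤ B := (mul_pos (h.R_pos _ h1) (Real.exp_pos _)).le.trans (hB τ₁ h1 le_rfl)
  have hR0' : Tendsto s.R (endFilter T) (𝓝[>] 0) := tendsto_nhdsWithin_iff.2
    ⟨hR0, (eventually_mem_openDom h.pos).mono fun τ hτ => h.R_pos τ hτ⟩
  refine tendsto_atTop_mono' _ ?_ ((tendsto_inv_nhdsGT_zero.comp hR0').const_mul_atTop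
    (show 0 < 1 / (1 + B) * (3 * k ^ 2 / 16 * η ^ 2) by positivity))
  filter_upwards [eventually_endFilter h1, hR0.eventually_le_const one_pos,
    hR0.eventually_le_const hη] with τ hτ hR1 hRη
  have hR := h.R_pos τ hτ.1
  have e1 : s.R τ / (1 + B) ≤ Real.exp (τ / 2 - k ^ 2 / 2 * s.l τ) := by
    have h2 : s.R τ / (1 + B) ≤ Real.exp (-(k ^ 2 / 2 * s.l τ)) := by
      refine abs_le_of_sq_le_sq' ?_ (Real.exp_pos _).le |>.2
      have h3 : Real.exp (-(k ^ 2 / 2 * s.l τ)) ^ 2 * Real.exp (k ^ 2 * s.l τ) = 1 := by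
        rw [← Real.exp_nat_mul, ← Real.exp_add, Real.exp_eq_one_iff]
        push_cast
        ring
      have h4 := hB τ hτ.1 hτ.2.le
      have h5 : s.R τ ≤ B * Real.exp (-(k ^ 2 / 2 * s.l τ)) ^ 2 := by
        have := mul_le_mul_of_nonneg_right h4 (sq_nonneg (Real.exp (-(k ^ 2 / 2 * s.l τ))))
        rwa [mul_assoc, mul_comm (Real.exp (k ^ 2 * s.l τ)), h3, mul_one] at this
      rw [div_pow, div_le_iff₀ (by positivity)]
      have h6 := sq_nonneg (Real.exp (-(k ^ 2 / 2 * s.l τ)))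
      nlinarith
    exact h2.trans (Real.exp_le_exp.2 (by linarith [hτ.1.1]))
  have e2 : 3 * k ^ 2 / 16 * (η ^ 2 / s.R τ ^ 2) ≤ 2 * (V₀ * Real.exp (lam k * s.l τ)) +
      k ^ 2 / 4 * (deriv s.l τ ^ 2 - 1 / 4) := by
    have h2 : η ^ 2 ≤ s.R τ ^ 2 * deriv s.l τ ^ 2 := by
      rw [← mul_pow, ← sq_abs (s.R τ * _)]
      exact pow_le_pow_left₀ hη.le (hy τ hτ.1 hτ.2.le) 2
    have h3 : η ^ 2 / s.R τ ^ 2 ≤ deriv s.l τ ^ 2 := by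
      rwa [div_le_iff₀' (by positivity)]
    have h4 : 1 ≤ η ^ 2 / s.R τ ^ 2 := by
      rw [le_div_iff₀ (by positivity), one_mul]
      exact pow_le_pow_left₀ hR.le hRη 2
    have h5 := mul_pos hV (Real.exp_pos (lam k * s.l τ))
    have h6 : k ^ 2 / 4 * (3 / 4 * (η ^ 2 / s.R τ ^ 2)) ≤ k ^ 2 / 4 * (deriv s.l τ ^ 2 - 1 / 4) := by
      gcongr
      linarith
    linarith
  refine le_trans (le_of_eq ?_) (mul_le_mul e1 e2 (by positivity) (Real.exp_pos _).le)
  simp only [Function.comp]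
  field_simp

end IsSolution

theorem mul_exp_le_of_le {R l b L : ℝ} (hR : R ≤ b) (hb : 0 ≤ b) (hl : l ≤ L) :
    R * Real.exp (k ^ 2 * l) ≤ b * Real.exp (k ^ 2 * L) := by
  gcongr

namespace IsMaximalSolution

/-- A collapse with bounded `l`. -/
theorem case_four_of_le (h : IsMaximalSolution k V₀ l₀ φ₀ c₁ T s) (hk0 : k ≠ 0) (hV : 0 < V₀)
    (hT : T < ⊤) {τ₁ L : ℝ} (h1 : τ₁ ∈ openDom T)
    (hx : ∀ τ ∈ openDom T, τ₁ ≤ τ → deriv s.R τ < 0)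
    (hl : ∀ τ ∈ openDom T, τ₁ ≤ τ → s.l τ ≤ L)
    (hy : V₀ * Real.exp (lam k * l₀) ≠ k ^ 2 / 8 → ∃ η, 0 < η ∧
      ∀ τ ∈ openDom T, τ₁ ≤ τ → η ≤ |s.R τ * deriv s.l τ|) :
    T < ⊤ ∧ RadiusVanishes s T ∧ SpecificLengthVanishes s T ∧
      (V₀ * Real.exp (lam k * l₀) ≠ k ^ 2 / 8 → HasCurvatureSingularity s T) ∧
      ReachedInFiniteAffineTime s T := by
  have c := h.1.core
  have hR0 := c.tendsto_R_zero hk0 (h.isMaximalTime hk0) hT h1 hx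
  refine ⟨hT, h.1.radiusVanishes_of_tendsto hR0, h.1.specificLengthVanishes hR0, fun hne => ?_,
    h.1.reachedInFiniteAffineTime_of_le hT h1 hl⟩
  obtain ⟨η, hη, hy⟩ := hy hne
  obtain ⟨M, hM⟩ := c.exists_abs_Z_le hk0 hV hT h1
  refine h.1.hasCurvatureSingularity_of_collapse hk0 hV hR0 h1 hη hy fun τ hτ h' =>
    mul_exp_le_of_le (hM τ hτ h').2 ?_ (hl τ hτ h')
  exact (h.1.R_pos τ hτ).le.trans (hM τ hτ h').2

theorem case_four_of_contracting (h : IsMaximalSolution k V₀ l₀ φ₀ c₁ T s) (hk0 : k ≠ 0)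
    (hk : k ^ 2 ≤ 2) (hV0 : 0 < V₀) (hV : k ^ 2 / 8 < V₀ * Real.exp (lam k * l₀)) :
    T < ⊤ ∧ RadiusVanishes s T ∧ SpecificLengthVanishes s T ∧
      (V₀ * Real.exp (lam k * l₀) ≠ k ^ 2 / 8 → HasCurvatureSingularity s T) ∧
      ReachedInFiniteAffineTime s T := by
  have c := h.1.core
  obtain ⟨τ₁, h1, η, hη, hc⟩ := c.exists_collapse_of_contracting hk0 hk hV0 hV (h.isMaximalTime hk0)
  refine h.case_four_of_le hk0 hV0 (c.lt_top_of_contracting hk0 hk hV0 hV) h1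
    (fun τ hτ h' => (hc τ hτ h').1) (fun τ hτ h' => (hc τ hτ h').2.1) fun _ =>
      ⟨η, hη, fun τ hτ h' => ?_⟩
  exact le_abs.2 (Or.inr (by linarith [(hc τ hτ h').2.2]))

/-- The three signs of V₀ e^(λ l₀) - k² / 8 correspond to l increasing, constant and decreasing.
Only in the first may l fail to be bounded above, and then R e^(k² l) is bounded instead. -/
theorem case_four_of_lam_pos (h : IsMaximalSolution k V₀ l₀ φ₀ c₁ T s) (hk : 2 < k ^ 2)
    (hV : 0 < V₀) : T < ⊤ ∧ RadiusVanishes s T ∧ SpecificLengthVanishes s T ∧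
      (V₀ * Real.exp (lam k * l₀) ≠ k ^ 2 / 8 → HasCurvatureSingularity s T) ∧
      ReachedInFiniteAffineTime s T := by
  have hk0 : k ≠ 0 := by rintro rfl; norm_num at hk
  have hl : 0 < lam k := by rw [lam]; linarith
  have c := h.1.core
  have hT := c.lt_top_of_lam_pos hk hV
  obtain ⟨τ₁, h1, hneg⟩ := c.exists_x_neg_of_lt_top hk0 hV (h.isMaximalTime hk0) hT
  have hx := fun τ hτ h' => c.x_neg_of_x_neg hk.le h1 hneg (τ := τ) hτ h'
  rcases lt_trichotomy (V₀ * Real.exp (lam k * l₀)) (k ^ 2 / 8) with hW | hW | hW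
  · obtain ⟨η, hη, hy⟩ := c.exists_lt_sign_y hk0 hl hV hT (Or.inl rfl)
      (show 0 < 1 * (k ^ 2 / 8 - V₀ * Real.exp (lam k * l₀)) by linarith) h1
    have hy' : ∀ τ ∈ openDom T, τ₁ ≤ τ → η ≤ |s.R τ * deriv s.l τ| := fun τ hτ h' =>
      le_abs.2 (Or.inl (by linarith [hy τ hτ h']))
    have hR0 := c.tendsto_R_zero hk0 (h.isMaximalTime hk0) hT h1 hx
    rcases c.exists_bound_of_increasing hk hV hT hW h1 hx hR0 with ⟨L, hL⟩ | ⟨τ₂, h2, δ, B, hδ, hb⟩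
    · exact h.case_four_of_le hk0 hV hT h1 hx (fun τ hτ _ => hL τ hτ) fun _ => ⟨η, hη, hy'⟩
    · obtain ⟨τ₃, h3, h13, h23⟩ : ∃ τ₃ ∈ openDom T, τ₁ ≤ τ₃ ∧ τ₂ ≤ τ₃ := by
        rcases le_total τ₁ τ₂ with h | h
        · exact ⟨τ₂, h2, h, le_rfl⟩
        · exact ⟨τ₁, h1, le_rfl, h⟩
      exact ⟨hT, h.1.radiusVanishes_of_tendsto hR0, h.1.specificLengthVanishes hR0, fun _ =>
        h.1.hasCurvatureSingularity_of_collapse hk0 hV hR0 h3 hη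
          (fun τ hτ h' => hy' τ hτ (h13.trans h')) fun τ hτ h' => (hb τ hτ (h23.trans h')).2,
        h.1.reachedInFiniteAffineTime_of_mul_le h2 hδ (fun τ hτ h' => (hb τ hτ h').1)
          fun τ hτ h' => (hb τ hτ h').2⟩
  · exact h.case_four_of_le hk0 hV hT h1 hx (fun τ hτ _ => (c.l_eq_of_static hk hW hτ).le)
      fun hne => absurd hW hne
  · obtain ⟨η, hη, hy⟩ := c.exists_lt_sign_y hk0 hl hV hT (Or.inr rfl)
      (show 0 < -1 * (k ^ 2 / 8 - V₀ * Real.exp (lam k * l₀)) by linarith) h1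
    refine h.case_four_of_le hk0 hV hT h1 hx (fun τ hτ _ => c.l_le_of_y_nonpos hτ
      fun r hr hrτ => ?_) fun _ => ⟨η, hη, fun τ hτ h' => le_abs.2 (Or.inr (by linarith [hy τ hτ h']))⟩
    have := c.sign_y hk0 hl (σ := -1) (by linarith) (mem_openDom_of_le hτ hr hrτ.le)
    linarith

end IsMaximalSolution

end SelfSimilarCylinder

/-! ### The theorem: distribution of the parameter ranges over the cases -/

open SelfSimilarCylinder in
theorem theorem2p3 (k V₀ l₀ φ₀ c₁ : ℝ) (hk : k ≠ 0) (hV₀ : V₀ ≠ 0) :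
    (∃ (T : EReal) (s : Fields), IsMaximalSolution k V₀ l₀ φ₀ c₁ T s) ∧
    ∀ (T : EReal) (s : Fields), IsMaximalSolution k V₀ l₀ φ₀ c₁ T s →
      (2 < k ^ 2 ∧ V₀ < 0 →
        T < ⊤ ∧ IsRadialNullInfinity s T ∧ RicciScalarDecays s T) ∧
      (k ^ 2 = 2 ∧ V₀ < 0 →
        T = ⊤ ∧ IsRadialNullInfinity s T ∧ RicciScalarDecays s T) ∧
      ((k ^ 2 < 2 ∧ V₀ < 0) ∨
          (k ^ 2 < 2 ∧ 0 < V₀ ∧ V₀ * Real.exp (lam k * l₀) < k ^ 2 / 8) →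
        T = ⊤ ∧ RadiusFiniteNonzero s T ∧ PastNullConeIsRegular s ∧
          ReachedInFiniteAffineTime s T) ∧
      ((k ^ 2 < 2 ∧ 0 < V₀ ∧ k ^ 2 / 8 < V₀ * Real.exp (lam k * l₀)) ∨
          (2 < k ^ 2 ∧ 0 < V₀) ∨ (k ^ 2 = 2 ∧ 1 / 4 < V₀) →
        T < ⊤ ∧ RadiusVanishes s T ∧ SpecificLengthVanishes s T ∧
          (V₀ * Real.exp (lam k * l₀) ≠ k ^ 2 / 8 → HasCurvatureSingularity s T) ∧
          ReachedInFiniteAffineTime s T) ∧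
      ((k ^ 2 = 2 ∧ 0 < V₀ ∧ V₀ ≤ 1 / 4) ∨
          (k ^ 2 < 2 ∧ V₀ * Real.exp (lam k * l₀) = k ^ 2 / 8) →
        T = ⊤ ∧ RadiusVanishes s T ∧ HasCurvatureSingularity s T ∧
          ReachedInFiniteAffineTime s T) := by
  have hlam : k ^ 2 = 2 → V₀ * Real.exp (lam k * l₀) = V₀ := fun h => by
    rw [lam, h, div_self two_ne_zero, sub_self, zero_mul, Real.exp_zero, mul_one]
  refine ⟨exists_isMaximalSolution hk, fun T s h => ⟨fun h1 => h.case_one h1.1 h1.2,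
    fun h2 => h.case_two hk h2.1 h2.2, ?_, ?_, ?_⟩⟩
  · rintro (⟨h1, h2⟩ | ⟨h1, -, h2⟩)
    · refine h.case_three hk h1 ((mul_neg_of_neg_of_pos h2 (Real.exp_pos _)).trans ?_)
      positivity
    · exact h.case_three hk h1 h2
  · rintro (⟨h1, h2, h3⟩ | ⟨h1, h2⟩ | ⟨h1, h2⟩)
    · exact h.case_four_of_contracting hk h1.le h2 h3
    · exact h.case_four_of_lam_pos h1 h2
    · refine h.case_four_of_contracting hk h1.le (by linarith) ?_
      rw [hlam h1, h1]
      linarith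
  · rintro (⟨h1, h2, h3⟩ | ⟨h1, h2⟩)
    · rcases h3.lt_or_eq with h3 | h3
      · exact h.case_five_sq_eq_two hk h1 h2 h3
      -- At k² = 2 and V₀ = 1/4 the potential equals k² / 8, so this borderline belongs to the
      -- solutions with constant l.
      · refine h.case_five_const hk h1.le ?_
        rw [hlam h1, h1, h3]
        norm_num
    · exact h.case_five_const hk h1.le h2
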